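/- **Setting.** On a probability space let $Y(0),Y(1),Z$ be binary random variables, $V$ a real random variable, and $X$ a random element of a measurable space (the covariates), with law $F$. Let $e(0,\cdot),e(1,\cdot)$ be measurable functions with $0\le e(0,x)<e(1,x)\le 1$, and put $T=\mathbb 1\{V\le e(Z,X)\}$ and $Y=T\,Y(1)+(1-T)\,Y(0)$. Assume that, conditionally on $X=x$ for $F$-almost every $x$: $Y(0)\le Y(1)$ almost surely; $V$ is uniform on $[0,1]$; $Z$ is independent of $(Y(t),V)$ for $t=0$ and for $t=1$; and $0<\Pr(Z=1\mid X=x)<1$. (All infima, suprema and pointwise statements in $x$ are up to $F$-null sets.) Write $\mathcal P_{z_j}(x)=\Pr(Z=j\mid X=x)$, $\mathcal P_{t_k|z_j}(x)=\Pr(T=k\mid Z=j,X=x)$, $\mathcal P_{y_1|z_j}(x)=\Pr(Y=1\mid Z=j,X=x)$, $\mathcal P_{y_1|t_k,z_j}(x)=\Pr(Y=1\mid T=k,Z=j,X=x)$, and $$\tilde\theta_L(x)=\frac{\mathcal P_{y_1|z_1}(x)-\mathcal P_{y_1|z_0}(x)}{1-\mathcal P_{y_1|z_0}(x)},\qquad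 \theta_L=\int\tilde\theta_L(x)\,dF(x),$$ $$\tilde\theta^*(x)=\frac{\mathcal P_{y_1|z_1}(x)-\mathcal P_{y_1|z_0}(x)}{\Pr(Y=0,T=0\mid Z=0,X=x)-\Pr(Y=0,T=0\mid Z=1,X=x)},\qquad \theta^*=\int\tilde\theta^*(x)\,dF\{x\mid e(0,X)<V\le e(1,X)\}.$$ **Theorem.** Suppose $\inf_x e(0,x)>0$, $\sup_x e(1,x)<1$ and $\inf_x\Pr\{Y(0)=0\mid e(0,x)<V\le e(1,x),X=x\}>0$. (a) (*Well defined.*) $\mathcal P_{t_1|z_j}(x)=e(j,x)$ for almost every $x$. The denominators of $\tilde\theta_L(x)$ and $\tilde\theta^*(x)$ are positive and $\tilde\theta_L(x),\tilde\theta^*(x)\in[0,1]$ for almost every $x$; $\Pr\{e(0,X)<V\le e(1,X)\}>0$; and the integrals defining $\theta_L$ and $\theta^*$ exist. Moreover $\theta^*$ depends only on the law of $(Y,T,Z,X)$: $$\theta^*=\frac{\int\tilde\theta^*(x)\{e(1,x)-e(0,x)\}\,dF(x)}{\int\{e(1,x)-e(0,x)\}\,dF(x)}.$$ (b) If $\mathbb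 E\bigl[1/\{\mathcal P_{z_1}(X)\mathcal P_{z_0}(X)(1-\mathcal P_{y_1|z_0}(X))\}\bigr]<\infty$, then $\theta_L$, as a functional of the law of $(Y,Z,X)$, is pathwise differentiable, with pathwise derivative $$F_L(Y,Z,X)=\frac{Z}{\mathcal P_{z_1}(X)}\,\frac{Y-\mathcal P_{y_1|z_1}(X)}{1-\mathcal P_{y_1|z_0}(X)}+\frac{1-Z}{\mathcal P_{z_0}(X)}\,\frac{\{Y-\mathcal P_{y_1|z_0}(X)\}\{\tilde\theta_L(X)-1\}}{1-\mathcal P_{y_1|z_0}(X)}+\tilde\theta_L(X)-\theta_L .$$ (c) If $\mathbb E\bigl[1/\{\mathcal P_{z_1}(X)\mathcal P_{z_0}(X)\}\bigr]<\infty$, then $\theta^*$, as a functional of the law of $(Y,T,Z,X)$ given by the formula in (a), in which $e(j,x)$ is read as $\mathcal P_{t_1|z_j}(x)$, is pathwise differentiable, with pathwise derivative $F^*=\sum_{j=1}^7F_j^*$. Here, with $Q_1=\tilde\theta^*$, $Q_{1d}(x)$ the denominator of $\tilde\theta^*(x)$, $Q_{2d}=\int\{\mathcal P_{t_1|z_1}-\mathcal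 P_{t_1|z_0}\}\,dF$, $Q_2=\{\mathcal P_{t_1|z_1}-\mathcal P_{t_1|z_0}\}/Q_{2d}$, $S_2=\theta^*/Q_{2d}$, and all functions of $x$ evaluated at $X$, $$\begin{aligned} F_1^*&=\tfrac{TZ}{\mathcal P_{t_1|z_1}\mathcal P_{z_1}}\{Y-\mathcal P_{y_1|t_1,z_1}\}\tfrac{Q_2}{Q_{1d}}\mathcal P_{t_1|z_1},\\ F_2^*&=\tfrac{(1-T)Z}{\mathcal P_{t_0|z_1}\mathcal P_{z_1}}\{Y-\mathcal P_{y_1|t_0,z_1}\}\tfrac{Q_2}{Q_{1d}}(1-Q_1)\mathcal P_{t_0|z_1},\\ F_3^*&=-\tfrac{T(1-Z)}{\mathcal P_{t_1|z_0}\mathcal P_{z_0}}\{Y-\mathcal P_{y_1|t_1,z_0}\}\tfrac{Q_2}{Q_{1d}}\mathcal P_{t_1|z_0},\\ F_4^*&=-\tfrac{(1-T)(1-Z)}{\mathcal P_{t_0|z_0}\mathcal P_{z_0}}\{Y-\mathcal P_{y_1|t_0,z_0}\}\tfrac{Q_2}{Q_{1d}}(1-Q_1)\mathcal P_{t_0|z_0},\\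 F_5^*&=\tfrac{Z\{T-\mathcal P_{t_1|z_1}\}}{\mathcal P_{z_1}}\Bigl(\tfrac{Q_2}{Q_{1d}}\bigl[\mathcal P_{y_1|t_1,z_1}-(1-Q_1)\mathcal P_{y_1|t_0,z_1}-Q_1\bigr]+\tfrac{Q_1}{Q_{2d}}-S_2\Bigr),\\ F_6^*&=-\tfrac{(1-Z)\{T-\mathcal P_{t_1|z_0}\}}{\mathcal P_{z_0}}\Bigl(\tfrac{Q_2}{Q_{1d}}\bigl[\mathcal P_{y_1|t_1,z_0}-(1-Q_1)\mathcal P_{y_1|t_0,z_0}-Q_1\bigr]+\tfrac{Q_1}{Q_{2d}}-S_2\Bigr),\\ F_7^*&=Q_1Q_2-S_2\{\mathcal P_{t_1|z_1}-\mathcal P_{t_1|z_0}-Q_{2d}\}-\theta^* . \end{aligned}$$ In particular $F_L$ and $F^*$ depend only on the laws of $(Y,Z,X)$ and $(Y,T,Z,X)$, respectively. **Pathwise differentiability** of a parameter $\theta(\cdot)$ at a law $P_0$, with pathwise derivative $F$, means: $\mathbb E_{P_0}F=0$, $\mathbb E_{P_0}F^2<\infty$, and for every regular parametric submodel $(Q_\gamma)$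 through $Q_0=P_0$ with score $s$ the map $\gamma\mapsto\theta(Q_\gamma)$ is differentiable at $0$ with derivative $\mathbb E_{P_0}[F s]$. A regular parametric submodel is a family $(Q_\gamma)_{\gamma\in\mathbb R}$ of probability laws which, for $\gamma$ near $0$, have densities $q_\gamma$ with respect to a common $\sigma$-finite measure $\nu$, with $s\in L^2(P_0)$ and $\int(\sqrt{q_\gamma}-\sqrt{q_0}-\tfrac{\gamma}{2}s\sqrt{q_0})^2\,d\nu=o(\gamma^2)$, and along which the conditional parameter ($\tilde\theta_L$ in (b), $\tilde\theta^*$ in (c), computed under $Q_\gamma$) is bounded in absolute value by a constant $M\ge1$, almost everywhere and for all $\gamma$ near $0$. The constant $M$ may depend on the submodel; the bound holds with $M=1$ whenever the $Q_\gamma$ are laws of observables generated by models as above. Where an event conditioned on has conditional probability zero, or a denominator vanishes, under $Q_\gamma$, the conditional probability or quotient is read as $0$. -/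

import Mathlib

open MeasureTheory ProbabilityTheory Filter Topology

noncomputable section

namespace Persuasion

/-! ### Regular parametric submodels and pathwise derivatives -/

/-- `Q` is a regular (one-dimensional) parametric submodel through `P₀` at parameter value `0`,
with score `s`: the laws `Q γ` near `γ = 0` have densities with respect to a common σ-finite measure
`ν`, the score is square integrable, and the square roots of the densities are differentiable in
mean square at `γ = 0`, with derivative `s / 2` times the square root of the density of `P₀`. -/
structure IsRegularPath {E : Type*} [MeasurableSpace E] (P₀ : ProbabilityMeasure E)
    (Q : ℝ → ProbabilityMeasure E) (s : E → ℝ) : Prop where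
  start : Q 0 = P₀
  score_memLp : MemLp s 2 (P₀ : Measure E)
  mean_square_diff : ∃ ν : Measure E, SigmaFinite ν ∧
    (∀ᶠ γ in 𝓝 (0 : ℝ), (Q γ : Measure E) ≪ ν) ∧
    Tendsto (fun γ : ℝ =>
      (∫⁻ o, ENNReal.ofReal
        ((√((Q γ : Measure E).rnDeriv ν o).toReal - √((P₀ : Measure E).rnDeriv ν o).toReal
          - γ / 2 * s o * √((P₀ : Measure E).rnDeriv ν o).toReal) ^ 2) ∂ν)
        / ENNReal.ofReal (γ ^ 2))
      (𝓝[≠] 0) (𝓝 0)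

/-- `F` is a mean-zero pathwise derivative at `P₀` of the parameter `θ`, relative to the class `𝓜` of
laws: `F` has mean zero and finite second moment under `P₀`, and along every regular parametric
submodel of `𝓜` through `P₀`, with score `s`, the parameter is differentiable with derivative
`E[F s]`. -/
def IsPathwiseDerivative {E : Type*} [MeasurableSpace E] (𝓜 : Set (ProbabilityMeasure E))
    (θ : ProbabilityMeasure E → ℝ) (P₀ : ProbabilityMeasure E) (F : E → ℝ) : Prop :=
  MemLp F 2 (P₀ : Measure E) ∧ ∫ o, F o ∂(P₀ : Measure E) = 0 ∧
    ∀ (Q : ℝ → ProbabilityMeasure E) (s : E → ℝ), IsRegularPath P₀ Q s →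
      (∀ᶠ γ in 𝓝 (0 : ℝ), Q γ ∈ 𝓜) →
        HasDerivAt (fun γ => θ (Q γ)) (∫ o, F o * s o ∂(P₀ : Measure E)) 0

/-! ### Conditional probabilities given the covariates -/

/-- The numerical value of a binary variable. -/
def num (b : Bool) : ℝ := if b then 1 else 0

/-- `Pr(A | B, X = x)` for a law `Q` of `(X, W)` and events `A`, `B` on `W`. -/
def pr {𝒳 W : Type*} [MeasurableSpace 𝒳] [MeasurableSpace W] [StandardBorelSpace W] [Nonempty W]
    (Q : ProbabilityMeasure (𝒳 × W)) (x : 𝒳) (A B : Set W) : ℝ :=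
  (cond ((Q : Measure (𝒳 × W)).condKernel x) B).real A

/-- `Pr(Z = z | X = x)`, for a law of `(X, Z, W)`. -/
def prZ {𝒳 W : Type*} [MeasurableSpace 𝒳] [MeasurableSpace W] [StandardBorelSpace W] [Nonempty W]
    (Q : ProbabilityMeasure (𝒳 × Bool × W)) (z : Bool) (x : 𝒳) : ℝ :=
  pr Q x {w | w.1 = z} Set.univ

/-! ### The parameter `θ_L`, a functional of the law of `(X, Z, Y)` -/

/-- `Pr(Y = 1 | Z = z, X = x)`, for a law of `(X, Z, Y)`. -/
def prYL {𝒳 : Type*} [MeasurableSpace 𝒳] (Q : ProbabilityMeasure (𝒳 × Bool × Bool))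
    (z : Bool) (x : 𝒳) : ℝ :=
  pr Q x {w | w.2 = true} {w | w.1 = z}

/-- The conditional lower bound `θ̃_L(x)`. -/
def condThetaL {𝒳 : Type*} [MeasurableSpace 𝒳] (Q : ProbabilityMeasure (𝒳 × Bool × Bool))
    (x : 𝒳) : ℝ :=
  (prYL Q true x - prYL Q false x) / (1 - prYL Q false x)

/-- `θ_L = ∫ θ̃_L(x) dF(x)`, with `F` the marginal law of the covariates. -/
def thetaL {𝒳 : Type*} [MeasurableSpace 𝒳] (Q : ProbabilityMeasure (𝒳 × Bool × Bool)) : ℝ :=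
  ∫ x, condThetaL Q x ∂(Q : Measure (𝒳 × Bool × Bool)).fst

/-- The function `F_L(Y, Z, X)`, at the observation `o = (X, Z, Y)`. -/
def FL {𝒳 : Type*} [MeasurableSpace 𝒳] (Q : ProbabilityMeasure (𝒳 × Bool × Bool))
    (o : 𝒳 × Bool × Bool) : ℝ :=
  let x := o.1
  let Z := num o.2.1
  let Y := num o.2.2
  Z / prZ Q true x * ((Y - prYL Q true x) / (1 - prYL Q false x))
    + (1 - Z) / prZ Q false x
      * ((Y - prYL Q false x) * (condThetaL Q x - 1) / (1 - prYL Q false x))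
    + condThetaL Q x - thetaL Q

/-! ### The parameter `θ*`, a functional of the law of `(X, Z, T, Y)` -/

/-- `Pr(Y = 1 | Z = z, X = x)`, for a law of `(X, Z, T, Y)`. -/
def prY {𝒳 : Type*} [MeasurableSpace 𝒳] (Q : ProbabilityMeasure (𝒳 × Bool × Bool × Bool))
    (z : Bool) (x : 𝒳) : ℝ :=
  pr Q x {w | w.2.2 = true} {w | w.1 = z}

/-- `Pr(T = t | Z = z, X = x)`; the exposure rate when `t = 1`. -/
def prT {𝒳 : Type*} [MeasurableSpace 𝒳] (Q : ProbabilityMeasure (𝒳 × Bool × Bool × Bool))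
    (t z : Bool) (x : 𝒳) : ℝ :=
  pr Q x {w | w.2.1 = t} {w | w.1 = z}

/-- `Pr(Y = 1 | T = t, Z = z, X = x)`. -/
def prYT {𝒳 : Type*} [MeasurableSpace 𝒳] (Q : ProbabilityMeasure (𝒳 × Bool × Bool × Bool))
    (t z : Bool) (x : 𝒳) : ℝ :=
  pr Q x {w | w.2.2 = true} {w | w.2.1 = t ∧ w.1 = z}

/-- `Pr(Y = 0, T = 0 | Z = z, X = x)`. -/
def prY0T0 {𝒳 : Type*} [MeasurableSpace 𝒳] (Q : ProbabilityMeasure (𝒳 × Bool × Bool × Bool))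
    (z : Bool) (x : 𝒳) : ℝ :=
  pr Q x {w | w.2.2 = false ∧ w.2.1 = false} {w | w.1 = z}

/-- The conditional local persuasion rate `θ̃*(x)`. -/
def condThetaStar {𝒳 : Type*} [MeasurableSpace 𝒳]
    (Q : ProbabilityMeasure (𝒳 × Bool × Bool × Bool)) (x : 𝒳) : ℝ :=
  (prY Q true x - prY Q false x) / (prY0T0 Q false x - prY0T0 Q true x)

/-- The average `∫ {e(1,x) - e(0,x)} dF(x)` of the difference of the exposure rates. -/
def meanRateDiff {𝒳 : Type*} [MeasurableSpace 𝒳]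
    (Q : ProbabilityMeasure (𝒳 × Bool × Bool × Bool)) : ℝ :=
  ∫ x, (prT Q true true x - prT Q true false x) ∂(Q : Measure (𝒳 × Bool × Bool × Bool)).fst

/-- `∫ θ̃*(x) {e(1,x) - e(0,x)} dF(x) / ∫ {e(1,x) - e(0,x)} dF(x)`. -/
def thetaStar {𝒳 : Type*} [MeasurableSpace 𝒳]
    (Q : ProbabilityMeasure (𝒳 × Bool × Bool × Bool)) : ℝ :=
  (∫ x, condThetaStar Q x * (prT Q true true x - prT Q true false x)
      ∂(Q : Measure (𝒳 × Bool × Bool × Bool)).fst) / meanRateDiff Q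

/-- The function `F*(Y, T, Z, X)`, at the observation `o = (X, Z, T, Y)`. -/
def FStar {𝒳 : Type*} [MeasurableSpace 𝒳] (Q : ProbabilityMeasure (𝒳 × Bool × Bool × Bool))
    (o : 𝒳 × Bool × Bool × Bool) : ℝ :=
  let x := o.1
  let Z := num o.2.1
  let T := num o.2.2.1
  let Y := num o.2.2.2
  let Q₁ := condThetaStar Q x
  let Q₁d := prY0T0 Q false x - prY0T0 Q true x
  let Q₂d := meanRateDiff Q
  let Q₂ := (prT Q true true x - prT Q true false x) / Q₂d
  let S₂ := thetaStar Q / Q₂d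
  let F₁ := T * Z / (prT Q true true x * prZ Q true x) * (Y - prYT Q true true x)
    * (Q₂ / Q₁d) * prT Q true true x
  let F₂ := (1 - T) * Z / (prT Q false true x * prZ Q true x) * (Y - prYT Q false true x)
    * (Q₂ / Q₁d) * (1 - Q₁) * prT Q false true x
  let F₃ := -(T * (1 - Z) / (prT Q true false x * prZ Q false x)) * (Y - prYT Q true false x)
    * (Q₂ / Q₁d) * prT Q true false x
  let F₄ := -((1 - T) * (1 - Z) / (prT Q false false x * prZ Q false x))
    * (Y - prYT Q false false x) * (Q₂ / Q₁d) * (1 - Q₁) * prT Q false false x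
  let F₅ := Z * (T - prT Q true true x) / prZ Q true x
    * (Q₂ / Q₁d * (prYT Q true true x - (1 - Q₁) * prYT Q false true x - Q₁) + Q₁ / Q₂d - S₂)
  let F₆ := -((1 - Z) * (T - prT Q true false x) / prZ Q false x)
    * (Q₂ / Q₁d * (prYT Q true false x - (1 - Q₁) * prYT Q false false x - Q₁) + Q₁ / Q₂d - S₂)
  let F₇ := Q₁ * Q₂ - S₂ * (prT Q true true x - prT Q true false x - Q₂d) - thetaStar Q
  F₁ + F₂ + F₃ + F₄ + F₅ + F₆ + F₇

/-! ### The structural model of persuasion with covariates -/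

/-- The primitives: potential outcomes `Y(0)`, `Y(1)`, the latent resistance `V`, the instrument `Z`,
the covariates `X`, on a probability space, and the threshold function `e(z, x)`. -/
structure Model (Ω 𝒳 : Type*) [MeasurableSpace Ω] [MeasurableSpace 𝒳] where
  P : ProbabilityMeasure Ω
  Y0 : Ω → Bool
  Y1 : Ω → Bool
  V : Ω → ℝ
  Z : Ω → Bool
  X : Ω → 𝒳
  e : Bool → 𝒳 → ℝ
  measurable_Y0 : Measurable Y0
  measurable_Y1 : Measurable Y1
  measurable_V : Measurable V
  measurable_Z : Measurable Z
  measurable_X : Measurable X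
  measurable_e : ∀ z, Measurable (e z)

namespace Model

/-- Exposure `T = 1{V ≤ e(Z, X)}`. -/
def T {Ω 𝒳 : Type*} [MeasurableSpace Ω] [MeasurableSpace 𝒳] (S : Model Ω 𝒳) (ω : Ω) : Bool :=
  decide (S.V ω ≤ S.e (S.Z ω) (S.X ω))

/-- The observed outcome `Y = T Y(1) + (1 - T) Y(0)`. -/
def Y {Ω 𝒳 : Type*} [MeasurableSpace Ω] [MeasurableSpace 𝒳] (S : Model Ω 𝒳) (ω : Ω) : Bool :=
  if S.T ω then S.Y1 ω else S.Y0 ω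

theorem measurable_T {Ω 𝒳 : Type*} [MeasurableSpace Ω] [MeasurableSpace 𝒳] (S : Model Ω 𝒳) :
    Measurable S.T := by
  have he : Measurable fun ω => S.e (S.Z ω) (S.X ω) :=
    (measurable_from_prod_countable_right (f := fun p : Bool × 𝒳 => S.e p.1 p.2)
      S.measurable_e).comp (S.measurable_Z.prodMk S.measurable_X)
  refine measurable_to_bool ?_
  have : S.T ⁻¹' {true} = {ω | S.V ω ≤ S.e (S.Z ω) (S.X ω)} := by
    ext ω; simp [T]
  rw [this]
  exact measurableSet_le S.measurable_V he

theorem measurable_Y {Ω 𝒳 : Type*} [MeasurableSpace Ω] [MeasurableSpace 𝒳] (S : Model Ω 𝒳) :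
    Measurable S.Y :=
  Measurable.ite (S.measurable_T (measurableSet_singleton true)) S.measurable_Y1 S.measurable_Y0

/-- The law of the covariates. -/
def covLaw {Ω 𝒳 : Type*} [MeasurableSpace Ω] [MeasurableSpace 𝒳] (S : Model Ω 𝒳) : Measure 𝒳 :=
  (S.P : Measure Ω).map S.X

/-- The conditional law of `(Y(0), Y(1), V, Z)` given `X = x`. -/
def latentLaw {Ω 𝒳 : Type*} [MeasurableSpace Ω] [MeasurableSpace 𝒳] (S : Model Ω 𝒳) (x : 𝒳) :
    Measure (Bool × Bool × ℝ × Bool) :=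
  condDistrib (fun ω => (S.Y0 ω, S.Y1 ω, S.V ω, S.Z ω)) S.X (S.P : Measure Ω) x

/-- The law of the observed `(X, Z, Y)`. -/
def lawXZY {Ω 𝒳 : Type*} [MeasurableSpace Ω] [MeasurableSpace 𝒳] (S : Model Ω 𝒳) :
    ProbabilityMeasure (𝒳 × Bool × Bool) :=
  S.P.map (f := fun ω => (S.X ω, S.Z ω, S.Y ω))
    (S.measurable_X.prodMk (S.measurable_Z.prodMk S.measurable_Y)).aemeasurable

/-- The law of the observed `(X, Z, T, Y)`. -/
def lawXZTY {Ω 𝒳 : Type*} [MeasurableSpace Ω] [MeasurableSpace 𝒳] (S : Model Ω 𝒳) :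
    ProbabilityMeasure (𝒳 × Bool × Bool × Bool) :=
  S.P.map (f := fun ω => (S.X ω, S.Z ω, S.T ω, S.Y ω))
    (S.measurable_X.prodMk
      (S.measurable_Z.prodMk (S.measurable_T.prodMk S.measurable_Y))).aemeasurable

/-- The event that the individual is a complier, `e(0, X) < V ≤ e(1, X)`. -/
def complier {Ω 𝒳 : Type*} [MeasurableSpace Ω] [MeasurableSpace 𝒳] (S : Model Ω 𝒳) : Set Ω :=
  {ω | S.e false (S.X ω) < S.V ω ∧ S.V ω ≤ S.e true (S.X ω)}

/-- The conditional law of the covariates given that the individual is a complier. -/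
def complierCovLaw {Ω 𝒳 : Type*} [MeasurableSpace Ω] [MeasurableSpace 𝒳] (S : Model Ω 𝒳) :
    Measure 𝒳 :=
  (cond (S.P : Measure Ω) S.complier).map S.X

/-- `θ* = ∫ θ̃*(x) dF{x | e(0, X) < V ≤ e(1, X)}`. -/
def localRate {Ω 𝒳 : Type*} [MeasurableSpace Ω] [MeasurableSpace 𝒳] (S : Model Ω 𝒳) : ℝ :=
  ∫ x, condThetaStar S.lawXZTY x ∂S.complierCovLaw

/-- `Pr{Y(0) = 0 | e(0, x) < V ≤ e(1, x), X = x}`. -/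
def complierNonPersuaded {Ω 𝒳 : Type*} [MeasurableSpace Ω] [MeasurableSpace 𝒳] (S : Model Ω 𝒳)
    (x : 𝒳) : ℝ :=
  (cond (S.latentLaw x) {w | S.e false x < w.2.2.1 ∧ w.2.2.1 ≤ S.e true x}).real {w | w.1 = false}

/-- The standing assumptions, conditional on `X = x` for almost every `x`: monotone treatment
response, uniform `V`, exogeneity of the instrument, no defiers; and both values of the instrument
have positive conditional probability. -/
structure Assumptions {Ω 𝒳 : Type*} [MeasurableSpace Ω] [MeasurableSpace 𝒳] (S : Model Ω 𝒳) :
    Prop where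
  monotone : ∀ᵐ x ∂S.covLaw, ∀ᵐ w ∂S.latentLaw x, w.1 ≤ w.2.1
  uniform : ∀ᵐ x ∂S.covLaw, (S.latentLaw x).map (fun w => w.2.2.1) = volume.restrict (Set.Icc 0 1)
  exogenous0 : ∀ᵐ x ∂S.covLaw,
    IndepFun (fun w => (w.1, w.2.2.1)) (fun w => w.2.2.2) (S.latentLaw x)
  exogenous1 : ∀ᵐ x ∂S.covLaw,
    IndepFun (fun w => (w.2.1, w.2.2.1)) (fun w => w.2.2.2) (S.latentLaw x)
  rates : ∀ᵐ x ∂S.covLaw, 0 ≤ S.e false x ∧ S.e false x < S.e true x ∧ S.e true x ≤ 1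
  instrument : ∀ᵐ x ∂S.covLaw, ∀ z, 0 < (S.latentLaw x).real {w | w.2.2.2 = z}

end Model

end Persuasion

end

/-! Apart from X, everything observed takes finitely many values. Hence a law of (X, W) is a
covariate law together with conditional cell probabilities k'(x, ·), and against μ ⊗ counting
measure its density is g(x) k'(x, w). Both parameters are built from averages ∫ g Φ(k') dμ of
functionals Φ that are invariant under positive scaling. With f and k the corresponding objects at P
and b = (g/f) k', the integrand g Φ(k') equals f (∑ b) Φ(b). It therefore suffices to expand (∑ b)
Φ(b) around b = k in each fiber, with an error that survives integration (`HasFiberDeriv`,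
`hasDerivAt_average`).

The error is measured by the Hellinger distance d = ‖√b - √k‖, because mean square differentiability
says exactly that ∫ f d² dμ is O(γ²) and that √b - √k is (γ/2) s √k up to a negligible term. The
instrument probabilities may be arbitrarily small, so the relevant local scale is u = √ω d, with ω
the integrable inverse weight of the moment assumption. The natural quadratic error u² = ω d² need
not integrate to o(γ). What is proved instead is an error of order u min(1, K d) + d² with K(x)
merely finite. Where ω, K ≤ N this is at most a multiple of d², which contributes O(γ²). Elsewhere
√ω d is at most (|γ|/η) ω + (η/|γ|) d², which contributes |γ| times a quantity made small by taking
first η small and then N large. The bound M on the conditional parameter along the submodel covers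
fibers where u is not small and no expansion is available (`hasFiberDeriv_of_near`).

For θ̃_L the weight is ω = 1/{p₁ p₀ (1 - y₀)}, where p_z and y_z are the conditional probabilities
of Z = z and of Y = 1 given Z = z. One power of 1 - y₀ suffices, since the Bernoulli variance y(1 -
y) cancels the other. For θ*, numerator and denominator are expanded separately and combined by the
quotient rule. The denominator d* of θ̃* can be arbitrarily small, but the weight Δ = e(1, ·) - e(0,
·) is at most R d*, where 1/R is the lower bound on the share of compliers with Y(0) = 0. So Δ θ̃*
has an integrable influence function although θ̃* itself is only Lipschitz at scale u/d*; this is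
why K = √ω/d* is allowed to be non-integrable. The terms F₁*, …, F₆* collapse algebraically to the
influence functions of arm means of T, Y and 1{T = 0, Y = 0} (`FStar_eq`).

The structural model enters only through identities for the conditional latent law. Moving the
threshold from e(0, x) to e(1, x) affects exactly those with V in between. This identifies the
numerators and denominators, gives their signs and order by monotonicity, and shows that the
covariate law of compliers has density proportional to e(1, x) - e(0, x). -/

noncomputable section

namespace Persuasion

set_option linter.unusedSectionVars false

/-! ### Laws on 𝒳 × W with W finite: cell probabilities, densities and dominating measures. -/

section CellProb

variable {𝒳 W : Type*} [MeasurableSpace 𝒳] [MeasurableSpace W] [StandardBorelSpace W] [Nonempty W]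

/-- The conditional probability of the cell `{w}` given `X = x`, for a law of `(X, W)`. -/
def cellProb (Q : ProbabilityMeasure (𝒳 × W)) (x : 𝒳) (w : W) : ℝ :=
  ((Q : Measure (𝒳 × W)).condKernel x).real {w}

theorem cellProb_nonneg (Q : ProbabilityMeasure (𝒳 × W)) (x : 𝒳) (w : W) : 0 ≤ cellProb Q x w :=
  measureReal_nonneg

theorem ofReal_cellProb (Q : ProbabilityMeasure (𝒳 × W)) (x : 𝒳) (w : W) :
    ENNReal.ofReal (cellProb Q x w) = (Q : Measure (𝒳 × W)).condKernel x {w} :=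
  ofReal_measureReal

theorem measurable_cellProb (Q : ProbabilityMeasure (𝒳 × W)) (w : W) :
    Measurable fun x => cellProb Q x w :=
  (Kernel.measurable_coe _ (measurableSet_singleton w)).ennreal_toReal

variable [Fintype W]

theorem sum_cellProb (Q : ProbabilityMeasure (𝒳 × W)) (x : 𝒳) : ∑ w, cellProb Q x w = 1 := by
  simp only [cellProb]
  rw [sum_measureReal_singleton]
  simp

theorem measurable_cellProb_uncurry (Q : ProbabilityMeasure (𝒳 × W)) :
    Measurable fun o : 𝒳 × W => cellProb Q o.1 o.2 :=
  measurable_from_prod_countable_left fun w => measurable_cellProb Q w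

theorem lintegral_eq_lintegral_sum_cellProb (Q : ProbabilityMeasure (𝒳 × W))
    {f : 𝒳 × W → ENNReal} (hf : Measurable f) :
    ∫⁻ o, f o ∂(Q : Measure (𝒳 × W))
      = ∫⁻ x, ∑ w, ENNReal.ofReal (cellProb Q x w) * f (x, w) ∂(Q : Measure (𝒳 × W)).fst := by
  rw [← Measure.lintegral_condKernel hf]
  refine lintegral_congr fun x => ?_
  rw [lintegral_fintype]
  simp [ofReal_cellProb, mul_comm]

theorem integral_eq_integral_sum_cellProb (Q : ProbabilityMeasure (𝒳 × W))
    {f : 𝒳 × W → ℝ} (hf : Integrable f (Q : Measure (𝒳 × W))) :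
    ∫ o, f o ∂(Q : Measure (𝒳 × W))
      = ∫ x, ∑ w, cellProb Q x w * f (x, w) ∂(Q : Measure (𝒳 × W)).fst := by
  rw [← Measure.integral_condKernel hf]
  refine integral_congr_ae (.of_forall fun x => ?_)
  simp only
  rw [integral_fintype (Integrable.of_finite)]
  simp [cellProb]

/-- The density of the covariates' law with respect to `μ`, as a real function. -/
def covDensity (Q : ProbabilityMeasure (𝒳 × W)) (μ : Measure 𝒳) (x : 𝒳) : ℝ :=
  ((Q : Measure (𝒳 × W)).fst.rnDeriv μ x).toReal

theorem covDensity_nonneg (Q : ProbabilityMeasure (𝒳 × W)) (μ : Measure 𝒳) (x : 𝒳) :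
    0 ≤ covDensity Q μ x := ENNReal.toReal_nonneg

theorem measurable_covDensity (Q : ProbabilityMeasure (𝒳 × W)) (μ : Measure 𝒳) :
    Measurable (covDensity Q μ) := (Measure.measurable_rnDeriv _ _).ennreal_toReal

theorem ae_ofReal_covDensity (Q : ProbabilityMeasure (𝒳 × W)) (μ : Measure 𝒳) [SigmaFinite μ] :
    ∀ᵐ x ∂μ, ENNReal.ofReal (covDensity Q μ x) = (Q : Measure (𝒳 × W)).fst.rnDeriv μ x := by
  filter_upwards [Measure.rnDeriv_lt_top (Q : Measure (𝒳 × W)).fst μ] with x hx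
  exact ENNReal.ofReal_toReal hx.ne

theorem lintegral_fst_eq (Q : ProbabilityMeasure (𝒳 × W)) (μ : Measure 𝒳) [SigmaFinite μ]
    (hQ : (Q : Measure (𝒳 × W)).fst ≪ μ) {f : 𝒳 → ENNReal} (hf : Measurable f) :
    ∫⁻ x, f x ∂(Q : Measure (𝒳 × W)).fst
      = ∫⁻ x, ENNReal.ofReal (covDensity Q μ x) * f x ∂μ := by
  rw [← lintegral_rnDeriv_mul hQ hf.aemeasurable]
  refine lintegral_congr_ae ?_
  filter_upwards [ae_ofReal_covDensity Q μ] with x hx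
  rw [hx]

theorem integral_fst_eq (Q : ProbabilityMeasure (𝒳 × W)) (μ : Measure 𝒳) [SigmaFinite μ]
    (hQ : (Q : Measure (𝒳 × W)).fst ≪ μ) (f : 𝒳 → ℝ) :
    ∫ x, f x ∂(Q : Measure (𝒳 × W)).fst = ∫ x, covDensity Q μ x * f x ∂μ := by
  rw [← integral_rnDeriv_smul hQ]
  rfl

theorem integrable_fst_iff (Q : ProbabilityMeasure (𝒳 × W)) (μ : Measure 𝒳) [SigmaFinite μ]
    (hQ : (Q : Measure (𝒳 × W)).fst ≪ μ) (f : 𝒳 → ℝ) :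
    Integrable (fun x => covDensity Q μ x * f x) μ ↔
      Integrable f (Q : Measure (𝒳 × W)).fst := by
  rw [← integrable_rnDeriv_smul_iff hQ]
  rfl

/-- Null sets of the covariate law are μ-null only where its density is positive, so fiberwise
hypotheses transfer to μ on that set; the region where the density vanishes has to be handled by
hand. -/
theorem ae_imp_of_ae_fst (Q : ProbabilityMeasure (𝒳 × W)) (μ : Measure 𝒳) [SigmaFinite μ]
    (hQ : (Q : Measure (𝒳 × W)).fst ≪ μ) {p : 𝒳 → Prop}
    (hp : ∀ᵐ x ∂(Q : Measure (𝒳 × W)).fst, p x) :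
    ∀ᵐ x ∂μ, 0 < covDensity Q μ x → p x := by
  rw [← Measure.withDensity_rnDeriv_eq _ _ hQ,
    ae_withDensity_iff (Measure.measurable_rnDeriv _ _)] at hp
  filter_upwards [hp] with x hx h0
  exact hx fun h => by simp [covDensity, h] at h0

/-- Disintegration: both measures give the same integral to every nonnegative test function, since
integrating over the counting measure is summing over the cells. -/
theorem rnDeriv_prod_count (Q : ProbabilityMeasure (𝒳 × W)) (μ : Measure 𝒳) [SigmaFinite μ]
    (hQ : (Q : Measure (𝒳 × W)).fst ≪ μ) :
    (Q : Measure (𝒳 × W)).rnDeriv (μ.prod Measure.count) =ᵐ[μ.prod Measure.count]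
      fun o => ENNReal.ofReal (covDensity Q μ o.1 * cellProb Q o.1 o.2) := by
  have hm : Measurable fun o : 𝒳 × W =>
      ENNReal.ofReal (covDensity Q μ o.1 * cellProb Q o.1 o.2) :=
    (((measurable_covDensity Q μ).comp measurable_fst).mul
      (measurable_cellProb_uncurry Q)).ennreal_ofReal
  have : (Q : Measure (𝒳 × W)) = (μ.prod Measure.count).withDensity
      fun o => ENNReal.ofReal (covDensity Q μ o.1 * cellProb Q o.1 o.2) := by
    refine Measure.ext_of_lintegral _ fun f hf => ?_
    have h1 : Measurable fun x => ∑ w, ENNReal.ofReal (cellProb Q x w) * f (x, w) :=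
      Finset.measurable_sum _ fun w _ => (measurable_cellProb Q w).ennreal_ofReal.mul
        (hf.comp (measurable_id.prodMk measurable_const))
    rw [lintegral_eq_lintegral_sum_cellProb Q hf, lintegral_fst_eq Q μ hQ h1,
      lintegral_withDensity_eq_lintegral_mul _ hm hf, lintegral_prod _ (hm.mul hf).aemeasurable]
    refine lintegral_congr fun x => ?_
    rw [lintegral_count, tsum_fintype, Finset.mul_sum]
    refine Finset.sum_congr rfl fun w _ => ?_
    simp only [Pi.mul_apply]
    rw [ENNReal.ofReal_mul (covDensity_nonneg _ _ _), mul_assoc]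
  conv_lhs => rw [this]
  exact Measure.rnDeriv_withDensity _ hm

/-- Counting measure charges every point, so almost every section of a null set of the product is
empty. -/
theorem absolutelyContinuous_fst_prod_count (ν : Measure (𝒳 × W)) :
    ν ≪ ν.fst.prod Measure.count := by
  refine Measure.AbsolutelyContinuous.mk fun A hA h0 => ?_
  rw [Measure.measure_prod_null hA] at h0
  have h1 : ∀ᵐ o ∂ν, Measure.count (Prod.mk o.1 ⁻¹' A : Set W) = 0 :=
    ae_of_ae_map measurable_fst.aemeasurable h0
  rw [measure_eq_zero_iff_ae_notMem]
  filter_upwards [h1] with o ho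
  rw [Measure.count_eq_zero_iff] at ho
  intro hoA
  have : o.2 ∈ (Prod.mk o.1 ⁻¹' A : Set W) := hoA
  simp [ho] at this

/-- Square roots of densities scale by √(dν/dκ), and the integrand is quadratic in them, so it
scales by dν/dκ. -/
theorem lintegral_hellinger_change {E : Type*} [MeasurableSpace E] {P Q ν κ : Measure E}
    [SigmaFinite P] [SigmaFinite Q] [SigmaFinite ν] [SigmaFinite κ]
    (hP : P ≪ ν) (hQ : Q ≪ ν) (hν : ν ≪ κ) {s : E → ℝ} (hs : Measurable s) (c : ℝ) :
    ∫⁻ o, ENNReal.ofReal ((√(Q.rnDeriv ν o).toReal - √(P.rnDeriv ν o).toReal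
        - c * s o * √(P.rnDeriv ν o).toReal) ^ 2) ∂ν
      = ∫⁻ o, ENNReal.ofReal ((√(Q.rnDeriv κ o).toReal - √(P.rnDeriv κ o).toReal
        - c * s o * √(P.rnDeriv κ o).toReal) ^ 2) ∂κ := by
  rw [← lintegral_rnDeriv_mul hν]
  · refine lintegral_congr_ae ?_
    filter_upwards [Measure.rnDeriv_mul_rnDeriv (κ := κ) hP,
      Measure.rnDeriv_mul_rnDeriv (κ := κ) hQ, Measure.rnDeriv_lt_top ν κ] with o h1 h2 h3
    rw [← h1, ← h2]
    simp only [Pi.mul_apply, ENNReal.toReal_mul]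
    conv_lhs => rw [← ENNReal.ofReal_toReal h3.ne]
    rw [← ENNReal.ofReal_mul ENNReal.toReal_nonneg, Real.sqrt_mul ENNReal.toReal_nonneg,
      Real.sqrt_mul ENNReal.toReal_nonneg]
    congr 1
    have := Real.sq_sqrt (ENNReal.toReal_nonneg (a := ν.rnDeriv κ o))
    linear_combination (-(√(Q.rnDeriv ν o).toReal - √(P.rnDeriv ν o).toReal
        - c * s o * √(P.rnDeriv ν o).toReal) ^ 2) * this
  · have := Measure.measurable_rnDeriv Q ν
    have := Measure.measurable_rnDeriv P ν
    fun_prop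

/-- The score enters only multiplied by the root density of P₀, which vanishes wherever the almost
sure equality says nothing. This allows a measurable version of the score. -/
theorem IsRegularPath.congr_score {E : Type*} [MeasurableSpace E] {P₀ : ProbabilityMeasure E}
    {Q : ℝ → ProbabilityMeasure E} {s s' : E → ℝ} (h : IsRegularPath P₀ Q s)
    (hs : s =ᵐ[(P₀ : Measure E)] s') : IsRegularPath P₀ Q s' := by
  obtain ⟨ν, hν, hac, hlim⟩ := h.mean_square_diff
  refine ⟨h.start, (memLp_congr_ae hs).1 h.score_memLp, ν, hν, hac, ?_⟩
  have hP : (P₀ : Measure E) ≪ ν := by have := hac.self_of_nhds; rwa [h.start] at this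
  refine hlim.congr fun γ => ?_
  congr 1
  refine lintegral_congr_ae ?_
  rw [Filter.EventuallyEq, ← Measure.withDensity_rnDeriv_eq _ _ hP,
    ae_withDensity_iff (Measure.measurable_rnDeriv _ _)] at hs
  filter_upwards [hs] with o ho
  by_cases h0 : (P₀ : Measure E).rnDeriv ν o = 0
  · simp [h0]
  · rw [ho h0]

/-- A regular submodel on `𝒳 × W`, with `W` finite, is differentiable in mean square with respect to
a product of a finite measure and the counting measure. -/
theorem IsRegularPath.exists_cov_dominating {P₀ : ProbabilityMeasure (𝒳 × W)}
    {Q : ℝ → ProbabilityMeasure (𝒳 × W)} {s : 𝒳 × W → ℝ} (h : IsRegularPath P₀ Q s)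
    (hs : Measurable s) :
    ∃ μ : Measure 𝒳, IsFiniteMeasure μ ∧
      (∀ᶠ γ in 𝓝 (0 : ℝ), (Q γ : Measure (𝒳 × W)).fst ≪ μ) ∧
      Tendsto (fun γ : ℝ => (∫⁻ x, ENNReal.ofReal (∑ w,
        (√(covDensity (Q γ) μ x * cellProb (Q γ) x w) - √(covDensity P₀ μ x * cellProb P₀ x w)
          - γ / 2 * s (x, w) * √(covDensity P₀ μ x * cellProb P₀ x w)) ^ 2) ∂μ)
        / ENNReal.ofReal (γ ^ 2)) (𝓝[≠] 0) (𝓝 0) := by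
  obtain ⟨ν, hν, hac, hlim⟩ := h.mean_square_diff
  -- The first marginal of a σ-finite measure need not be σ-finite; passing to an equivalent finite
  -- measure first makes the marginal finite.
  have hνμ : ν ≪ ν.toFinite.fst.prod Measure.count :=
    (absolutelyContinuous_toFinite ν).trans (absolutelyContinuous_fst_prod_count _)
  have hfst : ∀ R : ProbabilityMeasure (𝒳 × W), (R : Measure (𝒳 × W)) ≪ ν →
      (R : Measure (𝒳 × W)).fst ≪ ν.toFinite.fst := fun R hR =>
    (hR.trans (absolutelyContinuous_toFinite ν)).map measurable_fst
  refine ⟨ν.toFinite.fst, inferInstance, hac.mono fun γ hγ => hfst _ hγ, ?_⟩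
  have hP : (P₀ : Measure (𝒳 × W)) ≪ ν := by have := hac.self_of_nhds; rwa [h.start] at this
  refine hlim.congr' ?_
  filter_upwards [hac.filter_mono nhdsWithin_le_nhds] with γ hγ
  congr 1
  rw [lintegral_hellinger_change hP hγ hνμ hs]
  have e1 := rnDeriv_prod_count P₀ ν.toFinite.fst (hfst _ hP)
  have e2 := rnDeriv_prod_count (Q γ) ν.toFinite.fst (hfst _ hγ)
  have m1 : ∀ R : ProbabilityMeasure (𝒳 × W),
      Measurable fun o : 𝒳 × W => covDensity R ν.toFinite.fst o.1 * cellProb R o.1 o.2 :=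
    fun R => ((measurable_covDensity R _).comp measurable_fst).mul (measurable_cellProb_uncurry R)
  have := m1 P₀
  have := m1 (Q γ)
  rw [lintegral_congr_ae (g := fun o => ENNReal.ofReal
    ((√(covDensity (Q γ) ν.toFinite.fst o.1 * cellProb (Q γ) o.1 o.2)
      - √(covDensity P₀ ν.toFinite.fst o.1 * cellProb P₀ o.1 o.2)
      - γ / 2 * s o * √(covDensity P₀ ν.toFinite.fst o.1 * cellProb P₀ o.1 o.2)) ^ 2))]
  · rw [lintegral_prod _ (by fun_prop)]
    refine lintegral_congr fun x => ?_
    rw [lintegral_count, tsum_fintype, ENNReal.ofReal_sum_of_nonneg fun w _ => sq_nonneg _]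
  · filter_upwards [e1, e2] with o h1 h2
    rw [h1, h2, ENNReal.toReal_ofReal, ENNReal.toReal_ofReal]
    · exact mul_nonneg (covDensity_nonneg _ _ _) (cellProb_nonneg _ _ _)
    · exact mul_nonneg (covDensity_nonneg _ _ _) (cellProb_nonneg _ _ _)

end CellProb

/-! ### Differentiability of averages of conditional functionals -/

/-- The functional `Φ` of a finite vector of cell weights is differentiable in mean square at `k` with
derivative `F`, with an explicit remainder that is quadratic near `k`, along the vectors at which
`Ψ` is bounded by `M`. -/
def HasFiberDeriv {W : Type*} [Fintype W] (Φ Ψ : (W → ℝ) → ℝ) (k F : W → ℝ) (ω K M C : ℝ) : Prop :=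
  ∀ b : W → ℝ, (∀ w, 0 ≤ b w) → |Ψ b| ≤ M →
    |(∑ w, b w) * Φ b - Φ k - ∑ w, F w * (2 * √(k w) * (√(b w) - √(k w)))|
      ≤ C * (√ω * √(∑ w, (√(b w) - √(k w)) ^ 2) * min 1 (K * √(∑ w, (√(b w) - √(k w)) ^ 2))
        + ∑ w, (√(b w) - √(k w)) ^ 2)

/-- Weighted AM–GM; the free weight c is what later trades powers of |γ| against η. -/
theorem two_mul_abs_mul_le {c x y : ℝ} (hc : 0 < c) : 2 * |x * y| ≤ c * x ^ 2 + y ^ 2 / c := by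
  have h : 0 ≤ (c * |x| - |y|) ^ 2 / c := by positivity
  have e : (c * |x| - |y|) ^ 2 / c = c * x ^ 2 + y ^ 2 / c - 2 * |x * y| := by
    rw [← sq_abs x, ← sq_abs y, abs_mul]; field_simp; ring
  linarith

/-- The fiber expansion at b = (g/f) k', multiplied by f. The result is additive in quantities whose
μ-integrals are known: the Hellinger term, the tail of ω, the second moment of F and the mean square
remainder. The parameters N (truncation) and η (AM–GM weight) stay free. -/
theorem fiber_scaled_bound {W : Type*} [Fintype W] {Φ Ψ : (W → ℝ) → ℝ} {k k' F σ : W → ℝ}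
    {ω K M C f g : ℝ} (h : 0 < f → HasFiberDeriv Φ Ψ k F ω K M C) (hΦΨ : ∀ b : W → ℝ, (∀ w, 0 ≤ b w) → |Φ b| ≤ |Ψ b|) (hΨ0 : Ψ 0 = 0)
    (hΦ : ∀ c : ℝ, 0 < c → ∀ b, Φ (fun w => c * b w) = Φ b)
    (hΨ : ∀ c : ℝ, 0 < c → ∀ b, Ψ (fun w => c * b w) = Ψ b)
    (hk : ∀ w, 0 ≤ k w) (hk' : ∀ w, 0 ≤ k' w) (hk'1 : ∑ w, k' w = 1)
    (hω : 0 ≤ ω) (hM : 0 ≤ M) (hC : 0 ≤ C)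
    (hf : 0 ≤ f) (hg : 0 ≤ g) (hgM : 0 < g → |Ψ k'| ≤ M)
    {N η γ : ℝ} (hN : 1 ≤ N) (hη : 0 < η) (hγ : γ ≠ 0) :
    |g * Φ k' - f * Φ k - γ * ∑ w, f * k w * (F w * σ w)|
      ≤ (C * N ^ 2 + C + M + C * (η / |γ|)) * ∑ w, (√(g * k' w) - √(f * k w)) ^ 2
        + C * (|γ| / η) * (f * (if ω ≤ N ∧ K ≤ N then 0 else ω))
        + |γ| * η * (f * ∑ w, k w * F w ^ 2)
        + (∑ w, (√(g * k' w) - √(f * k w) - γ / 2 * σ w * √(f * k w)) ^ 2) / (η * |γ|) := by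
  have hγ' : 0 < |γ| := abs_pos.2 hγ
  set D2 := ∑ w, (√(g * k' w) - √(f * k w)) ^ 2 with hD2
  have hD2nn : 0 ≤ D2 := Finset.sum_nonneg fun w _ => sq_nonneg _
  set I : ℝ := if ω ≤ N ∧ K ≤ N then 0 else ω with hI
  have hInn : 0 ≤ I := by rw [hI]; split_ifs <;> simp [hω]
  have hVnn : 0 ≤ ∑ w, k w * F w ^ 2 :=
    Finset.sum_nonneg fun w _ => mul_nonneg (hk w) (sq_nonneg _)
  set r := ∑ w, (√(g * k' w) - √(f * k w) - γ / 2 * σ w * √(f * k w)) ^ 2 with hr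
  have hrnn : 0 ≤ r := Finset.sum_nonneg fun w _ => sq_nonneg _
  -- Where f = 0 there is no expansion, but then the Hellinger term equals g, so the bound M on Ψ
  -- controls everything.
  rcases hf.eq_or_lt with rfl | hf
  · have hD : D2 = g := by
      rw [hD2]
      simp only [zero_mul, Real.sqrt_zero, sub_zero]
      rw [Finset.sum_congr rfl fun w _ => Real.sq_sqrt (mul_nonneg hg (hk' w)),
        ← Finset.mul_sum, hk'1, mul_one]
    have h1 : |g * Φ k'| ≤ M * D2 := by
      rw [hD, abs_mul, abs_of_nonneg hg, mul_comm]
      rcases hg.eq_or_lt with rfl | hg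
      · simp
      · exact mul_le_mul_of_nonneg_right ((hΦΨ _ hk').trans (hgM hg)) hg.le
    simp only [zero_mul, Finset.sum_const_zero, mul_zero, sub_zero, add_zero]
    have h2 : 0 ≤ (C * N ^ 2 + C + C * (η / |γ|)) * D2 := by positivity
    have h3 : 0 ≤ r / (η * |γ|) := by positivity
    linarith
  set b : W → ℝ := fun w => g / f * k' w with hb
  have hbnn : ∀ w, 0 ≤ b w := fun w => mul_nonneg (div_nonneg hg hf.le) (hk' w)
  have hΦb : |Ψ b| ≤ M ∧ f * ((∑ w, b w) * Φ b) = g * Φ k' := by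
    rcases hg.eq_or_lt with rfl | hg
    · have : b = 0 := by ext w; simp [hb]
      rw [this, hΨ0]; simp [hM]
    · have h1 : Φ b = Φ k' := hΦ _ (div_pos hg hf) _
      have h2 : Ψ b = Ψ k' := hΨ _ (div_pos hg hf) _
      rw [h1, h2]
      refine ⟨hgM hg, ?_⟩
      rw [hb, ← Finset.mul_sum, hk'1]; field_simp
  have hsb : ∀ w, √f * √(b w) = √(g * k' w) := fun w => by
    rw [← Real.sqrt_mul hf.le]; congr 1; simp only [hb]; field_simp
  have hsk : ∀ w, √f * √(k w) = √(f * k w) := fun w => by rw [← Real.sqrt_mul hf.le]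
  have hff : √f * √f = f := Real.mul_self_sqrt hf.le
  set d2 := ∑ w, (√(b w) - √(k w)) ^ 2 with hd2
  have hd2nn : 0 ≤ d2 := Finset.sum_nonneg fun w _ => sq_nonneg _
  have hfd : f * d2 = D2 := by
    rw [hd2, hD2, Finset.mul_sum]
    refine Finset.sum_congr rfl fun w _ => ?_
    rw [← hsb, ← hsk]
    linear_combination (-(√(b w) - √(k w)) ^ 2) * hff
  have key := h hf b hbnn hΦb.1
  rw [← hd2] at key
  have hsd : √d2 ^ 2 = d2 := Real.sq_sqrt hd2nn
  -- On {ω ≤ N, K ≤ N} the mixed term is at most N² d². Off this set the minimum is replaced by 1,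
  -- and AM–GM with weight |γ|/η separates ω from d².
  have hA : √ω * √d2 * min 1 (K * √d2) ≤ N ^ 2 * d2 + ((|γ| / η) * I + (η / |γ|) * d2) := by
    by_cases hc : ω ≤ N ∧ K ≤ N
    · have e1 : √ω ≤ N := by
        rw [Real.sqrt_le_left (by linarith)]; nlinarith [hc.1]
      have e2 : min 1 (K * √d2) ≤ N * √d2 :=
        (min_le_right _ _).trans (mul_le_mul_of_nonneg_right hc.2 (Real.sqrt_nonneg _))
      have e3 : √ω * √d2 * min 1 (K * √d2) ≤ (N * √d2) * (N * √d2) :=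
        (mul_le_mul_of_nonneg_left e2 (by positivity)).trans
          (mul_le_mul_of_nonneg_right
            (mul_le_mul_of_nonneg_right e1 (Real.sqrt_nonneg _)) (by positivity))
      have e4 : 0 ≤ (|γ| / η) * I + (η / |γ|) * d2 := by positivity
      nlinarith
    · have hIω : I = ω := if_neg hc
      have e1 : √ω * √d2 * min 1 (K * √d2) ≤ √ω * √d2 :=
        mul_le_of_le_one_right (by positivity) (min_le_left _ _)
      have e2 := two_mul_abs_mul_le (c := |γ| / η) (x := √ω) (y := √d2) (by positivity)
      rw [Real.sq_sqrt hω, hsd, abs_of_nonneg (by positivity)] at e2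
      rw [hIω]
      have e3 : d2 / (|γ| / η) = η / |γ| * d2 := by field_simp
      have e4 : 0 ≤ N ^ 2 * d2 := by positivity
      have e5 : 0 ≤ √ω * √d2 := by positivity
      linarith
  have hT1 : |g * Φ k' - f * Φ k
        - ∑ w, F w * (2 * √(f * k w) * (√(g * k' w) - √(f * k w)))|
      ≤ C * (N ^ 2 * D2 + ((|γ| / η) * (f * I) + (η / |γ|) * D2) + D2) := by
    have e1 : g * Φ k' - f * Φ k - ∑ w, F w * (2 * √(f * k w) * (√(g * k' w) - √(f * k w)))
        = f * ((∑ w, b w) * Φ b - Φ k - ∑ w, F w * (2 * √(k w) * (√(b w) - √(k w)))) := by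
      rw [mul_sub, mul_sub, hΦb.2, Finset.mul_sum]
      congr 1
      refine Finset.sum_congr rfl fun w _ => ?_
      rw [← hsb, ← hsk]
      linear_combination (F w * 2 * √(k w) * (√(b w) - √(k w))) * hff
    rw [e1, abs_mul, abs_of_pos hf, ← hfd]
    calc _ ≤ f * (C * ((N ^ 2 * d2 + ((|γ| / η) * I + (η / |γ|) * d2)) + d2)) := by
          gcongr
          exact key.trans (by gcongr)
      _ = _ := by ring
  -- Since (√(f k))² = f k, the two linear terms differ exactly by twice the pairing of F √(f k)
  -- with the mean square remainder; AM–GM with weight |γ| η finishes.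
  have hT2 : |∑ w, F w * (2 * √(f * k w) * (√(g * k' w) - √(f * k w)))
        - γ * ∑ w, f * k w * (F w * σ w)|
      ≤ |γ| * η * (f * ∑ w, k w * F w ^ 2) + r / (η * |γ|) := by
    rw [Finset.mul_sum, ← Finset.sum_sub_distrib, Finset.mul_sum, Finset.mul_sum, hr,
      Finset.sum_div, ← Finset.sum_add_distrib]
    refine (Finset.abs_sum_le_sum_abs _ _).trans (Finset.sum_le_sum fun w _ => ?_)
    have e0 := Real.mul_self_sqrt (mul_nonneg hf.le (hk w))
    have e1 := two_mul_abs_mul_le (c := |γ| * η) (x := F w * √(f * k w))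
      (y := √(g * k' w) - √(f * k w) - γ / 2 * σ w * √(f * k w)) (by positivity)
    have e2 : F w * (2 * √(f * k w) * (√(g * k' w) - √(f * k w))) - γ * (f * k w * (F w * σ w))
        = 2 * (F w * √(f * k w)
          * (√(g * k' w) - √(f * k w) - γ / 2 * σ w * √(f * k w))) := by
      linear_combination (γ * F w * σ w) * e0
    rw [e2, abs_mul, abs_of_pos (by norm_num : (0 : ℝ) < 2)]
    refine e1.trans (le_of_eq ?_)
    rw [mul_pow, Real.sq_sqrt (mul_nonneg hf.le (hk w)), mul_comm η]
    ring
  calc _ = |(g * Φ k' - f * Φ k - ∑ w, F w * (2 * √(f * k w) * (√(g * k' w) - √(f * k w))))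
        + (∑ w, F w * (2 * √(f * k w) * (√(g * k' w) - √(f * k w)))
        - γ * ∑ w, f * k w * (F w * σ w))| := by congr 1; ring
    _ ≤ _ := (abs_add_le _ _).trans (add_le_add hT1 hT2)
    _ ≤ _ := by nlinarith [mul_nonneg hM hD2nn]

/-- Integrated over μ, this makes the squared Hellinger distance O(γ²). -/
theorem sum_sq_sqrt_sub_le {W : Type*} [Fintype W] {a b σ : W → ℝ} (ha : ∀ w, 0 ≤ a w) (γ : ℝ) :
    ∑ w, (√(b w) - √(a w)) ^ 2
      ≤ 2 * ∑ w, (√(b w) - √(a w) - γ / 2 * σ w * √(a w)) ^ 2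
        + γ ^ 2 / 2 * ∑ w, a w * σ w ^ 2 := by
  rw [Finset.mul_sum, Finset.mul_sum, ← Finset.sum_add_distrib]
  refine Finset.sum_le_sum fun w _ => ?_
  have := Real.sq_sqrt (ha w)
  have e : a w * σ w ^ 2 = (σ w * √(a w)) ^ 2 := by rw [mul_pow, this]; ring
  rw [e]
  nlinarith [sq_nonneg (√(b w) - √(a w) - γ / 2 * σ w * √(a w) - γ / 2 * (σ w * √(a w)))]

section Average

variable {𝒳 W : Type*} [MeasurableSpace 𝒳] [MeasurableSpace W] [StandardBorelSpace W] [Nonempty W]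
  [Fintype W]

theorem integrable_sum_cellProb (Q : ProbabilityMeasure (𝒳 × W)) {f : 𝒳 × W → ℝ}
    (hf : Integrable f (Q : Measure (𝒳 × W))) :
    Integrable (fun x => ∑ w, cellProb Q x w * f (x, w)) (Q : Measure (𝒳 × W)).fst := by
  refine hf.integral_condKernel.congr (.of_forall fun x => ?_)
  simp only
  rw [integral_fintype (Integrable.of_finite)]
  simp [cellProb]

/-- The average over the covariates of a functional of the conditional law of `W`. -/
def average (Φ : (W → ℝ) → ℝ) (Q : ProbabilityMeasure (𝒳 × W)) : ℝ :=
  ∫ x, Φ (cellProb Q x) ∂(Q : Measure (𝒳 × W)).fst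

theorem measurable_comp_cellProb (Q : ProbabilityMeasure (𝒳 × W)) {Φ : (W → ℝ) → ℝ}
    (hΦ : Measurable Φ) : Measurable fun x => Φ (cellProb Q x) :=
  hΦ.comp (measurable_pi_lambda _ fun w => measurable_cellProb Q w)

/-- Integrates the fiberwise bound over μ. All four terms are o(γ) or a small multiple of |γ| once
η, N and γ are chosen in that order; H is the mean square remainder, which is o(γ²). -/
theorem abs_average_sub_le {P R : ProbabilityMeasure (𝒳 × W)} {μ : Measure 𝒳} [IsFiniteMeasure μ]
    (hP : (P : Measure (𝒳 × W)).fst ≪ μ) (hR : (R : Measure (𝒳 × W)).fst ≪ μ)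
    {s F : 𝒳 × W → ℝ} (hs : Measurable s) (hs2 : MemLp s 2 (P : Measure (𝒳 × W)))
    (hF2 : MemLp F 2 (P : Measure (𝒳 × W)))
    {Φ Ψ : (W → ℝ) → ℝ} (hΦm : Measurable Φ)
    (hΦΨ : ∀ b : W → ℝ, (∀ w, 0 ≤ b w) → |Φ b| ≤ |Ψ b|)
    (hΨ0 : Ψ 0 = 0) (hΦ : ∀ c : ℝ, 0 < c → ∀ b, Φ (fun w => c * b w) = Φ b)
    (hΨ : ∀ c : ℝ, 0 < c → ∀ b, Ψ (fun w => c * b w) = Ψ b)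
    {ω K : 𝒳 → ℝ} (hωm : Measurable ω) (hKm : Measurable K) (hω : ∀ x, 0 ≤ ω x)
    (hωi : Integrable ω (P : Measure (𝒳 × W)).fst) {M C : ℝ} (hM : 0 ≤ M) (hC : 0 ≤ C)
    (hfib : ∀ᵐ x ∂(P : Measure (𝒳 × W)).fst,
      HasFiberDeriv Φ Ψ (cellProb P x) (fun w => F (x, w)) (ω x) (K x) M C)
    (hPM : ∀ᵐ x ∂(P : Measure (𝒳 × W)).fst, |Ψ (cellProb P x)| ≤ M)
    (hRM : ∀ᵐ x ∂(R : Measure (𝒳 × W)).fst, |Ψ (cellProb R x)| ≤ M)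
    {N η γ : ℝ} (hN : 1 ≤ N) (hη : 0 < η) (hγ : γ ≠ 0) {H : ENNReal} (hH : H ≠ ⊤)
    (hHeq : ∫⁻ x, ENNReal.ofReal (∑ w,
        (√(covDensity R μ x * cellProb R x w) - √(covDensity P μ x * cellProb P x w)
          - γ / 2 * s (x, w) * √(covDensity P μ x * cellProb P x w)) ^ 2) ∂μ = H) :
    |average Φ R - average Φ P - γ * ∫ o, F o * s o ∂(P : Measure (𝒳 × W))|
      ≤ (C * N ^ 2 + C + M + C * (η / |γ|))
          * (2 * H.toReal + γ ^ 2 / 2 * ∫ o, s o ^ 2 ∂(P : Measure (𝒳 × W)))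
        + C * (|γ| / η) *
          ∫ x, (if ω x ≤ N ∧ K x ≤ N then 0 else ω x) ∂(P : Measure (𝒳 × W)).fst
        + |γ| * η * ∫ o, F o ^ 2 ∂(P : Measure (𝒳 × W)) + H.toReal / (η * |γ|) := by
  have hγ' : 0 < |γ| := abs_pos.2 hγ
  have cnn : ∀ (Q : ProbabilityMeasure (𝒳 × W)) x w, 0 ≤ covDensity Q μ x * cellProb Q x w :=
    fun Q x w => mul_nonneg (covDensity_nonneg _ _ _) (cellProb_nonneg _ _ _)
  set r : 𝒳 → ℝ := fun x => ∑ w,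
        (√(covDensity R μ x * cellProb R x w) - √(covDensity P μ x * cellProb P x w)
          - γ / 2 * s (x, w) * √(covDensity P μ x * cellProb P x w)) ^ 2 with hr
  have hrm : Measurable r := by
    refine Finset.measurable_sum _ fun w _ => ?_
    have h1 := measurable_cellProb P w
    have h2 := measurable_cellProb R w
    have h3 := measurable_covDensity P μ
    have h4 := measurable_covDensity R μ
    have h5 : Measurable fun x => s (x, w) := hs.comp (measurable_id.prodMk measurable_const)
    fun_prop
  have hrnn : ∀ x, 0 ≤ r x := fun x => Finset.sum_nonneg fun w _ => sq_nonneg _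
  have hri : Integrable r μ := by
    refine ⟨hrm.aestronglyMeasurable, ?_⟩
    rw [hasFiniteIntegral_iff_ofReal (.of_forall hrnn), hHeq]
    exact hH.lt_top
  have hrint : ∫ x, r x ∂μ = H.toReal := by
    rw [integral_eq_lintegral_of_nonneg_ae (.of_forall hrnn) hrm.aestronglyMeasurable, hHeq]
  -- transfer of integrals under `P` to integrals under `μ`
  have tr : ∀ f : 𝒳 × W → ℝ, Integrable f (P : Measure (𝒳 × W)) →
      Integrable (fun x => covDensity P μ x * ∑ w, cellProb P x w * f (x, w)) μ ∧
      ∫ x, covDensity P μ x * ∑ w, cellProb P x w * f (x, w) ∂μ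
        = ∫ o, f o ∂(P : Measure (𝒳 × W)) := fun f hf =>
    ⟨(integrable_fst_iff P μ hP _).2 (integrable_sum_cellProb P hf), by
      rw [integral_eq_integral_sum_cellProb P hf, integral_fst_eq P μ hP]⟩
  obtain ⟨iS, eS⟩ := tr (fun o => s o ^ 2) hs2.integrable_sq
  obtain ⟨iF, eF⟩ := tr (fun o => F o ^ 2) hF2.integrable_sq
  obtain ⟨iFs, eFs⟩ := tr (fun o => F o * s o) (hF2.integrable_mul hs2)
  set I : 𝒳 → ℝ := fun x => if ω x ≤ N ∧ K x ≤ N then 0 else ω x with hI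
  have hIm : Measurable I := Measurable.ite
    ((measurableSet_le hωm measurable_const).inter (measurableSet_le hKm measurable_const))
    measurable_const hωm
  have hIi : Integrable I (P : Measure (𝒳 × W)).fst := by
    refine hωi.mono hIm.aestronglyMeasurable (.of_forall fun x => ?_)
    simp only [hI]
    split_ifs <;> simp
  have iI := (integrable_fst_iff P μ hP _).2 hIi
  have iav : ∀ Q : ProbabilityMeasure (𝒳 × W), (Q : Measure (𝒳 × W)).fst ≪ μ →
      (∀ᵐ x ∂(Q : Measure (𝒳 × W)).fst, |Ψ (cellProb Q x)| ≤ M) →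
      Integrable (fun x => covDensity Q μ x * Φ (cellProb Q x)) μ := fun Q hQ hb =>
    (integrable_fst_iff Q μ hQ _).2 <| Integrable.of_bound
      (measurable_comp_cellProb Q hΦm).aestronglyMeasurable M (hb.mono fun x hx => (hΦΨ _ (cellProb_nonneg Q x)).trans hx)
  have iR := iav R hR hRM
  have iP := iav P hP hPM
  have hlhs : average Φ R - average Φ P - γ * ∫ o, F o * s o ∂(P : Measure (𝒳 × W))
      = ∫ x, (covDensity R μ x * Φ (cellProb R x) - covDensity P μ x * Φ (cellProb P x)
        - γ * (covDensity P μ x * ∑ w, cellProb P x w * (F (x, w) * s (x, w)))) ∂μ := by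
    have e1 := integral_sub (iR.sub iP) (iFs.const_mul γ)
    have e2 := integral_sub iR iP
    simp only [Pi.sub_apply, integral_const_mul] at e1
    rw [e1, e2, eFs, average, average, integral_fst_eq P μ hP, integral_fst_eq R μ hR]
  set A := C * N ^ 2 + C + M + C * (η / |γ|) with hA
  have hAnn : 0 ≤ A := by positivity
  set G : 𝒳 → ℝ := fun x =>
    A * (2 * r x + γ ^ 2 / 2 * (covDensity P μ x * ∑ w, cellProb P x w * s (x, w) ^ 2))
      + C * (|γ| / η) * (covDensity P μ x * I x)
      + |γ| * η * (covDensity P μ x * ∑ w, cellProb P x w * F (x, w) ^ 2)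
      + r x / (η * |γ|) with hG
  have i1 := ((hri.const_mul 2).add (iS.const_mul (γ ^ 2 / 2))).const_mul A
  have i2 := iI.const_mul (C * (|γ| / η))
  have i3 := iF.const_mul (|γ| * η)
  have i4 := hri.div_const (η * |γ|)
  have hGi : Integrable G μ := ((i1.add i2).add i3).add i4
  have hGint : ∫ x, G x ∂μ = A * (2 * H.toReal + γ ^ 2 / 2 * ∫ o, s o ^ 2 ∂(P : Measure (𝒳 × W)))
        + C * (|γ| / η) * ∫ x, I x ∂(P : Measure (𝒳 × W)).fst
        + |γ| * η * ∫ o, F o ^ 2 ∂(P : Measure (𝒳 × W)) + H.toReal / (η * |γ|) := by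
    have e1 := integral_add (hri.const_mul 2) (iS.const_mul (γ ^ 2 / 2))
    have e2 := integral_add i1 i2
    have e3 := integral_add (i1.add i2) i3
    have e4 := integral_add ((i1.add i2).add i3) i4
    simp only [Pi.add_apply, integral_const_mul, integral_div] at e1 e2 e3 e4
    rw [hG, e4, e3, e2, e1, eS, eF, hrint, integral_fst_eq P μ hP]
  rw [hlhs, ← hGint]
  refine (abs_integral_le_integral_abs).trans (integral_mono_ae ?_ hGi ?_)
  · exact ((iR.sub iP).sub (iFs.const_mul γ)).abs
  filter_upwards [ae_imp_of_ae_fst P μ hP hfib, ae_imp_of_ae_fst R μ hR hRM] with x h1 h2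
  have hd := sum_sq_sqrt_sub_le (b := fun w => covDensity R μ x * cellProb R x w)
    (σ := fun w => s (x, w)) (cnn P x) γ
  have hsum : ∑ w, covDensity P μ x * cellProb P x w * s (x, w) ^ 2
      = covDensity P μ x * ∑ w, cellProb P x w * s (x, w) ^ 2 := by
    rw [Finset.mul_sum]; simp only [mul_assoc]
  rw [hsum] at hd
  have hmain : |covDensity R μ x * Φ (cellProb R x) - covDensity P μ x * Φ (cellProb P x)
        - γ * ∑ w, covDensity P μ x * cellProb P x w * (F (x, w) * s (x, w))|
      ≤ A * ∑ w, (√(covDensity R μ x * cellProb R x w) - √(covDensity P μ x * cellProb P x w)) ^ 2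
        + C * (|γ| / η) * (covDensity P μ x * I x)
        + |γ| * η * (covDensity P μ x * ∑ w, cellProb P x w * F (x, w) ^ 2)
        + r x / (η * |γ|) := by
    exact fiber_scaled_bound h1 hΦΨ hΨ0 hΦ hΨ (cellProb_nonneg P x) (cellProb_nonneg R x)
      (sum_cellProb R x) (hω x) hM hC (covDensity_nonneg P μ x) (covDensity_nonneg R μ x) h2 hN hη hγ
  have hsum' : ∑ w, covDensity P μ x * cellProb P x w * (F (x, w) * s (x, w))
      = covDensity P μ x * ∑ w, cellProb P x w * (F (x, w) * s (x, w)) := by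
    rw [Finset.mul_sum]; simp only [mul_assoc]
  rw [hsum'] at hmain
  refine hmain.trans ?_
  simp only [hG]
  gcongr

/-- Under the fiberwise expansion, the average of a bounded conditional functional is differentiable
along every regular submodel. -/
theorem hasDerivAt_average {P : ProbabilityMeasure (𝒳 × W)} {Q : ℝ → ProbabilityMeasure (𝒳 × W)}
    {s F : 𝒳 × W → ℝ} (hreg : IsRegularPath P Q s) (hF2 : MemLp F 2 (P : Measure (𝒳 × W)))
    {Φ Ψ : (W → ℝ) → ℝ} (hΦm : Measurable Φ)
    (hΦΨ : ∀ b : W → ℝ, (∀ w, 0 ≤ b w) → |Φ b| ≤ |Ψ b|)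
    (hΨ0 : Ψ 0 = 0) (hΦ : ∀ c : ℝ, 0 < c → ∀ b, Φ (fun w => c * b w) = Φ b)
    (hΨ : ∀ c : ℝ, 0 < c → ∀ b, Ψ (fun w => c * b w) = Ψ b)
    {ω K : 𝒳 → ℝ} (hωm : Measurable ω) (hKm : Measurable K) (hω : ∀ x, 0 ≤ ω x)
    (hωi : Integrable ω (P : Measure (𝒳 × W)).fst) {M C : ℝ} (hM : 0 ≤ M) (hC : 0 ≤ C)
    (hfib : ∀ᵐ x ∂(P : Measure (𝒳 × W)).fst,
      HasFiberDeriv Φ Ψ (cellProb P x) (fun w => F (x, w)) (ω x) (K x) M C)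
    (hQM : ∀ᶠ γ in 𝓝 (0 : ℝ), ∀ᵐ x ∂(Q γ : Measure (𝒳 × W)).fst, |Ψ (cellProb (Q γ) x)| ≤ M) :
    HasDerivAt (fun γ => average Φ (Q γ)) (∫ o, F o * s o ∂(P : Measure (𝒳 × W))) 0 := by
  obtain ⟨s', hs'm, hss'⟩ := hreg.score_memLp.aestronglyMeasurable.aemeasurable
  replace hreg := hreg.congr_score hss'
  have hint : ∫ o, F o * s o ∂(P : Measure (𝒳 × W)) = ∫ o, F o * s' o ∂(P : Measure (𝒳 × W)) :=
    integral_congr_ae (hss'.mono fun o ho => by simp only [ho])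
  rw [hint]
  clear hint hss' s
  obtain ⟨μ, hμ, hac, hlim⟩ := hreg.exists_cov_dominating hs'm
  have hP : (P : Measure (𝒳 × W)).fst ≪ μ := by
    have := hac.self_of_nhds; rwa [hreg.start] at this
  have hPM : ∀ᵐ x ∂(P : Measure (𝒳 × W)).fst, |Ψ (cellProb P x)| ≤ M := by
    have := hQM.self_of_nhds; rwa [hreg.start] at this
  set H : ℝ → ENNReal := fun γ => ∫⁻ x, ENNReal.ofReal (∑ w,
        (√(covDensity (Q γ) μ x * cellProb (Q γ) x w) - √(covDensity P μ x * cellProb P x w)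
          - γ / 2 * s' (x, w) * √(covDensity P μ x * cellProb P x w)) ^ 2) ∂μ with hH
  set S2 := ∫ o, s' o ^ 2 ∂(P : Measure (𝒳 × W)) with hS2
  set V := ∫ o, F o ^ 2 ∂(P : Measure (𝒳 × W)) with hV
  have hS2nn : 0 ≤ S2 := integral_nonneg fun o => sq_nonneg _
  have hVnn : 0 ≤ V := integral_nonneg fun o => sq_nonneg _
  have hHsmall : ∀ δ : ℝ, 0 < δ → ∀ᶠ γ in 𝓝[≠] (0 : ℝ), H γ ≠ ⊤ ∧ (H γ).toReal ≤ δ * γ ^ 2 := by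
    intro δ hδ
    have h1 := hlim.eventually (gt_mem_nhds (ENNReal.ofReal_pos.2 hδ))
    filter_upwards [h1, self_mem_nhdsWithin] with γ hγ hγ0
    have hγ0' : 0 < γ ^ 2 := by have : γ ≠ 0 := hγ0; positivity
    have h2 : H γ ≤ ENNReal.ofReal (δ * γ ^ 2) := by
      rw [ENNReal.ofReal_mul hδ.le]
      exact ((ENNReal.div_lt_iff (Or.inl (ENNReal.ofReal_pos.2 hγ0').ne')
        (Or.inl ENNReal.ofReal_ne_top)).1 hγ).le
    exact ⟨ne_top_of_le_ne_top ENNReal.ofReal_ne_top h2, ENNReal.toReal_le_of_le_ofReal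
      (by positivity) h2⟩
  -- Dominated convergence with majorant ω. At each x the integrand is eventually 0 because ω x and
  -- K x are real numbers, so K needs no integrability.
  have hωN : Tendsto (fun n : ℕ => ∫ x, (if ω x ≤ (n : ℝ) ∧ K x ≤ (n : ℝ) then 0 else ω x)
      ∂(P : Measure (𝒳 × W)).fst) atTop (𝓝 0) := by
    have := tendsto_integral_of_dominated_convergence (μ := (P : Measure (𝒳 × W)).fst)
      (F := fun (n : ℕ) x => if ω x ≤ (n : ℝ) ∧ K x ≤ (n : ℝ) then 0 else ω x) (f := fun _ => 0)
      ω (fun n => (Measurable.ite ((measurableSet_le hωm measurable_const).inter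
        (measurableSet_le hKm measurable_const)) measurable_const hωm).aestronglyMeasurable) hωi
      (fun n => .of_forall fun x => by
        split_ifs
        · simpa using hω x
        · rw [Real.norm_of_nonneg (hω x)])
      (.of_forall fun x => by
        refine tendsto_const_nhds.congr' ?_
        obtain ⟨n0, hn0⟩ := exists_nat_ge (max (ω x) (K x))
        filter_upwards [eventually_ge_atTop n0] with n hn
        have : (n0 : ℝ) ≤ n := by exact_mod_cast hn
        rw [if_pos ⟨(le_max_left _ _).trans (hn0.trans this),
          (le_max_right _ _).trans (hn0.trans this)⟩])
    simpa using this
  rw [hasDerivAt_iff_isLittleO, Asymptotics.isLittleO_iff]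
  intro ε hε
  -- choice of the auxiliary parameters
  obtain ⟨η, hη, hη1⟩ : ∃ η : ℝ, 0 < η ∧ (C * (2 + S2) + V) * η ≤ ε / 4 := by
    refine ⟨ε / 4 / (C * (2 + S2) + V + 1), by positivity, ?_⟩
    rw [mul_div_assoc', div_le_iff₀ (by positivity)]
    nlinarith
  -- N comes after η, because the tail of ω is divided by η; the radius ρ comes last, because it
  -- must beat N². Each of the four error terms receives ε/4.
  obtain ⟨N, hN, hN1⟩ : ∃ N : ℝ, 1 ≤ N ∧ C / η *
      ∫ x, (if ω x ≤ N ∧ K x ≤ N then 0 else ω x) ∂(P : Measure (𝒳 × W)).fst ≤ ε / 4 := by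
    have h1 := hωN.const_mul (C / η)
    rw [mul_zero] at h1
    obtain ⟨n, hn, hn1⟩ := ((h1.eventually (gt_mem_nhds (by positivity : 0 < ε / 4))).and
      (eventually_ge_atTop 1)).exists
    exact ⟨n, by exact_mod_cast hn1, hn.le⟩
  set A := C * N ^ 2 + C + M with hA
  have hAnn : 0 ≤ A := by positivity
  obtain ⟨ρ, hρ, hρ1⟩ : ∃ ρ : ℝ, 0 < ρ ∧ A * (2 + S2) * ρ ≤ ε / 4 := by
    refine ⟨ε / 4 / (A * (2 + S2) + 1), by positivity, ?_⟩
    rw [mul_div_assoc', div_le_iff₀ (by positivity)]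
    nlinarith
  have hev : ∀ᶠ γ in 𝓝[≠] (0 : ℝ), ‖average Φ (Q γ) - average Φ (Q 0)
      - (γ - 0) • ∫ o, F o * s' o ∂(P : Measure (𝒳 × W))‖ ≤ ε * ‖γ - 0‖ := by
    filter_upwards [hHsmall 1 one_pos, hHsmall (ε / 4 * η) (by positivity),
      hac.filter_mono nhdsWithin_le_nhds, hQM.filter_mono nhdsWithin_le_nhds,
      self_mem_nhdsWithin, nhdsWithin_le_nhds (Metric.ball_mem_nhds (0 : ℝ) hρ)]
      with γ hγ1 hγ2 hγac hγM hγ0 hγρ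
    have hγ0 : γ ≠ 0 := hγ0
    have hγ' : 0 < |γ| := abs_pos.2 hγ0
    have hγρ : |γ| < ρ := by simpa using hγρ
    have hb := abs_average_sub_le hP hγac hs'm hreg.score_memLp hF2 hΦm hΦΨ hΨ0 hΦ hΨ hωm hKm hω hωi hM hC
      hfib hPM hγM hN hη hγ0 hγ1.1 rfl
    rw [sub_zero, smul_eq_mul, Real.norm_eq_abs, Real.norm_eq_abs, hreg.start]
    refine hb.trans ?_
    rw [← hA, ← hS2, ← hV]
    set h := (H γ).toReal with hh
    have hsq : γ ^ 2 = |γ| ^ 2 := (sq_abs γ).symm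
    have b1 : 2 * h + γ ^ 2 / 2 * S2 ≤ (2 + S2) * |γ| ^ 2 := by
      have := hγ1.2; rw [hsq] at this ⊢; nlinarith [mul_nonneg (sq_nonneg |γ|) hS2nn]
    have b2 : (A + C * (η / |γ|)) * (2 * h + γ ^ 2 / 2 * S2)
        ≤ (A * (2 + S2) * |γ|) * |γ| + (C * (2 + S2) * η) * |γ| := by
      calc _ ≤ (A + C * (η / |γ|)) * ((2 + S2) * |γ| ^ 2) := by gcongr
        _ = _ := by field_simp
    have b3 : h / (η * |γ|) ≤ ε / 4 * |γ| := by
      rw [div_le_iff₀ (by positivity)]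
      have := hγ2.2; rw [hsq] at this; nlinarith
    have b4 : A * (2 + S2) * |γ| ≤ ε / 4 := (by gcongr : _ ≤ A * (2 + S2) * ρ).trans hρ1
    set J := ∫ x, (if ω x ≤ N ∧ K x ≤ N then 0 else ω x) ∂(P : Measure (𝒳 × W)).fst
    have b5 : C * (|γ| / η) * J = (C / η * J) * |γ| := by ring
    rw [b5]
    have b6 := mul_le_mul_of_nonneg_right b4 hγ'.le
    have b7 := mul_le_mul_of_nonneg_right hN1 hγ'.le
    have b8 := mul_le_mul_of_nonneg_right hη1 hγ'.le
    linarith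
  rw [eventually_nhdsWithin_iff] at hev
  filter_upwards [hev] with γ hγ
  by_cases h0 : γ = 0
  · simp [h0]
  · exact hγ h0

end Average

/-! ### Expansions of conditional means on a finite set of cells -/

section Fiber

variable {U : Type*} [Fintype U]

/-- The total weight of the cells with instrument value `z`. -/
def armMass (b : Bool × U → ℝ) (z : Bool) : ℝ := ∑ u, b (z, u)

/-- The mean of `h` given the instrument value `z`. -/
def armMean (b : Bool × U → ℝ) (z : Bool) (h : U → ℝ) : ℝ := (∑ u, h u * b (z, u)) / armMass b z

/-- The influence function of `armMean · z h` at `k`. -/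
def armInfluence (k : Bool × U → ℝ) (z : Bool) (h : U → ℝ) (w : Bool × U) : ℝ :=
  if w.1 = z then (h w.2 - armMean k z h) / armMass k z else 0

/-- The linear approximation of `∑ w, f w * b w - ∑ w, f w * k w` in terms of the differences of the
square roots. -/
def linApprox {W : Type*} [Fintype W] (k b f : W → ℝ) : ℝ :=
  ∑ w, f w * (2 * √(k w) * (√(b w) - √(k w)))

theorem linApprox_add {W : Type*} [Fintype W] (k b f g : W → ℝ) :
    linApprox k b (fun w => f w + g w) = linApprox k b f + linApprox k b g := by
  simp only [linApprox, add_mul, Finset.sum_add_distrib]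

theorem linApprox_sub {W : Type*} [Fintype W] (k b f g : W → ℝ) :
    linApprox k b (fun w => f w - g w) = linApprox k b f - linApprox k b g := by
  simp only [linApprox, sub_mul, Finset.sum_sub_distrib]

theorem linApprox_const_mul {W : Type*} [Fintype W] (k b f : W → ℝ) (c : ℝ) :
    linApprox k b (fun w => c * f w) = c * linApprox k b f := by
  simp only [linApprox, mul_assoc, Finset.mul_sum]

theorem armMass_const_mul (b : Bool × U → ℝ) (c : ℝ) (z : Bool) :
    armMass (fun w => c * b w) z = c * armMass b z := by
  simp only [armMass, Finset.mul_sum]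

theorem armMean_const_mul (b : Bool × U → ℝ) {c : ℝ} (hc : 0 < c) (z : Bool) (h : U → ℝ) :
    armMean (fun w => c * b w) z h = armMean b z h := by
  rw [armMean, armMean, armMass_const_mul]
  have : ∑ u, h u * (c * b (z, u)) = c * ∑ u, h u * b (z, u) := by
    rw [Finset.mul_sum]; exact Finset.sum_congr rfl fun u _ => by ring
  rw [this, mul_div_mul_left _ _ hc.ne']

theorem armMean_zero (z : Bool) (h : U → ℝ) : armMean (0 : Bool × U → ℝ) z h = 0 := by
  simp [armMean]

theorem sum_sub_armMean (k : Bool × U → ℝ) {z : Bool} (hz : armMass k z ≠ 0) (h : U → ℝ) :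
    ∑ u, (h u - armMean k z h) * k (z, u) = 0 := by
  simp only [sub_mul, Finset.sum_sub_distrib, ← Finset.mul_sum]
  rw [armMean]
  change _ - _ / _ * armMass k z = 0
  rw [div_mul_cancel₀ _ hz, sub_self]

theorem sum_arm (f : Bool × U → ℝ) (z : Bool) :
    ∑ w : Bool × U, (if w.1 = z then f w else 0) = ∑ u, f (z, u) := by
  rw [Fintype.sum_prod_type, Fintype.sum_bool]
  cases z <;> simp

theorem linApprox_armInfluence (k b : Bool × U → ℝ) (z : Bool) (h : U → ℝ) :
    linApprox k b (armInfluence k z h) = (∑ u, (h u - armMean k z h)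
      * (2 * √(k (z, u)) * (√(b (z, u)) - √(k (z, u))))) / armMass k z := by
  rw [linApprox, Finset.sum_div, ← sum_arm (fun w => (h w.2 - armMean k z h)
      * (2 * √(k w) * (√(b w) - √(k w))) / armMass k z) z]
  refine Finset.sum_congr rfl fun w _ => ?_
  rw [armInfluence]
  split_ifs
  · ring
  · simp

theorem sub_eq_two_mul_sqrt {x y : ℝ} (hx : 0 ≤ x) (hy : 0 ≤ y) :
    y - x = 2 * √x * (√y - √x) + (√y - √x) ^ 2 := by
  have h1 := Real.sq_sqrt hx
  have h2 := Real.sq_sqrt hy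
  linear_combination -h2 + h1

theorem sum_sub_sum_eq {W : Type*} [Fintype W] {k b : W → ℝ} (hk : ∀ w, 0 ≤ k w)
    (hb : ∀ w, 0 ≤ b w) :
    ∑ w, b w - ∑ w, k w = linApprox k b (fun _ => 1) + ∑ w, (√(b w) - √(k w)) ^ 2 := by
  rw [linApprox, ← Finset.sum_sub_distrib, ← Finset.sum_add_distrib]
  exact Finset.sum_congr rfl fun w _ => by rw [sub_eq_two_mul_sqrt (hk w) (hb w), one_mul]

/-- Cauchy–Schwarz applied to f √k and √b - √k; the 2 is the factor in `linApprox`. -/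
theorem abs_linApprox_le {W : Type*} [Fintype W] {k b f : W → ℝ} (hk : ∀ w, 0 ≤ k w) {v t : ℝ}
    (ht : 0 ≤ t) (hv : (∑ w, f w ^ 2 * k w) * ∑ w, (√(b w) - √(k w)) ^ 2 ≤ t ^ 2)
    (htv : 2 * t ≤ v) : |linApprox k b f| ≤ v := by
  have h1 := Finset.sum_mul_sq_le_sq_mul_sq Finset.univ (fun w => f w * √(k w))
    (fun w => √(b w) - √(k w))
  have h2 : ∑ w, (f w * √(k w)) ^ 2 = ∑ w, f w ^ 2 * k w :=
    Finset.sum_congr rfl fun w _ => by rw [mul_pow, Real.sq_sqrt (hk w)]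
  have h3 : linApprox k b f = 2 * ∑ w, f w * √(k w) * (√(b w) - √(k w)) := by
    rw [linApprox, Finset.mul_sum]; exact Finset.sum_congr rfl fun w _ => by ring
  rw [h2] at h1
  have h4 := abs_le_of_sq_le_sq (h1.trans hv) ht
  rw [h3, abs_mul, abs_of_pos two_pos]
  linarith

theorem abs_sum_sub_one_le {W : Type*} [Fintype W] {k b : W → ℝ} (hk : ∀ w, 0 ≤ k w)
    (hb : ∀ w, 0 ≤ b w) (hk1 : ∑ w, k w = 1) {u : ℝ} (hu : 0 ≤ u)
    (hd : ∑ w, (√(b w) - √(k w)) ^ 2 ≤ u ^ 2) : |∑ w, b w - 1| ≤ 2 * u + u ^ 2 := by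
  have h1 := sum_sub_sum_eq hk hb
  rw [hk1] at h1
  have h2 : |linApprox k b (fun _ => 1)| ≤ 2 * u :=
    abs_linApprox_le hk hu (by simpa [hk1] using hd) le_rfl
  have h3 : 0 ≤ ∑ w, (√(b w) - √(k w)) ^ 2 := Finset.sum_nonneg fun w _ => sq_nonneg _
  rw [h1, abs_le]
  rw [abs_le] at h2
  constructor <;> linarith

theorem sum_sq_armInfluence (k : Bool × U → ℝ) (z : Bool) (h : U → ℝ) (c : ℝ) :
    ∑ w, (c * armInfluence k z h w) ^ 2 * k w
      = (∑ v, (c * (h v - armMean k z h)) ^ 2 * k (z, v)) / armMass k z ^ 2 := by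
  rw [Finset.sum_div, ← sum_arm (fun w => (c * (h w.2 - armMean k z h)) ^ 2 * k w
    / armMass k z ^ 2) z]
  refine Finset.sum_congr rfl fun w _ => ?_
  rw [armInfluence]
  split_ifs
  · field_simp
  · simp

theorem sum_armInfluence (k : Bool × U → ℝ) {z : Bool} (hz : armMass k z ≠ 0) (h : U → ℝ) :
    ∑ w, k w * armInfluence k z h w = 0 := by
  have h1 := congrArg (· / armMass k z) (sum_sub_armMean k hz h)
  simp only [zero_div, Finset.sum_div] at h1
  rw [← h1, ← sum_arm (fun w => (h w.2 - armMean k z h) * k w / armMass k z) z]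
  refine Finset.sum_congr rfl fun w _ => ?_
  rw [armInfluence]
  split_ifs
  · ring
  · simp

/-- Always-valid bound for the linear part of the expansion of a conditional mean. -/
theorem abs_linApprox_armInfluence_le {k b : Bool × U → ℝ} (hk : ∀ w, 0 ≤ k w) {z : Bool}
    (hz : 0 < armMass k z) {h : U → ℝ} {c G u : ℝ} (hu : 0 ≤ u)
    (hvar : ∑ v, (c * (h v - armMean k z h)) ^ 2 * k (z, v) ≤ G * armMass k z)
    (hG : G * ∑ w, (√(b w) - √(k w)) ^ 2 ≤ u ^ 2 * armMass k z) :
    |c * linApprox k b (armInfluence k z h)| ≤ 2 * u := by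
  rw [← linApprox_const_mul]
  refine abs_linApprox_le hk hu ?_ le_rfl
  have hd : 0 ≤ ∑ w, (√(b w) - √(k w)) ^ 2 := Finset.sum_nonneg fun w _ => sq_nonneg _
  rw [sum_sq_armInfluence, div_mul_eq_mul_div, div_le_iff₀ (by positivity)]
  calc _ ≤ G * armMass k z * ∑ w, (√(b w) - √(k w)) ^ 2 := by gcongr
    _ = (G * ∑ w, (√(b w) - √(k w)) ^ 2) * armMass k z := by ring
    _ ≤ u ^ 2 * armMass k z * armMass k z := by gcongr
    _ = _ := by ring

theorem sum_sq_arm_le (k b : Bool × U → ℝ) (z : Bool) :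
    ∑ v, (√(b (z, v)) - √(k (z, v))) ^ 2 ≤ ∑ w, (√(b w) - √(k w)) ^ 2 := by
  rw [← sum_arm (fun w => (√(b w) - √(k w)) ^ 2) z]
  refine Finset.sum_le_sum fun w _ => ?_
  split_ifs
  · rfl
  · positivity

theorem armMass_le_sum {k : Bool × U → ℝ} (hk : ∀ w, 0 ≤ k w) (z : Bool) :
    armMass k z ≤ ∑ w, k w := by
  rw [armMass, ← sum_arm k z]
  refine Finset.sum_le_sum fun w _ => ?_
  split_ifs
  · rfl
  · exact hk w

/-- Quadratic expansion of a conditional mean near `k`. -/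
theorem armMean_expansion {k b : Bool × U → ℝ} (hk : ∀ w, 0 ≤ k w) (hb : ∀ w, 0 ≤ b w)
    (hk1 : ∑ w, k w = 1) {z : Bool} (hz : 0 < armMass k z) {h : U → ℝ} {c G u : ℝ} (hG1 : 1 ≤ G)
    (hu : 0 ≤ u) (hu1 : u ≤ 1 / 8) (hbd : ∀ v, |c * (h v - armMean k z h)| ≤ G)
    (hvar : ∑ v, (c * (h v - armMean k z h)) ^ 2 * k (z, v) ≤ G * armMass k z)
    (hG : G * ∑ w, (√(b w) - √(k w)) ^ 2 ≤ u ^ 2 * armMass k z) :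
    0 < armMass b z ∧ |c * (armMean b z h - armMean k z h)| ≤ 6 * u ∧
      |(∑ w, b w) * (c * (armMean b z h - armMean k z h))
        - c * linApprox k b (armInfluence k z h)| ≤ 37 * u ^ 2 := by
  set D2 := ∑ w, (√(b w) - √(k w)) ^ 2 with hD2
  have hD2nn : 0 ≤ D2 := Finset.sum_nonneg fun w _ => sq_nonneg _
  set A := armMass k z with hA
  set B := armMass b z with hB
  set m := armMean k z h with hm
  have hA1 : A ≤ 1 := by rw [← hk1]; exact armMass_le_sum hk z
  have hD2A : D2 ≤ u ^ 2 * A := by nlinarith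
  have hQt : |∑ w, b w - 1| ≤ 3 * u :=
    (abs_sum_sub_one_le hk hb hk1 hu (by nlinarith [sq_nonneg u])).trans (by nlinarith)
  have hdz : ∑ v, (√(b (z, v)) - √(k (z, v))) ^ 2 ≤ D2 := sum_sq_arm_le k b z
  have hdznn : 0 ≤ ∑ v, (√(b (z, v)) - √(k (z, v))) ^ 2 :=
    Finset.sum_nonneg fun w _ => sq_nonneg _
  -- the mass of the arm
  have hBA : |B - A| ≤ 3 * u * A := by
    have h1 := sum_sub_sum_eq (k := fun v => k (z, v)) (b := fun v => b (z, v))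
      (fun v => hk _) (fun v => hb _)
    have h2 : |linApprox (fun v => k (z, v)) (fun v => b (z, v)) (fun _ => 1)| ≤ 2 * (u * A) := by
      refine abs_linApprox_le (fun v => hk _) (by positivity) ?_ le_rfl
      simp only [one_pow, one_mul]
      change A * _ ≤ _
      nlinarith
    change B - A = _ at h1
    have h3 : u ^ 2 * A ≤ u * A := by nlinarith [mul_nonneg hu hz.le]
    rw [h1, abs_le]
    rw [abs_le] at h2
    constructor <;> linarith
  have hBpos : A / 2 ≤ B := by
    have := (abs_le.1 hBA).1
    nlinarith
  have hB0 : 0 < B := by linarith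
  -- the centred sum
  have hS : c * (armMean b z h - m) = (∑ v, c * (h v - m) * b (z, v)) / B := by
    rw [armMean, eq_div_iff hB0.ne', mul_assoc, sub_mul, div_mul_cancel₀ _ hB0.ne', hB, armMass,
      Finset.mul_sum, ← Finset.sum_sub_distrib, Finset.mul_sum]
    exact Finset.sum_congr rfl fun v _ => by ring
  set S1 := ∑ v, c * (h v - m) * (2 * √(k (z, v)) * (√(b (z, v)) - √(k (z, v)))) with hS1
  set S2 := ∑ v, c * (h v - m) * (√(b (z, v)) - √(k (z, v))) ^ 2 with hS2
  have hsplit : ∑ v, c * (h v - m) * b (z, v) = S1 + S2 := by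
    have h0 : ∑ v, c * (h v - m) * k (z, v) = 0 := by
      have := sum_sub_armMean k hz.ne' h
      simp only [mul_assoc, ← Finset.mul_sum]
      rw [← hm] at this
      rw [this, mul_zero]
    rw [← sub_zero (∑ v, c * (h v - m) * b (z, v)), ← h0, ← Finset.sum_sub_distrib, hS1, hS2,
      ← Finset.sum_add_distrib]
    refine Finset.sum_congr rfl fun v _ => ?_
    rw [← mul_sub, sub_eq_two_mul_sqrt (hk _) (hb _)]
    ring
  have hlin : c * linApprox k b (armInfluence k z h) = S1 / A := by
    rw [linApprox_armInfluence, mul_div_assoc', Finset.mul_sum]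
    simp only [hS1, mul_assoc]
    rfl
  have hS1b : |S1| ≤ 2 * u * A := by
    have := abs_linApprox_armInfluence_le hk hz hu hvar hG
    rwa [hlin, abs_div, abs_of_pos hz, div_le_iff₀ hz] at this
  have hS2b : |S2| ≤ u ^ 2 * A := by
    calc |S2| ≤ ∑ v, |c * (h v - m) * (√(b (z, v)) - √(k (z, v))) ^ 2| :=
          Finset.abs_sum_le_sum_abs _ _
      _ ≤ ∑ v, G * (√(b (z, v)) - √(k (z, v))) ^ 2 := by
          refine Finset.sum_le_sum fun v _ => ?_
          rw [abs_mul, abs_of_nonneg (sq_nonneg (√(b (z, v)) - √(k (z, v))))]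
          exact mul_le_mul_of_nonneg_right (hbd v) (sq_nonneg _)
      _ ≤ G * D2 := by rw [← Finset.mul_sum]; gcongr
      _ ≤ _ := hG
  have hSb : |S1 + S2| ≤ 3 * u * A := by
    have h3 : u ^ 2 * A ≤ u * A := by nlinarith [mul_nonneg hu hz.le]
    exact (abs_add_le _ _).trans (by linarith)
  have hdiv : |(S1 + S2) / B| ≤ 6 * u := by
    rw [abs_div, abs_of_pos hB0, div_le_iff₀ hB0]
    nlinarith
  refine ⟨hB0, by rwa [hS, hsplit], ?_⟩
  rw [hS, hsplit, hlin]
  -- The remainder is (relative error of the total mass against the arm mass) × (deviation of the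
  -- mean), plus the quadratic part S2/A. The bounds 6u · 6u and u² give the constant 37.
  have e : (∑ w, b w) * ((S1 + S2) / B) - S1 / A
      = (((∑ w, b w - 1) * A - (B - A)) / A) * ((S1 + S2) / B) + S2 / A := by
    field_simp; ring
  rw [e]
  have h5 : |((∑ w, b w - 1) * A - (B - A)) / A| ≤ 6 * u := by
    rw [abs_div, abs_of_pos hz, div_le_iff₀ hz]
    refine (abs_sub _ _).trans ?_
    rw [abs_mul, abs_of_pos hz]
    nlinarith
  have h6 : |S2 / A| ≤ u ^ 2 := by
    rw [abs_div, abs_of_pos hz, div_le_iff₀ hz]; exact hS2b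
  refine (abs_add_le _ _).trans ?_
  rw [abs_mul]
  have := mul_le_mul h5 hdiv (abs_nonneg _) (by positivity)
  nlinarith

end Fiber

/-- Only the range u = √ω d ≤ 1/8 needs an expansion. For u > 1/8 the assumption √ω ≤ K forces K d >
1/8, so the allowed error u min(1, K d) exceeds u/8 and also 1/64. It thus absorbs the linear term
and the terms bounded through M. Multiplying by ∑ b instead of 1 costs only Φ(k) d². -/
theorem hasFiberDeriv_of_near {W : Type*} [Fintype W] {Φ Ψ : (W → ℝ) → ℝ} {k F G : W → ℝ}
    {ω K M C : ℝ} (hk : ∀ w, 0 ≤ k w) (hk1 : ∑ w, k w = 1) (hK : √ω ≤ K)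
    (hM : 0 ≤ M) (hC : 0 ≤ C) (hΦΨ : ∀ b : W → ℝ, (∀ w, 0 ≤ b w) → |Φ b| ≤ |Ψ b|)
    (hΨk : |Ψ k| ≤ M) (hF : ∀ w, F w = G w + Φ k)
    (hlin : ∀ b : W → ℝ, (∀ w, 0 ≤ b w) →
      |linApprox k b G| ≤ C * (√ω * √(∑ w, (√(b w) - √(k w)) ^ 2)))
    (hnear : ∀ b : W → ℝ, (∀ w, 0 ≤ b w) → |Ψ b| ≤ M →
      √ω * √(∑ w, (√(b w) - √(k w)) ^ 2) ≤ 1 / 8 →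
      |(∑ w, b w) * (Φ b - Φ k) - linApprox k b G|
        ≤ C * (√ω * √(∑ w, (√(b w) - √(k w)) ^ 2)
          * min 1 (K * √(∑ w, (√(b w) - √(k w)) ^ 2)))) :
    HasFiberDeriv Φ Ψ k F ω K M (9 * C + 300 * M) := by
  intro b hb hbM
  have hlinb := hlin b hb
  have hnearb := hnear b hb hbM
  change |(∑ w, b w) * Φ b - Φ k - linApprox k b F| ≤ _
  have hFG : linApprox k b F = linApprox k b G + Φ k * linApprox k b (fun _ => 1) := by
    rw [← linApprox_const_mul, ← linApprox_add]
    congr 1; ext w; rw [hF, mul_one]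
  have hsum := sum_sub_sum_eq hk hb
  rw [hk1] at hsum
  have hΦk : |Φ k| ≤ M := (hΦΨ k hk).trans hΨk
  have hΦb : |Φ b| ≤ M := (hΦΨ b hb).trans hbM
  set D2 := ∑ w, (√(b w) - √(k w)) ^ 2 with hD2
  have hD2nn : 0 ≤ D2 := Finset.sum_nonneg fun w _ => sq_nonneg _
  have hD := Real.sq_sqrt hD2nn
  have hl1 : |linApprox k b (fun _ => 1)| ≤ 2 * √D2 := by
    refine abs_linApprox_le hk (Real.sqrt_nonneg _) (le_of_eq ?_) le_rfl
    simp only [one_pow, one_mul, hk1]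
    exact hD.symm
  set D := √D2
  have hDnn : 0 ≤ D := Real.sqrt_nonneg _
  set u := √ω * D with hu
  have hunn : 0 ≤ u := by positivity
  have hΦD : |Φ k * D2| ≤ M * D2 := by
    rw [abs_mul, abs_of_nonneg hD2nn]; gcongr
  rcases le_or_gt u (1 / 8) with hu1 | hu1
  · have h1 := hnearb hu1
    have e : (∑ w, b w) * Φ b - Φ k - linApprox k b F
        = ((∑ w, b w) * (Φ b - Φ k) - linApprox k b G) + Φ k * D2 := by
      rw [hFG]; linear_combination Φ k * hsum
    rw [e]
    refine (abs_add_le _ _).trans ?_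
    have h2 : 0 ≤ u * min 1 (K * D) := by
      have : 0 ≤ K * D := mul_nonneg ((Real.sqrt_nonneg _).trans hK) hDnn
      positivity
    nlinarith [mul_nonneg hM h2, mul_nonneg hM hD2nn, mul_nonneg hC hD2nn, mul_nonneg hC h2]
  · have h2 : u ≤ 8 * (u * min 1 (K * D)) := by
      have : 1 / 8 ≤ min 1 (K * D) := by
        refine le_min (by norm_num) (hu1.le.trans ?_)
        exact mul_le_mul_of_nonneg_right hK hDnn
      nlinarith
    set v := u * min 1 (K * D)
    have h3 : (∑ w, b w) ≤ 2 + 2 * D2 := by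
      have := (abs_le.1 hl1).2
      nlinarith [sq_nonneg (D - 1)]
    have h3nn : 0 ≤ ∑ w, b w := Finset.sum_nonneg fun w _ => hb w
    have h4 : |(∑ w, b w) * Φ b| ≤ (2 + 2 * D2) * M := by
      rw [abs_mul, abs_of_nonneg h3nn]; gcongr
    have h5 : |linApprox k b F| ≤ C * u + M * (1 + D2) := by
      rw [hFG]
      refine (abs_add_le _ _).trans (add_le_add hlinb ?_)
      rw [abs_mul]
      have : 2 * D ≤ 1 + D2 := by nlinarith [sq_nonneg (D - 1)]
      gcongr
      exact hl1.trans this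
    have h6 : |(∑ w, b w) * Φ b - Φ k - linApprox k b F|
        ≤ (2 + 2 * D2) * M + M + (C * u + M * (1 + D2)) :=
      (abs_sub _ _).trans (add_le_add ((abs_sub _ _).trans (add_le_add h4 hΦk)) h5)
    nlinarith [mul_le_mul_of_nonneg_left h2 hC, mul_le_mul_of_nonneg_left h2 hM,
      mul_nonneg hM hD2nn, mul_nonneg hC hD2nn]

/-- The constant functional, set to 0 at the zero vector so that it meets the normalization Ψ(0) =
0. Its remainder is exactly d². It serves to show that scores have mean zero. -/
theorem hasFiberDeriv_one {W : Type*} [Fintype W] [Nonempty W] [DecidableEq W] {k : W → ℝ}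
    (hk : ∀ w, 0 ≤ k w) (hk1 : ∑ w, k w = 1) :
    HasFiberDeriv (fun b : W → ℝ => if b = 0 then 0 else 1) (fun b => if b = 0 then 0 else 1)
      k (fun _ => 1) 1 1 1 1 := by
  intro b hb _
  have hk0 : k ≠ 0 := by rintro rfl; simp at hk1
  have hsum := sum_sub_sum_eq hk hb
  rw [hk1] at hsum
  change |_ - _ - linApprox k b _| ≤ _
  have e : (∑ w, b w) * (if b = 0 then 0 else 1) = ∑ w, b w := by
    split_ifs with h
    · simp [h]
    · simp
  simp only [e, if_neg hk0]
  rw [hsum, add_sub_cancel_left, abs_of_nonneg (Finset.sum_nonneg fun w _ => sq_nonneg _)]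
  have : 0 ≤ √1 * √(∑ w, (√(b w) - √(k w)) ^ 2) * min 1 (1 * √(∑ w, (√(b w) - √(k w)) ^ 2)) := by
    positivity
  linarith

theorem num_nonneg (y : Bool) : 0 ≤ num y := by cases y <;> simp [num]

theorem num_le_one (y : Bool) : num y ≤ 1 := by cases y <;> simp [num]

theorem armMass_nonneg {U : Type*} [Fintype U] {b : Bool × U → ℝ} (hb : ∀ w, 0 ≤ b w) (z : Bool) :
    0 ≤ armMass b z := Finset.sum_nonneg fun _ _ => hb _

theorem armMean_mem {U : Type*} [Fintype U] {b : Bool × U → ℝ} (hb : ∀ w, 0 ≤ b w) (z : Bool)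
    {h : U → ℝ} (h0 : ∀ u, 0 ≤ h u) (h1 : ∀ u, h u ≤ 1) : armMean b z h ∈ Set.Icc (0 : ℝ) 1 := by
  refine ⟨div_nonneg (Finset.sum_nonneg fun u _ => mul_nonneg (h0 u) (hb _)) (armMass_nonneg hb z),
    div_le_one_of_le₀ (Finset.sum_le_sum fun u _ => ?_) (armMass_nonneg hb z)⟩
  exact mul_le_of_le_one_left (hb _) (h1 u)

/-! ### The fiber expansion of `θ̃_L` -/

/-- `θ̃_L` as a function of the conditional cell probabilities. -/
def psiL (b : Bool × Bool → ℝ) : ℝ :=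
  (armMean b true num - armMean b false num) / (1 - armMean b false num)

/-- `F_L + θ_L` as a function of the conditional cell probabilities. -/
def derivL (k : Bool × Bool → ℝ) (w : Bool × Bool) : ℝ :=
  (1 - armMean k false num)⁻¹ * armInfluence k true num w
    + (psiL k - 1) * ((1 - armMean k false num)⁻¹ * armInfluence k false num w) + psiL k

theorem sum_sq_num_sub_armMean {k : Bool × Bool → ℝ} {z : Bool} (hz : armMass k z ≠ 0) (c : ℝ) :
    ∑ v, (c * (num v - armMean k z num)) ^ 2 * k (z, v)
      = c ^ 2 * armMean k z num * (1 - armMean k z num) * armMass k z := by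
  have h1 : armMean k z num * armMass k z = k (z, true) := by
    rw [armMean, div_mul_cancel₀ _ hz]; simp [num]
  have h2 : armMass k z = k (z, true) + k (z, false) := by simp [armMass]
  simp only [Fintype.sum_bool, num, if_true, Bool.false_eq_true, if_false]
  have h3 : k (z, false) = (1 - armMean k z num) * armMass k z := by linarith
  rw [h3, ← h1]; ring

/-- The factor 1 - y of the Bernoulli variance y(1 - y) cancels one of the two powers of 1/r. Hence
the moment condition for θ_L involves only the first power of 1/(1 - y₀). -/
theorem sum_sq_num_sub_armMean_le {k : Bool × Bool → ℝ} (hk : ∀ w, 0 ≤ k w) {z : Bool}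
    (hz : 0 < armMass k z) {r : ℝ} (hr : 0 < r) (hzr : 1 - armMean k z num ≤ r) :
    ∑ v, (r⁻¹ * (num v - armMean k z num)) ^ 2 * k (z, v) ≤ r⁻¹ * armMass k z := by
  rw [sum_sq_num_sub_armMean hz.ne']
  obtain ⟨h0, h1⟩ := armMean_mem hk z num_nonneg num_le_one
  have h2 : r⁻¹ * (1 - armMean k z num) ≤ 1 := by rwa [inv_mul_le_iff₀ hr, mul_one]
  have h3 : 0 ≤ r⁻¹ * (1 - armMean k z num) := mul_nonneg (by positivity) (by linarith)
  refine mul_le_mul_of_nonneg_right ?_ hz.le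
  calc r⁻¹ ^ 2 * armMean k z num * (1 - armMean k z num)
      = r⁻¹ * (armMean k z num * (r⁻¹ * (1 - armMean k z num))) := by ring
    _ ≤ r⁻¹ * (1 * 1) := by gcongr
    _ = r⁻¹ := by ring

/-- Since 1 - ψ = (1 - y₁)/(1 - y₀), the increment ψ' - ψ is exactly c(y₁' - y₁) - (1 - ψ') c(y₀' -
y₀). Replacing ψ' by ψ on the right costs a product of two terms of order u, namely 6(M + 2)u · 7u.
-/
theorem ratio_remainder_le {q y0 y1 y0' y1' ψ ψ' c L0 L1 u M : ℝ} (hu : 0 ≤ u) (hu8 : u ≤ 1 / 8)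
    (hψ0 : 0 ≤ ψ) (hψ1 : ψ ≤ 1) (hψ'M : |ψ'| ≤ M) (hM : 0 ≤ M) (hcr : c * (1 - y0) = 1)
    (hψr : (1 - ψ) * (1 - y0) = 1 - y1) (hψr' : (1 - ψ') * (1 - y0') = 1 - y1')
    (l0 : |L0| ≤ 2 * u) (m0 : |c * (y0' - y0)| ≤ 6 * u) (m1 : |c * (y1' - y1)| ≤ 6 * u)
    (E0 : |q * (c * (y0' - y0)) - L0| ≤ 37 * u ^ 2)
    (E1 : |q * (c * (y1' - y1)) - L1| ≤ 37 * u ^ 2) :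
    |q * (ψ' - ψ) - (L1 + (ψ - 1) * L0)| ≤ 200 * (M + 2) * u ^ 2 := by
  have hdiff : ψ' - ψ = c * (y1' - y1) - (1 - ψ') * (c * (y0' - y0)) := by
    linear_combination (ψ - ψ') * hcr - c * hψr' + c * hψr
  have hψ'1 : |1 - ψ'| ≤ 1 + M := by
    refine (abs_sub _ _).trans ?_
    rw [abs_one]; linarith
  have hd1 : |ψ' - ψ| ≤ 6 * (M + 2) * u := by
    rw [hdiff]
    refine (abs_sub _ _).trans ?_
    rw [abs_mul (1 - ψ')]
    have := mul_le_mul hψ'1 m0 (abs_nonneg _) (by linarith)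
    linarith
  have hqm : |q * (c * (y0' - y0))| ≤ 7 * u := by
    have h1 : q * (c * (y0' - y0)) = (q * (c * (y0' - y0)) - L0) + L0 := by ring
    rw [h1]
    refine (abs_add_le _ _).trans ((add_le_add E0 l0).trans ?_)
    nlinarith
  have e : q * (ψ' - ψ) - (L1 + (ψ - 1) * L0)
      = (q * (c * (y1' - y1)) - L1) - (1 - ψ) * (q * (c * (y0' - y0)) - L0)
        + (ψ' - ψ) * (q * (c * (y0' - y0))) := by
    linear_combination q * hdiff
  rw [e]
  have t1 : |(1 - ψ) * (q * (c * (y0' - y0)) - L0)| ≤ 37 * u ^ 2 := by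
    rw [abs_mul]
    have h1 : |1 - ψ| ≤ 1 := abs_le.2 ⟨by linarith, by linarith⟩
    exact (mul_le_of_le_one_left (abs_nonneg _) h1).trans E0
  have t2 : |(ψ' - ψ) * (q * (c * (y0' - y0)))| ≤ 6 * (M + 2) * u * (7 * u) := by
    rw [abs_mul]; gcongr
  refine (abs_add_le _ _).trans ((add_le_add ((abs_sub _ _).trans (add_le_add E1 t1)) t2).trans ?_)
  nlinarith [sq_nonneg u, mul_nonneg hM (sq_nonneg u)]

/-- With c = 1/(1 - y₀), both arm means scaled by c have expansions at scale u = √ω d, because c ≤ ω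
times the mass of either arm. Here K = √ω, so K d = u and the error near k is purely quadratic in u.
-/
theorem hasFiberDeriv_psiL {k : Bool × Bool → ℝ} (hk : ∀ w, 0 ≤ k w) (hk1 : ∑ w, k w = 1)
    (hz : ∀ z, 0 < armMass k z) (hr : 0 < 1 - armMean k false num)
    (hy : armMean k false num ≤ armMean k true num) {M : ℝ} (hM : 1 ≤ M) :
    HasFiberDeriv psiL psiL k (derivL k)
      (armMass k true * armMass k false * (1 - armMean k false num))⁻¹
      (√(armMass k true * armMass k false * (1 - armMean k false num))⁻¹) M
      (9 * (200 * (M + 2)) + 300 * M) := by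
  have hy0 := armMean_mem hk false num_nonneg num_le_one
  have hy1 := armMean_mem hk true num_nonneg num_le_one
  have hzle : ∀ z, armMass k z ≤ 1 := fun z => by rw [← hk1]; exact armMass_le_sum hk z
  have hz1 := hz true
  have hz0 := hz false
  set y0 := armMean k false num with hy0d
  set y1 := armMean k true num with hy1d
  set ω := (armMass k true * armMass k false * (1 - y0))⁻¹ with hω
  have hωpos : 0 < ω := by positivity
  have hψ : psiL k = (y1 - y0) / (1 - y0) := rfl
  have hψ0 : 0 ≤ psiL k := by rw [hψ]; exact div_nonneg (by linarith) hr.le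
  have hψ1 : psiL k ≤ 1 := by rw [hψ]; exact div_le_one_of_le₀ (by linarith [hy1.2]) hr.le
  have hψr : (1 - psiL k) * (1 - y0) = 1 - y1 := by rw [hψ]; field_simp; ring
  set c := (1 - y0)⁻¹ with hc
  have hcpos : 0 < c := by positivity
  have hc1 : 1 ≤ c := (one_le_inv₀ hr).2 (by linarith [hy0.1])
  have hcr : c * (1 - y0) = 1 := inv_mul_cancel₀ hr.ne'
  have hyz := fun z => armMean_mem hk z num_nonneg num_le_one
  have hbd : ∀ z v, |c * (num v - armMean k z num)| ≤ c := fun z v => by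
    rw [abs_mul, abs_of_pos hcpos]
    refine mul_le_of_le_one_right hcpos.le (abs_le.2 ⟨?_, ?_⟩)
    · linarith [num_nonneg v, (hyz z).2]
    · linarith [num_le_one v, (hyz z).1]
  have hvar : ∀ z, ∑ v, (c * (num v - armMean k z num)) ^ 2 * k (z, v) ≤ c * armMass k z :=
    fun z => sum_sq_num_sub_armMean_le hk (hz z) hr (by cases z <;> linarith)
  have hG : ∀ (z : Bool) (d : ℝ), 0 ≤ d → c * d ≤ (√ω * √d) ^ 2 * armMass k z := by
    intro z d hd
    rw [mul_pow, Real.sq_sqrt hωpos.le, Real.sq_sqrt hd]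
    have h1 : c ≤ ω * armMass k z := by
      rw [hω, hc, mul_inv, mul_assoc, mul_comm (1 - y0)⁻¹, ← mul_assoc]
      refine le_mul_of_one_le_left (by positivity) ?_
      cases z
      · rw [mul_inv, mul_assoc, inv_mul_cancel₀ hz0.ne', mul_one]
        exact (one_le_inv₀ hz1).2 (hzle _)
      · rw [mul_inv, mul_comm, ← mul_assoc, mul_inv_cancel₀ hz1.ne', one_mul]
        exact (one_le_inv₀ hz0).2 (hzle _)
    nlinarith
  refine hasFiberDeriv_of_near (G := fun w => c * armInfluence k true num w
    + (psiL k - 1) * (c * armInfluence k false num w)) hk hk1 le_rfl (by linarith) (by linarith)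
    (fun b _ => le_rfl) (abs_le.2 ⟨by linarith, by linarith⟩) (fun w => rfl) ?_ ?_
  · intro b hb
    have hd : 0 ≤ ∑ w, (√(b w) - √(k w)) ^ 2 := Finset.sum_nonneg fun w _ => sq_nonneg _
    set u := √ω * √(∑ w, (√(b w) - √(k w)) ^ 2) with hu
    have hunn : 0 ≤ u := by positivity
    have l1 := abs_linApprox_armInfluence_le hk hz1 hunn (hvar true) (hG true _ hd)
    have l0 := abs_linApprox_armInfluence_le hk hz0 hunn (hvar false) (hG false _ hd)
    rw [linApprox_add, linApprox_const_mul, linApprox_const_mul, linApprox_const_mul]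
    refine (abs_add_le _ _).trans ?_
    rw [abs_mul (psiL k - 1)]
    have : |psiL k - 1| ≤ 1 := abs_le.2 ⟨by linarith, by linarith⟩
    nlinarith [mul_le_mul this l0 (abs_nonneg _) zero_le_one]
  · intro b hb hbM hu8
    have hd : 0 ≤ ∑ w, (√(b w) - √(k w)) ^ 2 := Finset.sum_nonneg fun w _ => sq_nonneg _
    set u := √ω * √(∑ w, (√(b w) - √(k w)) ^ 2) with hu
    have hunn : 0 ≤ u := by positivity
    have l0 := abs_linApprox_armInfluence_le hk hz0 hunn (hvar false) (hG false _ hd)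
    obtain ⟨hB1, m1, E1⟩ := armMean_expansion hk hb hk1 hz1 hc1 hunn hu8 (hbd true) (hvar true)
      (hG true _ hd)
    obtain ⟨hB0, m0, E0⟩ := armMean_expansion hk hb hk1 hz0 hc1 hunn hu8 (hbd false) (hvar false)
      (hG false _ hd)
    rw [linApprox_add, linApprox_const_mul, linApprox_const_mul, linApprox_const_mul]
    rw [← hy1d] at m1 E1
    rw [← hy0d] at m0 E0
    set L1 := c * linApprox k b (armInfluence k true num)
    set L0 := c * linApprox k b (armInfluence k false num)
    set q := ∑ w, b w
    have hmin : min 1 u = u := min_eq_right (by linarith)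
    rw [hmin]
    -- The perturbed denominator is (1 - y₀)(1 - c(y₀' - y₀)), and c(y₀' - y₀) ≤ 6u ≤ 3/4.
    have hr' : 0 < 1 - armMean b false num := by
      have h1 : 1 - armMean b false num
          = (1 - y0) * (1 - c * (armMean b false num - y0)) := by
        linear_combination (armMean b false num - y0) * hcr
      rw [h1]
      have := (abs_le.1 m0).2
      exact mul_pos hr (by linarith)
    have hψr' : (1 - psiL b) * (1 - armMean b false num) = 1 - armMean b true num := by
      rw [psiL]; field_simp; ring
    have := ratio_remainder_le hunn hu8 hψ0 hψ1 hbM (by linarith) hcr hψr hψr' l0 m0 m1 E0 E1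
    refine this.trans (le_of_eq (by ring))

/-! ### The fiber expansions for `θ*` -/

/-- The difference of the means of `h` in the two instrument arms. -/
def armDiff {U : Type*} [Fintype U] (b : Bool × U → ℝ) (h : U → ℝ) : ℝ :=
  armMean b true h - armMean b false h

/-- The influence function of `armDiff · h` at `k`. -/
def armDiffInfluence {U : Type*} [Fintype U] (k : Bool × U → ℝ) (h : U → ℝ) (w : Bool × U) : ℝ :=
  armInfluence k true h w - armInfluence k false h w

/-- Exposure `T`, as a function of `(T, Y)`. -/
def numT (v : Bool × Bool) : ℝ := num v.1

/-- Outcome `Y`, as a function of `(T, Y)`. -/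
def numY (v : Bool × Bool) : ℝ := num v.2

/-- The indicator of `T = 0, Y = 0`, as a function of `(T, Y)`. -/
def numNone (v : Bool × Bool) : ℝ := (1 - num v.1) * (1 - num v.2)

theorem numT_mem (v : Bool × Bool) : 0 ≤ numT v ∧ numT v ≤ 1 := ⟨num_nonneg _, num_le_one _⟩

theorem numY_mem (v : Bool × Bool) : 0 ≤ numY v ∧ numY v ≤ 1 := ⟨num_nonneg _, num_le_one _⟩

theorem numNone_mem (v : Bool × Bool) : 0 ≤ numNone v ∧ numNone v ≤ 1 := by
  rcases v with ⟨_ | _, _ | _⟩ <;> simp [numNone, num]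

section

variable {U : Type*} [Fintype U]

theorem abs_armDiff_le_one {b : Bool × U → ℝ} (hb : ∀ w, 0 ≤ b w) {h : U → ℝ}
    (hh : ∀ v, 0 ≤ h v ∧ h v ≤ 1) : |armDiff b h| ≤ 1 := by
  have h1 := armMean_mem hb true (fun v => (hh v).1) (fun v => (hh v).2)
  have h0 := armMean_mem hb false (fun v => (hh v).1) (fun v => (hh v).2)
  exact abs_le.2 ⟨by rw [armDiff]; linarith [h1.1, h0.2], by rw [armDiff]; linarith [h1.2, h0.1]⟩

theorem armDiff_const_mul (b : Bool × U → ℝ) {c : ℝ} (hc : 0 < c) (h : U → ℝ) :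
    armDiff (fun w => c * b w) h = armDiff b h := by
  simp only [armDiff, armMean_const_mul b hc]

theorem armDiff_zero (h : U → ℝ) : armDiff (0 : Bool × U → ℝ) h = 0 := by
  simp [armDiff, armMean_zero]

theorem sum_sq_sub_armMean_le {k : Bool × U → ℝ} (hk : ∀ w, 0 ≤ k w) (z : Bool) {h : U → ℝ}
    (hh : ∀ v, 0 ≤ h v ∧ h v ≤ 1) :
    ∑ v, (h v - armMean k z h) ^ 2 * k (z, v) ≤ armMass k z := by
  refine Finset.sum_le_sum fun v _ => mul_le_of_le_one_left (hk _) ?_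
  have hm := armMean_mem hk z (fun v => (hh v).1) (fun v => (hh v).2)
  rw [sq_le_one_iff_abs_le_one]
  exact abs_le.2 ⟨by linarith [(hh v).1, hm.2], by linarith [(hh v).2, hm.1]⟩

/-- `armMean_expansion` with c = G = 1 in each arm; the constants are twice those of a single arm.
-/
theorem armDiff_expansion {k b : Bool × U → ℝ} (hk : ∀ w, 0 ≤ k w) (hb : ∀ w, 0 ≤ b w)
    (hk1 : ∑ w, k w = 1) (hz : ∀ z, 0 < armMass k z) {h : U → ℝ}
    (hh : ∀ v, 0 ≤ h v ∧ h v ≤ 1) {u : ℝ}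
    (hu : u = √(armMass k true * armMass k false)⁻¹ * √(∑ w, (√(b w) - √(k w)) ^ 2)) :
    |linApprox k b (armDiffInfluence k h)| ≤ 4 * u ∧
    (u ≤ 1 / 8 → |armDiff b h - armDiff k h| ≤ 12 * u ∧
      |(∑ w, b w) * (armDiff b h - armDiff k h) - linApprox k b (armDiffInfluence k h)|
        ≤ 74 * u ^ 2) := by
  have hd : 0 ≤ ∑ w, (√(b w) - √(k w)) ^ 2 := Finset.sum_nonneg fun w _ => sq_nonneg _
  have hunn : 0 ≤ u := by rw [hu]; positivity
  have hzle : ∀ z, armMass k z ≤ 1 := fun z => by rw [← hk1]; exact armMass_le_sum hk z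
  have hz1 := hz true
  have hz0 := hz false
  have hG : ∀ z, 1 * ∑ w, (√(b w) - √(k w)) ^ 2 ≤ u ^ 2 * armMass k z := by
    intro z
    rw [hu, mul_pow, Real.sq_sqrt (by positivity), Real.sq_sqrt hd]
    have h1 : 1 ≤ (armMass k true * armMass k false)⁻¹ * armMass k z := by
      cases z
      · rw [mul_inv, mul_assoc, inv_mul_cancel₀ hz0.ne', mul_one]
        exact (one_le_inv₀ hz1).2 (hzle _)
      · rw [mul_inv, mul_comm, ← mul_assoc, mul_inv_cancel₀ hz1.ne', one_mul]
        exact (one_le_inv₀ hz0).2 (hzle _)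
    nlinarith
  have hvar : ∀ z, ∑ v, (1 * (h v - armMean k z h)) ^ 2 * k (z, v) ≤ 1 * armMass k z := fun z => by
    simpa only [one_mul] using sum_sq_sub_armMean_le hk z hh
  have hbd : ∀ z v, |1 * (h v - armMean k z h)| ≤ 1 := fun z v => by
    have hm := armMean_mem hk z (fun v => (hh v).1) (fun v => (hh v).2)
    rw [one_mul]
    exact abs_le.2 ⟨by linarith [(hh v).1, hm.2], by linarith [(hh v).2, hm.1]⟩
  have hL : linApprox k b (armDiffInfluence k h) = 1 * linApprox k b (armInfluence k true h)
      - 1 * linApprox k b (armInfluence k false h) := by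
    rw [one_mul, one_mul, ← linApprox_sub]; rfl
  have l1 := abs_linApprox_armInfluence_le hk hz1 hunn (hvar true) (hG true)
  have l0 := abs_linApprox_armInfluence_le hk hz0 hunn (hvar false) (hG false)
  refine ⟨?_, fun hu8 => ?_⟩
  · rw [hL]
    exact (abs_sub _ _).trans (by linarith)
  · obtain ⟨-, m1, E1⟩ := armMean_expansion hk hb hk1 hz1 le_rfl hunn hu8 (hbd true) (hvar true)
      (hG true)
    obtain ⟨-, m0, E0⟩ := armMean_expansion hk hb hk1 hz0 le_rfl hunn hu8 (hbd false) (hvar false)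
      (hG false)
    have e1 : armDiff b h - armDiff k h = 1 * (armMean b true h - armMean k true h)
        - 1 * (armMean b false h - armMean k false h) := by simp only [armDiff]; ring
    rw [hL, e1]
    refine ⟨(abs_sub _ _).trans (by linarith), ?_⟩
    rw [mul_sub, sub_sub_sub_comm]
    exact (abs_sub _ _).trans (by linarith)

/-- The influence function of an average of arm differences. -/
def derivDiff (h : U → ℝ) (k : Bool × U → ℝ) (w : Bool × U) : ℝ :=
  armDiffInfluence k h w + armDiff k h

theorem hasFiberDeriv_armDiff {k : Bool × U → ℝ} (hk : ∀ w, 0 ≤ k w) (hk1 : ∑ w, k w = 1)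
    (hz : ∀ z, 0 < armMass k z) {h : U → ℝ} (hh : ∀ v, 0 ≤ h v ∧ h v ≤ 1) :
    HasFiberDeriv (fun b => armDiff b h) (fun b => armDiff b h) k (derivDiff h k)
      (armMass k true * armMass k false)⁻¹ (√(armMass k true * armMass k false)⁻¹) 1
      (9 * 74 + 300 * 1) := by
  refine hasFiberDeriv_of_near (G := armDiffInfluence k h) hk hk1 le_rfl zero_le_one
    (by norm_num) (fun b _ => le_rfl) (abs_armDiff_le_one hk hh) (fun w => rfl) ?_ ?_
  · intro b hb
    refine (armDiff_expansion hk hb hk1 hz hh rfl).1.trans ?_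
    have : 0 ≤ √(armMass k true * armMass k false)⁻¹ * √(∑ w, (√(b w) - √(k w)) ^ 2) := by
      positivity
    linarith
  · intro b hb _ hu8
    refine ((armDiff_expansion hk hb hk1 hz hh rfl).2 hu8).2.trans ?_
    rw [min_eq_right (by linarith), sq]

end

/-- The perturbed denominator vanishes and the quotient is read as 0. Then d itself is at most 12u,
so min(1, u/d) ≥ 1/12 and a first-order error is affordable. -/
theorem weighted_ratio_remainder_le_of_eq_zero {q d Δ ψ ρ Ln Ld LΔ u R : ℝ} (hu : 0 ≤ u)
    (hd : 0 < d) (hψ : |ψ| ≤ 1) (hρ : ρ * d = Δ) (hρ0 : 0 ≤ ρ) (hρR : ρ ≤ R) (hq : |q| ≤ 2)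
    (md : d ≤ 12 * u) (ln : |Ln| ≤ 4 * u) (ld : |Ld| ≤ 4 * u) (lΔ : |LΔ| ≤ 4 * u) :
    |q * (ψ * Δ) + (ψ * LΔ + ρ * (Ln - ψ * Ld))| ≤ 400 * (R + 1) * (u * min 1 (u / d)) := by
  have hR : 0 ≤ R := hρ0.trans hρR
  have ht12 : 1 / 12 ≤ min 1 (u / d) :=
    le_min (by norm_num) (by rw [le_div_iff₀ hd]; linarith)
  set t := min 1 (u / d)
  have hΔ : |Δ| ≤ R * (12 * u) := by
    rw [← hρ, abs_of_nonneg (by positivity)]; gcongr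
  have t1 : |q * (ψ * Δ)| ≤ 2 * (1 * (R * (12 * u))) := by
    rw [abs_mul, abs_mul]; gcongr
  have t2 : |ψ * LΔ| ≤ 1 * (4 * u) := by rw [abs_mul]; gcongr
  have t3 : |ψ * Ld| ≤ 1 * (4 * u) := by rw [abs_mul]; gcongr
  have t4 : |ρ * (Ln - ψ * Ld)| ≤ R * (4 * u + 1 * (4 * u)) := by
    rw [abs_mul, abs_of_nonneg hρ0]
    have := (abs_sub Ln (ψ * Ld)).trans (add_le_add ln t3)
    gcongr
  have h6 : |q * (ψ * Δ) + (ψ * LΔ + ρ * (Ln - ψ * Ld))| ≤ 32 * (R + 1) * u := by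
    refine (abs_add_le _ _).trans ((add_le_add t1
      ((abs_add_le _ _).trans (add_le_add t2 t4))).trans ?_)
    linarith
  have h1 : u ≤ 12 * (u * t) := by nlinarith
  have h2 : 0 ≤ u * t := by linarith
  calc _ ≤ 32 * (R + 1) * u := h6
    _ ≤ 32 * (R + 1) * (12 * (u * t)) := by gcongr
    _ = 384 * ((R + 1) * (u * t)) := by ring
    _ ≤ 400 * ((R + 1) * (u * t)) := by gcongr; norm_num
    _ = _ := by ring

/-- Boundedness gives M + 1, and (ψ' - ψ) d = (n' - n) - ψ'(d' - d) gives a multiple of u/d; the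
minimum keeps whichever is better. -/
theorem abs_ratio_sub_le {d n n' d' ψ ψ' u M : ℝ} (hd : 0 < d) (hn : ψ * d = n)
    (hn' : ψ' * d' = n') (hψ : |ψ| ≤ 1) (hM : 0 ≤ M) (hψ' : |ψ'| ≤ M) (mn : |n' - n| ≤ 12 * u)
    (md : |d' - d| ≤ 12 * u) : |ψ' - ψ| ≤ 12 * (M + 1) * min 1 (u / d) := by
  have b1 : |ψ' - ψ| ≤ M + 1 := (abs_sub _ _).trans (add_le_add hψ' hψ)
  have hdiff : (ψ' - ψ) * d = (n' - n) - ψ' * (d' - d) := by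
    linear_combination -hn + hn'
  have b2 : |ψ' - ψ| ≤ 12 * (M + 1) * (u / d) := by
    rw [mul_div_assoc', le_div_iff₀ hd]
    calc |ψ' - ψ| * d = |(n' - n) - ψ' * (d' - d)| := by
          rw [← hdiff, abs_mul, abs_of_pos hd]
      _ ≤ 12 * u + M * (12 * u) := by
          refine (abs_sub _ _).trans (add_le_add mn ?_)
          rw [abs_mul]; gcongr
      _ = _ := by ring
  rcases min_choice 1 (u / d) with h | h
  · rw [h]; linarith
  · rw [h]; exact b2

/-- Write δ for increments. As Δ = ρ d, one has (ψ' - ψ)Δ = ρ(δn - ψ' δd), free of any small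
denominator. The true second-order term is then (ψ' - ψ)(δΔ - ρ δd): a factor of order t, which
stands for min(1, u/d), times a factor of order u. -/
theorem weighted_ratio_remainder_le_of_ratio {q n d Δ n' d' Δ' ψ ψ' ρ Ln Ld LΔ u t R M : ℝ}
    (hu : 0 ≤ u) (hu8 : u ≤ 1 / 8) (hut : u ≤ t) (hψ : |ψ| ≤ 1) (hn : ψ * d = n)
    (hρ : ρ * d = Δ) (hρ0 : 0 ≤ ρ) (hρR : ρ ≤ R) (hM : 0 ≤ M) (hn' : ψ' * d' = n')
    (hψd : |ψ' - ψ| ≤ 12 * (M + 1) * t) (ld : |Ld| ≤ 4 * u) (lΔ : |LΔ| ≤ 4 * u)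
    (En : |q * (n' - n) - Ln| ≤ 74 * u ^ 2) (Ed : |q * (d' - d) - Ld| ≤ 74 * u ^ 2)
    (EΔ : |q * (Δ' - Δ) - LΔ| ≤ 74 * u ^ 2) :
    |q * (ψ' * Δ' - ψ * Δ) - (ψ * LΔ + ρ * (Ln - ψ * Ld))|
      ≤ 400 * (M + 1) * (R + 1) * (u * t) := by
  have hR : 0 ≤ R := hρ0.trans hρR
  have ht : 0 ≤ t := hu.trans hut
  have hdiff : (ψ' - ψ) * d = (n' - n) - ψ' * (d' - d) := by
    linear_combination -hn + hn'
  have hsmall : ∀ x L : ℝ, |L| ≤ 4 * u → |q * x - L| ≤ 74 * u ^ 2 → |q * x| ≤ 14 * u := by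
    intro x L h1 h2
    have e : q * x = (q * x - L) + L := by ring
    rw [e]
    refine (abs_add_le _ _).trans ((add_le_add h2 h1).trans ?_)
    nlinarith
  have qd := hsmall _ _ ld Ed
  have qΔ := hsmall _ _ lΔ EΔ
  have e : q * (ψ' * Δ' - ψ * Δ) - (ψ * LΔ + ρ * (Ln - ψ * Ld))
      = ψ * (q * (Δ' - Δ) - LΔ) + ρ * ((q * (n' - n) - Ln) - ψ * (q * (d' - d) - Ld))
        + (ψ' - ψ) * (q * (Δ' - Δ) - ρ * (q * (d' - d))) := by
    linear_combination (-q * (ψ' - ψ)) * hρ + q * ρ * hdiff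
  have t1 : |ψ * (q * (Δ' - Δ) - LΔ)| ≤ 1 * (74 * u ^ 2) := by rw [abs_mul]; gcongr
  have t2 : |ψ * (q * (d' - d) - Ld)| ≤ 1 * (74 * u ^ 2) := by rw [abs_mul]; gcongr
  have t3 : |ρ * ((q * (n' - n) - Ln) - ψ * (q * (d' - d) - Ld))|
      ≤ R * (74 * u ^ 2 + 1 * (74 * u ^ 2)) := by
    rw [abs_mul, abs_of_nonneg hρ0]
    have := (abs_sub (q * (n' - n) - Ln) (ψ * (q * (d' - d) - Ld))).trans (add_le_add En t2)
    gcongr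
  have t4 : |q * (Δ' - Δ) - ρ * (q * (d' - d))| ≤ 14 * u + R * (14 * u) := by
    refine (abs_sub _ _).trans (add_le_add qΔ ?_)
    rw [abs_mul, abs_of_nonneg hρ0]; gcongr
  have t5 : |(ψ' - ψ) * (q * (Δ' - Δ) - ρ * (q * (d' - d)))|
      ≤ 12 * (M + 1) * t * (14 * u + R * (14 * u)) := by
    rw [abs_mul]; gcongr
  rw [e]
  refine (abs_add_le _ _).trans ((add_le_add ((abs_add_le _ _).trans (add_le_add t1 t3))
    t5).trans ?_)
  have h1 : u ^ 2 ≤ u * t := by nlinarith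
  have h2 : 0 ≤ u * t := by positivity
  calc 1 * (74 * u ^ 2) + R * (74 * u ^ 2 + 1 * (74 * u ^ 2))
        + 12 * (M + 1) * t * (14 * u + R * (14 * u))
      = (74 + 148 * R) * u ^ 2 + 168 * (M + 1) * (R + 1) * (u * t) := by ring
    _ ≤ (148 * (1 * (R + 1))) * (u * t) + 168 * (M + 1) * (R + 1) * (u * t) := by
        gcongr; linarith
    _ ≤ (148 * ((M + 1) * (R + 1))) * (u * t) + 168 * (M + 1) * (R + 1) * (u * t) := by
        gcongr; linarith
    _ = 316 * ((M + 1) * (R + 1) * (u * t)) := by ring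
    _ ≤ 400 * ((M + 1) * (R + 1) * (u * t)) := by gcongr; norm_num
    _ = _ := by ring

theorem weighted_ratio_remainder_le {q n d Δ n' d' Δ' ψ ψ' ρ Ln Ld LΔ u R M : ℝ} (hu : 0 ≤ u)
    (hu8 : u ≤ 1 / 8) (hd : 0 < d) (hd1 : d ≤ 1) (hψ : |ψ| ≤ 1) (hn : ψ * d = n)
    (hρ : ρ * d = Δ) (hρ0 : 0 ≤ ρ) (hρR : ρ ≤ R) (hM : 0 ≤ M) (hψ' : |ψ'| ≤ M)
    (hn' : d' ≠ 0 → ψ' * d' = n') (hd' : d' = 0 → ψ' = 0) (hq : |q| ≤ 2)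
    (mn : |n' - n| ≤ 12 * u) (md : |d' - d| ≤ 12 * u)
    (ln : |Ln| ≤ 4 * u) (ld : |Ld| ≤ 4 * u) (lΔ : |LΔ| ≤ 4 * u)
    (En : |q * (n' - n) - Ln| ≤ 74 * u ^ 2) (Ed : |q * (d' - d) - Ld| ≤ 74 * u ^ 2)
    (EΔ : |q * (Δ' - Δ) - LΔ| ≤ 74 * u ^ 2) :
    |q * (ψ' * Δ' - ψ * Δ) - (ψ * LΔ + ρ * (Ln - ψ * Ld))|
      ≤ 400 * (M + 1) * (R + 1) * (u * min 1 (u / d)) := by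
  have hR : 0 ≤ R := hρ0.trans hρR
  have hut : u ≤ min 1 (u / d) := le_min (by linarith) (by rw [le_div_iff₀ hd]; nlinarith)
  by_cases h0 : d' = 0
  · rw [h0, zero_sub, abs_neg, abs_of_pos hd] at md
    have h1 := weighted_ratio_remainder_le_of_eq_zero hu hd hψ hρ hρ0 hρR hq md ln ld lΔ
    rw [hd' h0, zero_mul, zero_sub, mul_neg, ← neg_add', abs_neg]
    refine h1.trans ?_
    have h2 : 0 ≤ u * min 1 (u / d) := mul_nonneg hu (hu.trans hut)
    gcongr
    linarith
  · exact weighted_ratio_remainder_le_of_ratio hu hu8 hut hψ hn hρ hρ0 hρR hM (hn' h0)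
      (abs_ratio_sub_le hd hn (hn' h0) hψ hM hψ' mn md) ld lΔ En Ed EΔ

/-- `θ̃*` as a function of the conditional cell probabilities. -/
def psiStar (b : Bool × Bool × Bool → ℝ) : ℝ := armDiff b numY / (-armDiff b numNone)

/-- `θ̃* · {e(1, ·) - e(0, ·)}` as a function of the conditional cell probabilities. -/
def weightedPsiStar (b : Bool × Bool × Bool → ℝ) : ℝ := psiStar b * armDiff b numT

/-- The influence function of the average of `weightedPsiStar`. -/
def derivStarNum (k : Bool × Bool × Bool → ℝ) (w : Bool × Bool × Bool) : ℝ :=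
  psiStar k * armDiffInfluence k numT w
    + armDiff k numT / (-armDiff k numNone)
      * (armDiffInfluence k numY w + psiStar k * armDiffInfluence k numNone w)
    + weightedPsiStar k

theorem abs_weightedPsiStar_le {b : Bool × Bool × Bool → ℝ} (hb : ∀ w, 0 ≤ b w) :
    |weightedPsiStar b| ≤ |psiStar b| := by
  rw [weightedPsiStar, abs_mul]
  exact mul_le_of_le_one_right (abs_nonneg _) (abs_armDiff_le_one hb numT_mem)

/-- The denominator of `psiStar` may be small; only its ratio with the weight is bounded, by R. Its
size enters through K, while ω stays that of the arm means. The bound M is imposed on `psiStar`, not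
on the weighted functional, because the remainder involves the increment of the quotient itself. -/
theorem hasFiberDeriv_weightedPsiStar {k : Bool × Bool × Bool → ℝ} (hk : ∀ w, 0 ≤ k w)
    (hk1 : ∑ w, k w = 1) (hz : ∀ z, 0 < armMass k z) (hd : 0 < -armDiff k numNone)
    (hψ : psiStar k ∈ Set.Icc (0 : ℝ) 1) {R : ℝ} (hΔ0 : 0 ≤ armDiff k numT)
    (hR : armDiff k numT ≤ R * (-armDiff k numNone)) {M : ℝ} (hM : 1 ≤ M) :
    HasFiberDeriv weightedPsiStar psiStar k (derivStarNum k)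
      (armMass k true * armMass k false)⁻¹
      (√(armMass k true * armMass k false)⁻¹ / (-armDiff k numNone)) M
      (9 * (400 * (M + 1) * (R + 1)) + 300 * M) := by
  have hz1 := hz true
  have hz0 := hz false
  have hd1 : -armDiff k numNone ≤ 1 := by
    linarith [(abs_le.1 (abs_armDiff_le_one hk numNone_mem)).1]
  have hρ0 : 0 ≤ armDiff k numT / (-armDiff k numNone) := div_nonneg hΔ0 hd.le
  have hρR : armDiff k numT / (-armDiff k numNone) ≤ R := by rwa [div_le_iff₀ hd]
  have hR0 : 0 ≤ R := hρ0.trans hρR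
  have hψabs : |psiStar k| ≤ 1 := abs_le.2 ⟨by linarith [hψ.1], hψ.2⟩
  have hsplit : ∀ b, linApprox k b (fun w => psiStar k * armDiffInfluence k numT w
        + armDiff k numT / (-armDiff k numNone)
          * (armDiffInfluence k numY w + psiStar k * armDiffInfluence k numNone w))
      = psiStar k * linApprox k b (armDiffInfluence k numT)
        + armDiff k numT / (-armDiff k numNone) * (linApprox k b (armDiffInfluence k numY)
          - psiStar k * (-linApprox k b (armDiffInfluence k numNone))) := fun b => by
    rw [linApprox_add, linApprox_const_mul, linApprox_const_mul, linApprox_add,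
      linApprox_const_mul, mul_neg, sub_neg_eq_add]
  refine hasFiberDeriv_of_near (G := fun w => psiStar k * armDiffInfluence k numT w
        + armDiff k numT / (-armDiff k numNone)
          * (armDiffInfluence k numY w + psiStar k * armDiffInfluence k numNone w))
    hk hk1 ?_ (by linarith) (by positivity) (fun b hb => abs_weightedPsiStar_le hb)
    (hψabs.trans hM) (fun w => rfl) ?_ ?_
  · rw [le_div_iff₀ hd]
    exact mul_le_of_le_one_right (Real.sqrt_nonneg _) hd1
  · intro b hb
    have lT := (armDiff_expansion hk hb hk1 hz numT_mem rfl).1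
    have lY := (armDiff_expansion hk hb hk1 hz numY_mem rfl).1
    have lN := (armDiff_expansion hk hb hk1 hz numNone_mem rfl).1
    rw [hsplit]
    set u := √(armMass k true * armMass k false)⁻¹ * √(∑ w, (√(b w) - √(k w)) ^ 2) with hu
    have hunn : 0 ≤ u := by positivity
    set ρ := armDiff k numT / (-armDiff k numNone)
    have t1 : |psiStar k * linApprox k b (armDiffInfluence k numT)| ≤ 1 * (4 * u) := by
      rw [abs_mul]; gcongr
    have t2 : |psiStar k * (-linApprox k b (armDiffInfluence k numNone))| ≤ 1 * (4 * u) := by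
      rw [abs_mul, abs_neg]; gcongr
    have t3 : |ρ * (linApprox k b (armDiffInfluence k numY)
          - psiStar k * (-linApprox k b (armDiffInfluence k numNone)))|
        ≤ R * (4 * u + 1 * (4 * u)) := by
      rw [abs_mul, abs_of_nonneg hρ0]
      have := (abs_sub (linApprox k b (armDiffInfluence k numY))
        (psiStar k * (-linApprox k b (armDiffInfluence k numNone)))).trans (add_le_add lY t2)
      gcongr
    refine (abs_add_le _ _).trans ((add_le_add t1 t3).trans ?_)
    have h1 := mul_nonneg hR0 hunn
    have h2 := mul_nonneg (by linarith : 0 ≤ M) hunn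
    have h3 := mul_nonneg (by linarith : 0 ≤ M) h1
    nlinarith
  · intro b hb hbM hu8
    obtain ⟨lT, hT⟩ := armDiff_expansion hk hb hk1 hz numT_mem rfl
    obtain ⟨lY, hY⟩ := armDiff_expansion hk hb hk1 hz numY_mem rfl
    obtain ⟨lN, hN⟩ := armDiff_expansion hk hb hk1 hz numNone_mem rfl
    obtain ⟨-, ET⟩ := hT hu8
    obtain ⟨mY, EY⟩ := hY hu8
    obtain ⟨mN, EN⟩ := hN hu8
    -- Since ω ≥ 1, smallness of u forces the Hellinger distance below 1/8, which keeps the total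
    -- mass near 1.
    have hq : |∑ w, b w| ≤ 2 := by
      have hω1 : 1 ≤ (armMass k true * armMass k false)⁻¹ := by
        rw [one_le_inv₀ (by positivity)]
        have hzle : ∀ z, armMass k z ≤ 1 := fun z => by rw [← hk1]; exact armMass_le_sum hk z
        exact mul_le_one₀ (hzle _) hz0.le (hzle _)
      have h1 : √(∑ w, (√(b w) - √(k w)) ^ 2) ≤ 1 / 8 :=
        (le_mul_of_one_le_left (Real.sqrt_nonneg _) (Real.one_le_sqrt.2 hω1)).trans hu8
      have h2 := abs_sum_sub_one_le hk hb hk1 (u := 1 / 8) (by norm_num)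
        ((Real.sqrt_le_left (by norm_num)).1 h1)
      rw [abs_le] at h2 ⊢
      constructor <;> linarith [h2.1, h2.2]
    rw [hsplit, div_mul_eq_mul_div (√(armMass k true * armMass k false)⁻¹), weightedPsiStar,
      weightedPsiStar]
    refine weighted_ratio_remainder_le (n := armDiff k numY) (n' := armDiff b numY)
      (d' := -armDiff b numNone) (by positivity) hu8 hd hd1 hψabs (div_mul_cancel₀ _ hd.ne')
      (div_mul_cancel₀ _ hd.ne') hρ0 hρR (by linarith) hbM (fun h => div_mul_cancel₀ _ h)
      (fun h => by rw [psiStar, h, div_zero]) hq mY ?_ lY (by rwa [abs_neg]) lT EY ?_ ET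
    · rw [← abs_neg]; convert mN using 2; ring
    · rw [← abs_neg]; convert EN using 2; ring

/-! ### The parameters in terms of the conditional cell probabilities -/

section Pr

variable {𝒳 W : Type*} [MeasurableSpace 𝒳] [MeasurableSpace W] [StandardBorelSpace W] [Nonempty W]
  [Fintype W]

theorem condKernel_real_eq_sum (Q : ProbabilityMeasure (𝒳 × W)) (x : 𝒳) (A : Set W)
    [DecidablePred (· ∈ A)] :
    ((Q : Measure (𝒳 × W)).condKernel x).real A
      = ∑ w, if w ∈ A then cellProb Q x w else 0 := by
  rw [← Finset.sum_filter]
  simp only [cellProb]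
  rw [sum_measureReal_singleton]
  congr 1
  ext w
  simp

theorem pr_eq_sum_div_sum (Q : ProbabilityMeasure (𝒳 × W)) (x : 𝒳) (A B : Set W)
    [DecidablePred (· ∈ A)] [DecidablePred (· ∈ B)] :
    pr Q x A B = (∑ w, if w ∈ A ∧ w ∈ B then cellProb Q x w else 0)
      / ∑ w, if w ∈ B then cellProb Q x w else 0 := by
  have hB : MeasurableSet B := B.toFinite.measurableSet
  classical
  rw [pr, measureReal_def, cond_apply hB, ENNReal.toReal_mul, ENNReal.toReal_inv,
    ← measureReal_def, ← measureReal_def, condKernel_real_eq_sum, condKernel_real_eq_sum,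
    mul_comm, div_eq_mul_inv]
  congr 1
  refine Finset.sum_congr rfl fun w _ => ?_
  simp only [Set.mem_inter_iff, and_comm]

end Pr

variable {𝒳 : Type*} [MeasurableSpace 𝒳]

theorem prZ_eq {U : Type*} [MeasurableSpace U] [StandardBorelSpace U] [Nonempty U] [Fintype U]
    (Q : ProbabilityMeasure (𝒳 × Bool × U)) (z : Bool) (x : 𝒳) :
    prZ Q z x = armMass (cellProb Q x) z := by
  classical
  rw [prZ, pr_eq_sum_div_sum]
  simp only [Set.mem_univ, and_true, if_true, sum_cellProb, div_one, Set.mem_ofPred_eq]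
  exact sum_arm (cellProb Q x) z

theorem prYL_eq (Q : ProbabilityMeasure (𝒳 × Bool × Bool)) (z : Bool) (x : 𝒳) :
    prYL Q z x = armMean (cellProb Q x) z num := by
  classical
  rw [prYL, pr_eq_sum_div_sum]
  cases z <;> simp [armMean, armMass, Fintype.sum_prod_type, num]

theorem condThetaL_eq (Q : ProbabilityMeasure (𝒳 × Bool × Bool)) (x : 𝒳) :
    condThetaL Q x = psiL (cellProb Q x) := by
  rw [condThetaL, psiL, prYL_eq, prYL_eq]

theorem thetaL_eq (Q : ProbabilityMeasure (𝒳 × Bool × Bool)) : thetaL Q = average psiL Q := by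
  simp only [thetaL, average, condThetaL_eq]

theorem FL_eq (Q : ProbabilityMeasure (𝒳 × Bool × Bool)) (o : 𝒳 × Bool × Bool) :
    FL Q o = derivL (cellProb Q o.1) o.2 - thetaL Q := by
  obtain ⟨x, z, y⟩ := o
  simp only [FL, derivL, condThetaL_eq, prYL_eq, prZ_eq, armInfluence]
  cases z
  · simp [num]; ring
  · simp [num]; ring

theorem prY_eq (Q : ProbabilityMeasure (𝒳 × Bool × Bool × Bool)) (z : Bool) (x : 𝒳) :
    prY Q z x = armMean (cellProb Q x) z numY := by
  classical
  rw [prY, pr_eq_sum_div_sum]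
  cases z <;> simp [armMean, armMass, Fintype.sum_prod_type, num, numY]

theorem prT_true_eq (Q : ProbabilityMeasure (𝒳 × Bool × Bool × Bool)) (z : Bool) (x : 𝒳) :
    prT Q true z x = armMean (cellProb Q x) z numT := by
  classical
  rw [prT, pr_eq_sum_div_sum]
  cases z <;> simp [armMean, armMass, Fintype.sum_prod_type, num, numT]

/-- The arm must have positive mass: otherwise both conditional probabilities are read as 0 and do
not sum to 1. -/
theorem prT_false_eq (Q : ProbabilityMeasure (𝒳 × Bool × Bool × Bool)) {z : Bool} {x : 𝒳}
    (hz : armMass (cellProb Q x) z ≠ 0) :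
    prT Q false z x = 1 - armMean (cellProb Q x) z numT := by
  classical
  rw [prT, pr_eq_sum_div_sum, armMean, eq_sub_iff_add_eq, ← div_self hz]
  cases z <;> simp [armMass, Fintype.sum_prod_type, num, numT, ← add_div] <;> ring_nf

theorem prY0T0_eq (Q : ProbabilityMeasure (𝒳 × Bool × Bool × Bool)) (z : Bool) (x : 𝒳) :
    prY0T0 Q z x = armMean (cellProb Q x) z numNone := by
  classical
  rw [prY0T0, pr_eq_sum_div_sum]
  cases z <;> simp [armMean, armMass, Fintype.sum_prod_type, num, numNone]

theorem condThetaStar_eq (Q : ProbabilityMeasure (𝒳 × Bool × Bool × Bool)) (x : 𝒳) :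
    condThetaStar Q x = psiStar (cellProb Q x) := by
  rw [condThetaStar, psiStar, prY_eq, prY_eq, prY0T0_eq, prY0T0_eq, armDiff, armDiff, neg_sub]

theorem meanRateDiff_eq (Q : ProbabilityMeasure (𝒳 × Bool × Bool × Bool)) :
    meanRateDiff Q = average (fun b => armDiff b numT) Q := by
  simp only [meanRateDiff, average, prT_true_eq, armDiff]

theorem thetaStar_eq (Q : ProbabilityMeasure (𝒳 × Bool × Bool × Bool)) :
    thetaStar Q = average weightedPsiStar Q / average (fun b => armDiff b numT) Q := by
  rw [thetaStar, meanRateDiff_eq]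
  simp only [average, prT_true_eq, condThetaStar_eq, weightedPsiStar, armDiff]

theorem prYT_eq (Q : ProbabilityMeasure (𝒳 × Bool × Bool × Bool)) (t z : Bool) (x : 𝒳) :
    prYT Q t z x = cellProb Q x (z, t, true)
      / (cellProb Q x (z, t, true) + cellProb Q x (z, t, false)) := by
  classical
  rw [prYT, pr_eq_sum_div_sum]
  cases z <;> cases t <;> simp [Fintype.sum_prod_type]

theorem armMean_numY_numNone_eq (Q : ProbabilityMeasure (𝒳 × Bool × Bool × Bool)) {z : Bool} {x : 𝒳}
    (hz : armMass (cellProb Q x) z ≠ 0) (h1 : armMean (cellProb Q x) z numT ≠ 0)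
    (h0 : 1 - armMean (cellProb Q x) z numT ≠ 0) :
    armMean (cellProb Q x) z numY = armMean (cellProb Q x) z numT * prYT Q true z x
        + (1 - armMean (cellProb Q x) z numT) * prYT Q false z x ∧
      armMean (cellProb Q x) z numNone
        = (1 - armMean (cellProb Q x) z numT) * (1 - prYT Q false z x) := by
  have e1 : armMean (cellProb Q x) z numT = (cellProb Q x (z, true, true)
      + cellProb Q x (z, true, false)) / armMass (cellProb Q x) z := by
    simp [armMean, Fintype.sum_prod_type, numT, num]
  have e2 : armMean (cellProb Q x) z numY = (cellProb Q x (z, true, true)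
      + cellProb Q x (z, false, true)) / armMass (cellProb Q x) z := by
    simp [armMean, Fintype.sum_prod_type, numY, num]
  have e3 : armMean (cellProb Q x) z numNone = cellProb Q x (z, false, false)
      / armMass (cellProb Q x) z := by
    simp [armMean, Fintype.sum_prod_type, numNone, num]
  have e4 : 1 - armMean (cellProb Q x) z numT = (cellProb Q x (z, false, true)
      + cellProb Q x (z, false, false)) / armMass (cellProb Q x) z := by
    rw [e1, eq_div_iff hz, sub_mul, div_mul_cancel₀ _ hz, one_mul]
    simp [armMass, Fintype.sum_prod_type]
  rw [e4] at h0 ⊢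
  rw [e1] at h1
  rw [e1, e2, e3, prYT_eq, prYT_eq]
  have h1' := (div_ne_zero_iff.1 h1).1
  have h0' := (div_ne_zero_iff.1 h0).1
  constructor
  · field_simp
  · field_simp; ring

/-- One arm of F*: two outcome terms and an exposure term. Conditioning on T is undone by the total
probability formulas for m and a, and what remains is the centered T, Y and (1 - T)(1 - Y). -/
theorem armInfluence_combination {T Y e y₁ y₀ m a p ρ ψ θ B : ℝ} (hp : p ≠ 0) (he : e ≠ 0)
    (he' : 1 - e ≠ 0) (hm : m = e * y₁ + (1 - e) * y₀) (ha : a = (1 - e) * (1 - y₀)) :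
    T / (e * p) * (Y - y₁) * ρ * e + (1 - T) / ((1 - e) * p) * (Y - y₀) * ρ * (1 - ψ) * (1 - e)
      + (T - e) / p * (ρ * (y₁ - (1 - ψ) * y₀ - ψ) + ψ / B - θ / B)
    = ψ / B * ((T - e) / p) + ρ * ((Y - m) / p + ψ * (((1 - T) * (1 - Y) - a) / p))
      - θ / B * ((T - e) / p) := by
  subst hm ha
  by_cases hB : B = 0
  · subst hB
    simp only [div_zero]
    field_simp
    ring
  · field_simp
    ring

/-- The quotient rule in influence-function form: F* is (numerator influence - θ* · denominator
influence) / denominator. Arm z = 1 collects F₁, F₂, F₅ and arm z = 0 collects F₃, F₄, F₆. -/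
theorem FStar_eq (Q : ProbabilityMeasure (𝒳 × Bool × Bool × Bool)) (hB : meanRateDiff Q ≠ 0)
    (o : 𝒳 × Bool × Bool × Bool) (hz : ∀ z, armMass (cellProb Q o.1) z ≠ 0)
    (h1 : ∀ z, armMean (cellProb Q o.1) z numT ≠ 0)
    (h0 : ∀ z, 1 - armMean (cellProb Q o.1) z numT ≠ 0) :
    FStar Q o = (meanRateDiff Q)⁻¹ * (derivStarNum (cellProb Q o.1) o.2
      - thetaStar Q * derivDiff numT (cellProb Q o.1) o.2) := by
  obtain ⟨x, z, t, y⟩ := o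
  have hBB : meanRateDiff Q * (meanRateDiff Q)⁻¹ = 1 := mul_inv_cancel₀ hB
  obtain ⟨hY, hN⟩ := armMean_numY_numNone_eq Q (hz z) (h1 z) (h0 z)
  have key := armInfluence_combination (T := num t) (Y := num y) (hz z) (h1 z) (h0 z) hY hN
    (ρ := (armMean (cellProb Q x) true numT - armMean (cellProb Q x) false numT) / meanRateDiff Q
      / (armMean (cellProb Q x) false numNone - armMean (cellProb Q x) true numNone))
    (ψ := psiStar (cellProb Q x)) (θ := thetaStar Q) (B := meanRateDiff Q)
  have n1 : num true = 1 := rfl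
  have n0 : num false = 0 := rfl
  simp only [FStar, derivStarNum, derivDiff, armDiffInfluence, armInfluence, weightedPsiStar,
    condThetaStar_eq, prT_true_eq, prT_false_eq Q (hz _), prZ_eq, prY0T0_eq, armDiff, neg_sub]
  cases z
  · simp only [n0, Bool.false_eq_true, if_false, if_true, mul_one, mul_zero, zero_mul, sub_zero,
      zero_div, one_mul, zero_add, zero_sub, numT, numY, numNone] at key ⊢
    linear_combination -key + thetaStar Q * hBB
  · simp only [n1, Bool.true_eq_false, if_false, if_true, mul_one, mul_zero, zero_mul, sub_zero,
      zero_div, one_mul, neg_zero, add_zero, sub_self, numT, numY, numNone] at key ⊢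
    linear_combination key + thetaStar Q * hBB

/-! ### Pathwise derivatives -/

section General

variable {𝒳 W : Type*} [MeasurableSpace 𝒳] [MeasurableSpace W] [StandardBorelSpace W] [Nonempty W]
  [Fintype W]

theorem memLp_two_of_sum_sq_le (P : ProbabilityMeasure (𝒳 × W)) {F : 𝒳 × W → ℝ} (hF : Measurable F)
    {ω : 𝒳 → ℝ} (hωi : Integrable ω (P : Measure (𝒳 × W)).fst)
    (h : ∀ᵐ x ∂(P : Measure (𝒳 × W)).fst, ∑ w, F (x, w) ^ 2 * cellProb P x w ≤ ω x) :
    MemLp F 2 (P : Measure (𝒳 × W)) := by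
  rw [memLp_two_iff_integrable_sq hF.aestronglyMeasurable]
  refine ⟨(hF.pow_const 2).aestronglyMeasurable, ?_⟩
  rw [hasFiniteIntegral_iff_ofReal (.of_forall fun o => sq_nonneg _),
    lintegral_eq_lintegral_sum_cellProb P (hF.pow_const 2).ennreal_ofReal]
  refine lt_of_le_of_lt (lintegral_mono_ae ?_) hωi.lintegral_lt_top
  filter_upwards [h] with x hx
  refine le_trans (le_of_eq ?_) (ENNReal.ofReal_le_ofReal hx)
  rw [ENNReal.ofReal_sum_of_nonneg fun w _ => mul_nonneg (sq_nonneg _) (cellProb_nonneg _ _ _)]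
  refine Finset.sum_congr rfl fun w _ => ?_
  rw [mul_comm, ENNReal.ofReal_mul (sq_nonneg _)]

theorem integral_eq_average (P : ProbabilityMeasure (𝒳 × W)) {F : 𝒳 × W → ℝ}
    (hF : MemLp F 2 (P : Measure (𝒳 × W))) {Φ : (W → ℝ) → ℝ}
    (h : ∀ᵐ x ∂(P : Measure (𝒳 × W)).fst, ∑ w, cellProb P x w * F (x, w) = Φ (cellProb P x)) :
    ∫ o, F o ∂(P : Measure (𝒳 × W)) = average Φ P := by
  rw [integral_eq_integral_sum_cellProb P (hF.integrable one_le_two)]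
  exact integral_congr_ae h

/-- The average of the constant functional is identically 1 along the submodel, while its derivative
is the mean of the score. -/
theorem IsRegularPath.integral_score {P : ProbabilityMeasure (𝒳 × W)}
    {Q : ℝ → ProbabilityMeasure (𝒳 × W)} {s : 𝒳 × W → ℝ} (hreg : IsRegularPath P Q s) :
    ∫ o, s o ∂(P : Measure (𝒳 × W)) = 0 := by
  classical
  have hne : ∀ (R : ProbabilityMeasure (𝒳 × W)) x, cellProb R x ≠ 0 := fun R x h => by
    have := sum_cellProb R x
    rw [h] at this
    simp at this
  have hhom : ∀ c : ℝ, 0 < c → ∀ b : W → ℝ,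
      (if (fun w => c * b w) = 0 then (0 : ℝ) else 1) = if b = 0 then 0 else 1 := by
    intro c hc b
    congr 1
    simp [funext_iff, hc.ne']
  have h := hasDerivAt_average hreg (F := fun _ => 1) (memLp_const 1)
    (Φ := fun b => if b = 0 then 0 else 1) (Ψ := fun b => if b = 0 then 0 else 1)
    (Measurable.ite (measurableSet_singleton 0) measurable_const measurable_const)
    (fun b _ => le_rfl) (by simp) hhom hhom (ω := fun _ => 1) (K := fun _ => 1) measurable_const
    measurable_const (fun _ => zero_le_one) (integrable_const 1) (M := 1) (C := 1) zero_le_one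
    zero_le_one
    (.of_forall fun x => hasFiberDeriv_one (cellProb_nonneg P x) (sum_cellProb P x))
    (.of_forall fun γ => .of_forall fun x => by simp [hne])
  have h1 : (fun γ => average (fun b : W → ℝ => if b = 0 then (0 : ℝ) else 1) (Q γ))
      = fun _ => 1 := by
    ext γ
    simp [average, hne]
  rw [h1] at h
  have := h.unique (hasDerivAt_const 0 1)
  simpa using this

end General

/-! ### Measurability, conditional means and conditional second moments of the influence functions.
-/

section Moments

variable {U : Type*} [Fintype U]

theorem measurable_armMass (z : Bool) : Measurable fun b : Bool × U → ℝ => armMass b z := by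
  unfold armMass; fun_prop

theorem measurable_armMean (z : Bool) (h : U → ℝ) :
    Measurable fun b : Bool × U → ℝ => armMean b z h := by
  have := measurable_armMass (U := U) z
  unfold armMean; fun_prop

theorem measurable_armInfluence (z : Bool) (h : U → ℝ) (w : Bool × U) :
    Measurable fun b : Bool × U → ℝ => armInfluence b z h w := by
  have := measurable_armMass (U := U) z
  have := measurable_armMean z h
  unfold armInfluence
  split_ifs <;> fun_prop

theorem measurable_armDiff (h : U → ℝ) : Measurable fun b : Bool × U → ℝ => armDiff b h :=
  (measurable_armMean true h).sub (measurable_armMean false h)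

theorem measurable_armDiffInfluence (h : U → ℝ) (w : Bool × U) :
    Measurable fun b : Bool × U → ℝ => armDiffInfluence b h w :=
  (measurable_armInfluence true h w).sub (measurable_armInfluence false h w)

theorem measurable_derivDiff (h : U → ℝ) (w : Bool × U) :
    Measurable fun b : Bool × U → ℝ => derivDiff h b w :=
  (measurable_armDiffInfluence h w).add (measurable_armDiff h)

theorem measurable_psiL : Measurable psiL := by
  have := measurable_armMean true num
  have := measurable_armMean false num
  unfold psiL; fun_prop

theorem measurable_derivL (w : Bool × Bool) : Measurable fun b => derivL b w := by
  have := measurable_armMean false num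
  have := measurable_armInfluence true num w
  have := measurable_armInfluence false num w
  have := measurable_psiL
  unfold derivL; fun_prop

theorem measurable_psiStar : Measurable psiStar :=
  (measurable_armDiff numY).div (measurable_armDiff numNone).neg

theorem measurable_weightedPsiStar : Measurable weightedPsiStar :=
  measurable_psiStar.mul (measurable_armDiff numT)

theorem measurable_derivStarNum (w : Bool × Bool × Bool) :
    Measurable fun b => derivStarNum b w := by
  have := measurable_armDiff numT
  have := measurable_armDiff numNone
  have := measurable_armDiffInfluence numT w
  have := measurable_armDiffInfluence numY w
  have := measurable_armDiffInfluence numNone w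
  have := measurable_psiStar
  have := measurable_weightedPsiStar
  unfold derivStarNum; fun_prop

theorem sum_armDiffInfluence (k : Bool × U → ℝ) (hz : ∀ z, armMass k z ≠ 0) (h : U → ℝ) :
    ∑ w, k w * armDiffInfluence k h w = 0 := by
  simp only [armDiffInfluence, mul_sub, Finset.sum_sub_distrib, sum_armInfluence k (hz _), sub_self]

theorem one_div_armMass_le {k : Bool × U → ℝ} (hk : ∀ w, 0 ≤ k w) (hk1 : ∑ w, k w = 1)
    (hz : ∀ z, 0 < armMass k z) (z : Bool) :
    1 / armMass k z ≤ (armMass k true * armMass k false)⁻¹ := by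
  have hz1 := hz true
  have hz0 := hz false
  have hzle : ∀ z, armMass k z ≤ 1 := fun z => by rw [← hk1]; exact armMass_le_sum hk z
  rw [one_div]
  refine inv_anti₀ (by positivity) ?_
  cases z
  · exact mul_le_of_le_one_left hz0.le (hzle _)
  · exact mul_le_of_le_one_right hz1.le (hzle _)

theorem sum_sq_armInfluence_le {k : Bool × U → ℝ} {z : Bool} (hz : 0 < armMass k z) {h : U → ℝ}
    {c G : ℝ} (hvar : ∑ v, (c * (h v - armMean k z h)) ^ 2 * k (z, v) ≤ G * armMass k z) :
    ∑ w, (c * armInfluence k z h w) ^ 2 * k w ≤ G * (1 / armMass k z) := by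
  rw [sum_sq_armInfluence, div_le_iff₀ (by positivity)]
  refine hvar.trans (le_of_eq ?_)
  field_simp

theorem sum_sq_armDiffInfluence_le {k : Bool × U → ℝ} (hk : ∀ w, 0 ≤ k w) (hk1 : ∑ w, k w = 1)
    (hz : ∀ z, 0 < armMass k z) {h : U → ℝ} (hh : ∀ v, 0 ≤ h v ∧ h v ≤ 1) :
    ∑ w, armDiffInfluence k h w ^ 2 * k w ≤ 4 * (armMass k true * armMass k false)⁻¹ := by
  have hi : ∀ z, ∑ w, (1 * armInfluence k z h w) ^ 2 * k w
      ≤ 1 * (armMass k true * armMass k false)⁻¹ := fun z =>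
    (sum_sq_armInfluence_le (G := 1) (hz z) (by
      simpa only [one_mul] using sum_sq_sub_armMean_le hk z hh)).trans
      (by simpa only [one_mul] using one_div_armMass_le hk hk1 hz z)
  simp only [one_mul] at hi
  have h1 := hi true
  have h0 := hi false
  have : ∑ w, armDiffInfluence k h w ^ 2 * k w
      ≤ 2 * ∑ w, armInfluence k true h w ^ 2 * k w
        + 2 * ∑ w, armInfluence k false h w ^ 2 * k w := by
    rw [Finset.mul_sum, Finset.mul_sum, ← Finset.sum_add_distrib]
    refine Finset.sum_le_sum fun w _ => ?_
    rw [armDiffInfluence, ← mul_assoc, ← mul_assoc, ← add_mul]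
    refine mul_le_mul_of_nonneg_right ?_ (hk w)
    nlinarith [sq_nonneg (armInfluence k true h w + armInfluence k false h w)]
  linarith

theorem one_le_inv_armMass {k : Bool × U → ℝ} (hk : ∀ w, 0 ≤ k w) (hk1 : ∑ w, k w = 1)
    (hz : ∀ z, 0 < armMass k z) : 1 ≤ (armMass k true * armMass k false)⁻¹ := by
  refine le_trans ?_ (one_div_armMass_le hk hk1 hz true)
  rw [le_div_iff₀ (hz true), one_mul, ← hk1]
  exact armMass_le_sum hk true

theorem sum_sq_derivDiff_le {k : Bool × U → ℝ} (hk : ∀ w, 0 ≤ k w) (hk1 : ∑ w, k w = 1)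
    (hz : ∀ z, 0 < armMass k z) {h : U → ℝ} (hh : ∀ v, 0 ≤ h v ∧ h v ≤ 1) :
    ∑ w, derivDiff h k w ^ 2 * k w ≤ 10 * (armMass k true * armMass k false)⁻¹ := by
  have h1 := sum_sq_armDiffInfluence_le hk hk1 hz hh
  have h2 := one_le_inv_armMass hk hk1 hz
  have h3 : armDiff k h ^ 2 ≤ 1 := by
    rw [sq_le_one_iff_abs_le_one]; exact abs_armDiff_le_one hk hh
  have : ∑ w, derivDiff h k w ^ 2 * k w
      ≤ ∑ w, (2 * (armDiffInfluence k h w ^ 2 * k w) + 2 * k w) := by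
    refine Finset.sum_le_sum fun w _ => ?_
    rw [derivDiff, ← mul_assoc, ← add_mul]
    refine mul_le_mul_of_nonneg_right ?_ (hk w)
    nlinarith [sq_nonneg (armDiffInfluence k h w - armDiff k h)]
  rw [Finset.sum_add_distrib, ← Finset.mul_sum, ← Finset.mul_sum, hk1] at this
  linarith

theorem sum_derivDiff {k : Bool × U → ℝ} (hk1 : ∑ w, k w = 1)
    (hz : ∀ z, armMass k z ≠ 0) (h : U → ℝ) : ∑ w, k w * derivDiff h k w = armDiff k h := by
  simp only [derivDiff, mul_add, Finset.sum_add_distrib, sum_armDiffInfluence k hz,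
    ← Finset.sum_mul, hk1]
  ring

theorem sum_derivL {k : Bool × Bool → ℝ} (hk1 : ∑ w, k w = 1)
    (hz : ∀ z, armMass k z ≠ 0) : ∑ w, k w * derivL k w = psiL k := by
  have h : ∀ w, k w * derivL k w = (1 - armMean k false num)⁻¹ * (k w * armInfluence k true num w)
      + (psiL k - 1) * (1 - armMean k false num)⁻¹ * (k w * armInfluence k false num w)
      + k w * psiL k := fun w => by rw [derivL]; ring
  simp only [h, Finset.sum_add_distrib, ← Finset.mul_sum, sum_armInfluence k (hz _),
    ← Finset.sum_mul, hk1]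
  ring

/-- The same weight that controls the remainder dominates the conditional second moment, so one
integrability assumption serves both. The three summands contribute 3 each. -/
theorem sum_sq_derivL_le {k : Bool × Bool → ℝ} (hk : ∀ w, 0 ≤ k w) (hk1 : ∑ w, k w = 1)
    (hz : ∀ z, 0 < armMass k z) (hr : 0 < 1 - armMean k false num)
    (hy : armMean k false num ≤ armMean k true num) :
    ∑ w, derivL k w ^ 2 * k w
      ≤ 9 * (armMass k true * armMass k false * (1 - armMean k false num))⁻¹ := by
  have hvar := fun z => sum_sq_num_sub_armMean_le hk (hz z) hr
    (show 1 - armMean k z num ≤ 1 - armMean k false num by cases z <;> linarith)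
  have hm := one_div_armMass_le hk hk1 hz
  have h1 := one_le_inv_armMass hk hk1 hz
  have hy0 := armMean_mem hk false num_nonneg num_le_one
  have hy1 := armMean_mem hk true num_nonneg num_le_one
  have hψ0 : 0 ≤ psiL k := div_nonneg (by linarith) hr.le
  have hψ1 : psiL k ≤ 1 := div_le_one_of_le₀ (by linarith [hy1.2]) hr.le
  rw [mul_inv]
  set c := (1 - armMean k false num)⁻¹ with hc
  have hcpos : 0 < c := by positivity
  have hc1 : 1 ≤ c := (one_le_inv₀ hr).2 (by linarith [hy0.1])
  set ω := (armMass k true * armMass k false)⁻¹ with hω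
  have hI : ∀ z, ∑ w, (c * armInfluence k z num w) ^ 2 * k w ≤ ω * c := fun z =>
    (sum_sq_armInfluence_le (hz z) (hvar z)).trans (by
      rw [mul_comm]; exact mul_le_mul_of_nonneg_right (hm z) hcpos.le)
  have hωc : 1 ≤ ω * c := one_le_mul_of_one_le_of_one_le h1 hc1
  have key : ∀ w, derivL k w ^ 2 * k w ≤ 3 * ((c * armInfluence k true num w) ^ 2 * k w)
      + 3 * ((c * armInfluence k false num w) ^ 2 * k w) + 3 * k w := by
    intro w
    rw [← mul_assoc, ← mul_assoc, ← add_mul, ← add_mul]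
    refine mul_le_mul_of_nonneg_right ?_ (hk w)
    rw [derivL, ← hc]
    have three : ∀ a b d : ℝ, (a + b + d) ^ 2 ≤ 3 * (a ^ 2 + b ^ 2 + d ^ 2) := by
      intro a b d
      nlinarith [sq_nonneg (a - b), sq_nonneg (a - d), sq_nonneg (b - d)]
    refine (three _ _ _).trans ?_
    have b1 : (psiL k - 1) ^ 2 ≤ 1 := by nlinarith
    have b2 : psiL k ^ 2 ≤ 1 := pow_le_one₀ hψ0 hψ1
    have b3 := mul_le_mul_of_nonneg_right b1 (sq_nonneg (c * armInfluence k false num w))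
    rw [mul_pow (psiL k - 1)]
    linarith
  have hsum := Finset.sum_le_sum fun w (_ : w ∈ Finset.univ) => key w
  simp only [Finset.sum_add_distrib, ← Finset.mul_sum, hk1] at hsum
  linarith [hI true, hI false]

theorem sum_derivStarNum {k : Bool × Bool × Bool → ℝ} (hk1 : ∑ w, k w = 1)
    (hz : ∀ z, armMass k z ≠ 0) : ∑ w, k w * derivStarNum k w = weightedPsiStar k := by
  have h : ∀ w, k w * derivStarNum k w = psiStar k * (k w * armDiffInfluence k numT w)
      + armDiff k numT / (-armDiff k numNone) * (k w * armDiffInfluence k numY w)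
      + armDiff k numT / (-armDiff k numNone) * psiStar k * (k w * armDiffInfluence k numNone w)
      + k w * weightedPsiStar k := fun w => by rw [derivStarNum]; ring
  simp only [h, Finset.sum_add_distrib, ← Finset.mul_sum, sum_armDiffInfluence k hz,
    ← Finset.sum_mul, hk1]
  ring

/-- Four summands, each arm difference having conditional second moment at most 4ω: the T term and
the constant give 16 + 4, the Y and (1 - T)(1 - Y) terms give 16 R² each. -/
theorem sum_sq_derivStarNum_le {k : Bool × Bool × Bool → ℝ} (hk : ∀ w, 0 ≤ k w)
    (hk1 : ∑ w, k w = 1) (hz : ∀ z, 0 < armMass k z) (hd : 0 < -armDiff k numNone)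
    (hψ : psiStar k ∈ Set.Icc (0 : ℝ) 1) {R : ℝ} (hΔ0 : 0 ≤ armDiff k numT)
    (hR : armDiff k numT ≤ R * (-armDiff k numNone)) :
    ∑ w, derivStarNum k w ^ 2 * k w
      ≤ (20 + 32 * R ^ 2) * (armMass k true * armMass k false)⁻¹ := by
  have hT := sum_sq_armDiffInfluence_le hk hk1 hz numT_mem
  have hY := sum_sq_armDiffInfluence_le hk hk1 hz numY_mem
  have hN := sum_sq_armDiffInfluence_le hk hk1 hz numNone_mem
  have h1 := one_le_inv_armMass hk hk1 hz
  have hρ0 : 0 ≤ armDiff k numT / (-armDiff k numNone) := div_nonneg hΔ0 hd.le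
  have hρR : armDiff k numT / (-armDiff k numNone) ≤ R := by rwa [div_le_iff₀ hd]
  have hψ2 : psiStar k ^ 2 ≤ 1 := pow_le_one₀ hψ.1 hψ.2
  have hφ2 : weightedPsiStar k ^ 2 ≤ 1 := by
    rw [sq_le_one_iff_abs_le_one]
    exact (abs_weightedPsiStar_le hk).trans (abs_le.2 ⟨by linarith [hψ.1], hψ.2⟩)
  set ρ := armDiff k numT / (-armDiff k numNone) with hρ
  have hρ2 : ρ ^ 2 ≤ R ^ 2 := by gcongr
  have key : ∀ w, derivStarNum k w ^ 2 * k w ≤ 4 * (armDiffInfluence k numT w ^ 2 * k w)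
      + 4 * R ^ 2 * (armDiffInfluence k numY w ^ 2 * k w)
      + 4 * R ^ 2 * (armDiffInfluence k numNone w ^ 2 * k w) + 4 * k w := by
    intro w
    rw [← mul_assoc, ← mul_assoc, ← mul_assoc, ← add_mul, ← add_mul, ← add_mul]
    refine mul_le_mul_of_nonneg_right ?_ (hk w)
    have four : ∀ a b c d : ℝ, (a + b + c + d) ^ 2 ≤ 4 * (a ^ 2 + b ^ 2 + c ^ 2 + d ^ 2) := by
      intro a b c d
      nlinarith [sq_nonneg (a - b), sq_nonneg (a - c), sq_nonneg (a - d), sq_nonneg (b - c),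
        sq_nonneg (b - d), sq_nonneg (c - d)]
    have e : derivStarNum k w = psiStar k * armDiffInfluence k numT w
        + ρ * armDiffInfluence k numY w + ρ * psiStar k * armDiffInfluence k numNone w
        + weightedPsiStar k := by rw [derivStarNum, ← hρ]; ring
    rw [e]
    refine (four _ _ _ _).trans ?_
    simp only [mul_pow]
    have b1 := mul_le_mul_of_nonneg_right hψ2 (sq_nonneg (armDiffInfluence k numT w))
    have b2 := mul_le_mul_of_nonneg_right hρ2 (sq_nonneg (armDiffInfluence k numY w))
    have b3 := mul_le_mul_of_nonneg_right
      ((mul_le_mul hρ2 hψ2 (sq_nonneg _) (sq_nonneg R)).trans (mul_one _).le)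
      (sq_nonneg (armDiffInfluence k numNone w))
    linarith
  have hsum := Finset.sum_le_sum fun w (_ : w ∈ Finset.univ) => key w
  simp only [Finset.sum_add_distrib, ← Finset.mul_sum, hk1] at hsum
  nlinarith [mul_le_mul_of_nonneg_left hY (sq_nonneg R), mul_le_mul_of_nonneg_left hN (sq_nonneg R)]

end Moments

variable {𝒳 : Type*} [MeasurableSpace 𝒳]

theorem measurable_cellProb_comp {W : Type*} [MeasurableSpace W] [StandardBorelSpace W] [Nonempty W]
    [Fintype W] (P : ProbabilityMeasure (𝒳 × W)) {f : (W → ℝ) → W → ℝ}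
    (hf : ∀ w, Measurable fun b => f b w) :
    Measurable fun o : 𝒳 × W => f (cellProb P o.1) o.2 :=
  measurable_from_prod_countable_left fun w => measurable_comp_cellProb P (hf w)

theorem psiL_const_mul {c : ℝ} (hc : 0 < c) (b : Bool × Bool → ℝ) :
    psiL (fun w => c * b w) = psiL b := by simp only [psiL, armMean_const_mul b hc]

theorem psiStar_const_mul {c : ℝ} (hc : 0 < c) (b : Bool × Bool × Bool → ℝ) :
    psiStar (fun w => c * b w) = psiStar b := by simp only [psiStar, armDiff_const_mul b hc]

theorem weightedPsiStar_const_mul {c : ℝ} (hc : 0 < c) (b : Bool × Bool × Bool → ℝ) :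
    weightedPsiStar (fun w => c * b w) = weightedPsiStar b := by
  simp only [weightedPsiStar, psiStar_const_mul hc, armDiff_const_mul b hc]

/-- `θ_L` is pathwise differentiable, with pathwise derivative `F_L`. -/
theorem isPathwiseDerivative_thetaL (P : ProbabilityMeasure (𝒳 × Bool × Bool))
    (hz : ∀ᵐ x ∂(P : Measure (𝒳 × Bool × Bool)).fst, ∀ z, 0 < prZ P z x)
    (hr : ∀ᵐ x ∂(P : Measure (𝒳 × Bool × Bool)).fst, 0 < 1 - prYL P false x)
    (hy : ∀ᵐ x ∂(P : Measure (𝒳 × Bool × Bool)).fst, prYL P false x ≤ prYL P true x)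
    (hω : Integrable (fun x => (prZ P true x * prZ P false x * (1 - prYL P false x))⁻¹)
      (P : Measure (𝒳 × Bool × Bool)).fst) {M : ℝ} (hM : 1 ≤ M) :
    IsPathwiseDerivative
      {Q | ∀ᵐ x ∂(Q : Measure (𝒳 × Bool × Bool)).fst, |condThetaL Q x| ≤ M} thetaL P (FL P) := by
  simp only [prZ_eq, prYL_eq] at hz hr hy hω
  set ω : 𝒳 → ℝ := fun x => (armMass (cellProb P x) true * armMass (cellProb P x) false
    * (1 - armMean (cellProb P x) false num))⁻¹ with hωd
  have hωm : Measurable ω := by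
    have h1 := measurable_comp_cellProb P (measurable_armMass (U := Bool) true)
    have h2 := measurable_comp_cellProb P (measurable_armMass (U := Bool) false)
    have h3 := measurable_comp_cellProb P (measurable_armMean false num)
    exact ((h1.mul h2).mul (measurable_const.sub h3)).inv
  have hω0 : ∀ x, 0 ≤ ω x := fun x => by
    have h1 := armMass_nonneg (cellProb_nonneg P x) true
    have h2 := armMass_nonneg (cellProb_nonneg P x) false
    have h3 := (armMean_mem (cellProb_nonneg P x) false num_nonneg num_le_one).2
    exact inv_nonneg.2 (mul_nonneg (mul_nonneg h1 h2) (by linarith))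
  set F : 𝒳 × Bool × Bool → ℝ := fun o => derivL (cellProb P o.1) o.2 with hF
  have hFm : Measurable F := measurable_cellProb_comp P measurable_derivL
  have hF2 : MemLp F 2 (P : Measure (𝒳 × Bool × Bool)) := by
    refine memLp_two_of_sum_sq_le P hFm (hω.const_mul 9) ?_
    filter_upwards [hz, hr, hy] with x hzx hrx hyx
    have h := sum_sq_derivL_le (cellProb_nonneg P x) (sum_cellProb P x) hzx hrx hyx
    simp only [hF, hωd]
    exact h
  have hint : ∫ o, F o ∂(P : Measure (𝒳 × Bool × Bool)) = thetaL P := by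
    rw [thetaL_eq]
    refine integral_eq_average P hF2 ?_
    filter_upwards [hz] with x hzx
    exact sum_derivL (sum_cellProb P x) fun z => (hzx z).ne'
  have hFL : FL P = fun o => F o - thetaL P := funext fun o => FL_eq P o
  refine ⟨?_, ?_, ?_⟩
  · have h := hF2.sub (memLp_const (thetaL P))
    rw [hFL]
    exact h
  · rw [hFL, integral_sub (hF2.integrable one_le_two) (integrable_const _), hint]
    simp
  intro Q s hreg hQM
  have h := hasDerivAt_average hreg hF2 measurable_psiL (fun b _ => le_rfl)
    (by simp [psiL, armMean_zero]) (fun c hc b => psiL_const_mul hc b)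
    (fun c hc b => psiL_const_mul hc b) hωm (K := fun x => √(ω x)) hωm.sqrt hω0 hω
    (M := M) (C := 9 * (200 * (M + 2)) + 300 * M) (by linarith) (by linarith) (by
      filter_upwards [hz, hr, hy] with x hzx hrx hyx
      exact hasFiberDeriv_psiL (cellProb_nonneg P x) (sum_cellProb P x) hzx hrx hyx hM)
    (by
      filter_upwards [hQM] with γ hγ
      simpa only [condThetaL_eq] using hγ)
  -- Centering by θ_L does not change the pairing with the score, which has mean zero.
  have e : ∫ o, FL P o * s o ∂(P : Measure (𝒳 × Bool × Bool))
      = ∫ o, F o * s o ∂(P : Measure (𝒳 × Bool × Bool)) := by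
    have i1 : Integrable (fun o => F o * s o) (P : Measure (𝒳 × Bool × Bool)) :=
      hF2.integrable_mul hreg.score_memLp
    simp only [hFL, sub_mul]
    rw [integral_sub i1 ((hreg.score_memLp.integrable one_le_two).const_mul _),
      integral_const_mul, hreg.integral_score, mul_zero, sub_zero]
  rw [e]
  simpa only [← thetaL_eq] using h

/-- `θ*` is pathwise differentiable, with pathwise derivative `F*`. -/
theorem isPathwiseDerivative_thetaStar (P : ProbabilityMeasure (𝒳 × Bool × Bool × Bool))
    (hz : ∀ᵐ x ∂(P : Measure (𝒳 × Bool × Bool × Bool)).fst, ∀ z, 0 < prZ P z x)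
    (hT : ∀ᵐ x ∂(P : Measure (𝒳 × Bool × Bool × Bool)).fst,
      ∀ z, 0 < prT P true z x ∧ prT P true z x < 1)
    (hd : ∀ᵐ x ∂(P : Measure (𝒳 × Bool × Bool × Bool)).fst, 0 < prY0T0 P false x - prY0T0 P true x)
    (hψ : ∀ᵐ x ∂(P : Measure (𝒳 × Bool × Bool × Bool)).fst, condThetaStar P x ∈ Set.Icc (0 : ℝ) 1)
    (hΔ : ∀ᵐ x ∂(P : Measure (𝒳 × Bool × Bool × Bool)).fst, prT P true false x ≤ prT P true true x)
    {R : ℝ} (hR : ∀ᵐ x ∂(P : Measure (𝒳 × Bool × Bool × Bool)).fst,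
      prT P true true x - prT P true false x ≤ R * (prY0T0 P false x - prY0T0 P true x))
    (hB : meanRateDiff P ≠ 0)
    (hω : Integrable (fun x => (prZ P true x * prZ P false x)⁻¹)
      (P : Measure (𝒳 × Bool × Bool × Bool)).fst) {M : ℝ} (hM : 1 ≤ M) :
    IsPathwiseDerivative
      {Q | ∀ᵐ x ∂(Q : Measure (𝒳 × Bool × Bool × Bool)).fst, |condThetaStar Q x| ≤ M}
      thetaStar P (FStar P) := by
  have en : ∀ x, prY0T0 P false x - prY0T0 P true x = -armDiff (cellProb P x) numNone := fun x => by
    rw [prY0T0_eq, prY0T0_eq, armDiff, neg_sub]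
  have et : ∀ x, prT P true true x - prT P true false x = armDiff (cellProb P x) numT := fun x => by
    rw [prT_true_eq, prT_true_eq, armDiff]
  replace hΔ : ∀ᵐ x ∂(P : Measure (𝒳 × Bool × Bool × Bool)).fst,
      0 ≤ armDiff (cellProb P x) numT := hΔ.mono fun x hx => by rw [← et]; linarith
  simp only [prZ_eq, prT_true_eq, condThetaStar_eq, en] at hz hT hψ hd hω
  simp only [et, en] at hR
  set ω : 𝒳 → ℝ := fun x => (armMass (cellProb P x) true * armMass (cellProb P x) false)⁻¹ with hωd
  have hωm : Measurable ω := by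
    have h1 := measurable_comp_cellProb P (measurable_armMass (U := Bool × Bool) true)
    have h2 := measurable_comp_cellProb P (measurable_armMass (U := Bool × Bool) false)
    exact (h1.mul h2).inv
  have hω0 : ∀ x, 0 ≤ ω x := fun x => inv_nonneg.2 (mul_nonneg
    (armMass_nonneg (cellProb_nonneg P x) true) (armMass_nonneg (cellProb_nonneg P x) false))
  set F : 𝒳 × Bool × Bool × Bool → ℝ := fun o => derivStarNum (cellProb P o.1) o.2 with hF
  set G : 𝒳 × Bool × Bool × Bool → ℝ := fun o => derivDiff numT (cellProb P o.1) o.2 with hG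
  have hFm : Measurable F := measurable_cellProb_comp P measurable_derivStarNum
  have hGm : Measurable G := measurable_cellProb_comp P (measurable_derivDiff numT)
  have hF2 : MemLp F 2 (P : Measure (𝒳 × Bool × Bool × Bool)) := by
    refine memLp_two_of_sum_sq_le P hFm (hω.const_mul (20 + 32 * R ^ 2)) ?_
    filter_upwards [hz, hd, hψ, hΔ, hR] with x hzx hdx hψx hΔx hRx
    exact sum_sq_derivStarNum_le (cellProb_nonneg P x) (sum_cellProb P x) hzx hdx hψx hΔx hRx
  have hG2 : MemLp G 2 (P : Measure (𝒳 × Bool × Bool × Bool)) := by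
    refine memLp_two_of_sum_sq_le P hGm (hω.const_mul 10) ?_
    filter_upwards [hz] with x hzx
    exact sum_sq_derivDiff_le (cellProb_nonneg P x) (sum_cellProb P x) hzx numT_mem
  have hFint : ∫ o, F o ∂(P : Measure (𝒳 × Bool × Bool × Bool)) = average weightedPsiStar P := by
    refine integral_eq_average P hF2 ?_
    filter_upwards [hz] with x hzx
    exact sum_derivStarNum (sum_cellProb P x) fun z => (hzx z).ne'
  have hGint : ∫ o, G o ∂(P : Measure (𝒳 × Bool × Bool × Bool)) = meanRateDiff P := by
    rw [meanRateDiff_eq]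
    refine integral_eq_average P hG2 ?_
    filter_upwards [hz] with x hzx
    exact sum_derivDiff (sum_cellProb P x) (fun z => (hzx z).ne') numT
  have hθ : thetaStar P = average weightedPsiStar P / meanRateDiff P := by
    rw [thetaStar_eq, meanRateDiff_eq]
  have hFS : FStar P =ᵐ[(P : Measure (𝒳 × Bool × Bool × Bool))]
      fun o => (meanRateDiff P)⁻¹ * (F o - thetaStar P * G o) := by
    have h1 : ∀ᵐ o ∂(P : Measure (𝒳 × Bool × Bool × Bool)),
        ∀ z, 0 < armMass (cellProb P o.1) z := ae_of_ae_map measurable_fst.aemeasurable hz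
    have h2 : ∀ᵐ o ∂(P : Measure (𝒳 × Bool × Bool × Bool)),
        ∀ z, 0 < armMean (cellProb P o.1) z numT ∧ armMean (cellProb P o.1) z numT < 1 :=
      ae_of_ae_map measurable_fst.aemeasurable hT
    filter_upwards [h1, h2] with o ho1 ho2
    exact FStar_eq P hB o (fun z => (ho1 z).ne') (fun z => (ho2 z).1.ne')
      (fun z => (sub_pos.2 (ho2 z).2).ne')
  have iF := hF2.integrable one_le_two
  have iG := (hG2.integrable one_le_two).const_mul (thetaStar P)
  refine ⟨(memLp_congr_ae hFS).2 ((hF2.sub (hG2.const_mul _)).const_mul _), ?_, ?_⟩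
  · rw [integral_congr_ae hFS, integral_const_mul, integral_sub iF iG, integral_const_mul, hFint,
      hGint, hθ, div_mul_cancel₀ _ hB, sub_self, mul_zero]
  intro Q s hreg hQM
  -- The numerator uses the bound of the submodel on θ̃*. The absolute value of R makes the error
  -- constant visibly nonnegative.
  have hN := hasDerivAt_average hreg hF2 measurable_weightedPsiStar
    (Ψ := psiStar) (fun b hb => abs_weightedPsiStar_le hb)
    (by simp [psiStar, armDiff_zero]) (fun c hc b => weightedPsiStar_const_mul hc b)
    (fun c hc b => psiStar_const_mul hc b) hωm
    (K := fun x => √(ω x) / (-armDiff (cellProb P x) numNone))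
    (hωm.sqrt.div (measurable_comp_cellProb P (measurable_armDiff numNone)).neg) hω0 hω
    (M := M) (C := 9 * (400 * (M + 1) * (|R| + 1)) + 300 * M) (by linarith)
    (by have := abs_nonneg R; have : 0 ≤ M := by linarith
        positivity) (by
      filter_upwards [hz, hd, hψ, hΔ, hR] with x hzx hdx hψx hΔx hRx
      exact hasFiberDeriv_weightedPsiStar (cellProb_nonneg P x) (sum_cellProb P x) hzx hdx hψx hΔx
        (hRx.trans (mul_le_mul_of_nonneg_right (le_abs_self R) hdx.le)) hM)
    (by
      filter_upwards [hQM] with γ hγ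
      simpa only [condThetaStar_eq] using hγ)
  -- The denominator is bounded by 1 along every submodel, whatever the class of laws.
  have hD := hasDerivAt_average hreg hG2 (measurable_armDiff numT) (fun b _ => le_rfl)
    (armDiff_zero numT) (fun c hc b => armDiff_const_mul b hc numT)
    (fun c hc b => armDiff_const_mul b hc numT) hωm (K := fun x => √(ω x)) hωm.sqrt hω0 hω
    (M := 1) (C := 9 * 74 + 300 * 1) zero_le_one (by norm_num) (by
      filter_upwards [hz] with x hzx
      exact hasFiberDeriv_armDiff (cellProb_nonneg P x) (sum_cellProb P x) hzx numT_mem)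
    (.of_forall fun γ => .of_forall fun x => abs_armDiff_le_one (cellProb_nonneg _ x) numT_mem)
  have hB' : average (fun b => armDiff b numT) (Q 0) ≠ 0 := by
    rw [← meanRateDiff_eq, hreg.start]; exact hB
  have h := hN.div hD hB'
  have e : ∫ o, FStar P o * s o ∂(P : Measure (𝒳 × Bool × Bool × Bool))
      = (meanRateDiff P)⁻¹ * (∫ o, F o * s o ∂(P : Measure (𝒳 × Bool × Bool × Bool))
        - thetaStar P * ∫ o, G o * s o ∂(P : Measure (𝒳 × Bool × Bool × Bool))) := by
    have i1 : Integrable (fun o => F o * s o) (P : Measure (𝒳 × Bool × Bool × Bool)) :=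
      hF2.integrable_mul hreg.score_memLp
    have i2 : Integrable (fun o => G o * s o) (P : Measure (𝒳 × Bool × Bool × Bool)) :=
      hG2.integrable_mul hreg.score_memLp
    rw [← integral_const_mul, ← integral_sub i1 (i2.const_mul _), ← integral_const_mul]
    refine integral_congr_ae ?_
    filter_upwards [hFS] with o ho
    rw [ho]; ring
  rw [e]
  have h' : (fun γ => thetaStar (Q γ)) = (fun γ => average weightedPsiStar (Q γ))
      / fun γ => average (fun b => armDiff b numT) (Q γ) := by
    ext γ; rw [thetaStar_eq]; rfl
  rw [h']
  refine h.congr_deriv ?_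
  rw [hreg.start, ← meanRateDiff_eq, hθ]
  field_simp

/-! ### The conditional law of the latent variables -/

section Latent

/-- `Pr{V ≤ c, Y(1) = 1} + Pr{V > c, Y(0) = 1}`. -/
def armOutcome (m : Measure (Bool × Bool × ℝ × Bool)) (c : ℝ) : ℝ :=
  m.real {l | l.2.2.1 ≤ c ∧ l.2.1 = true} + m.real {l | c < l.2.2.1 ∧ l.1 = true}

variable {m : Measure (Bool × Bool × ℝ × Bool)}

theorem measurableSet_latent_le (c : ℝ) :
    MeasurableSet {l : Bool × Bool × ℝ × Bool | l.2.2.1 ≤ c} :=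
  measurableSet_le (by fun_prop) measurable_const

theorem measurableSet_latent_lt (c : ℝ) :
    MeasurableSet {l : Bool × Bool × ℝ × Bool | c < l.2.2.1} :=
  measurableSet_lt measurable_const (by fun_prop)

theorem measurableSet_latent_Y0 (y : Bool) :
    MeasurableSet {l : Bool × Bool × ℝ × Bool | l.1 = y} :=
  measurable_fst (measurableSet_singleton y)

theorem measurableSet_latent_Y1 (y : Bool) :
    MeasurableSet {l : Bool × Bool × ℝ × Bool | l.2.1 = y} :=
  measurable_snd.fst (measurableSet_singleton y)

theorem measurableSet_latent_Z (z : Bool) :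
    MeasurableSet {l : Bool × Bool × ℝ × Bool | l.2.2.2 = z} :=
  measurable_snd.snd.snd (measurableSet_singleton z)

theorem real_inter_Z_of_indep {Y : Bool × Bool × ℝ × Bool → Bool × ℝ}
    (h : IndepFun Y (fun w => w.2.2.2) m) {A : Set (Bool × ℝ)} (hA : MeasurableSet A) (z : Bool) :
    m.real {l | Y l ∈ A ∧ l.2.2.2 = z} = m.real {l | Y l ∈ A} * m.real {l | l.2.2.2 = z} := by
  have := h.measure_inter_preimage_eq_mul A {z} hA (measurableSet_singleton z)
  rw [measureReal_def, measureReal_def, measureReal_def, ← ENNReal.toReal_mul]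
  exact congrArg ENNReal.toReal this

variable [IsProbabilityMeasure m]

theorem real_le_and_Z (h0 : IndepFun (fun w => (w.1, w.2.2.1)) (fun w => w.2.2.2) m) (c : ℝ)
    (z : Bool) : m.real {l | l.2.2.1 ≤ c ∧ l.2.2.2 = z}
      = m.real {l | l.2.2.1 ≤ c} * m.real {l | l.2.2.2 = z} :=
  real_inter_Z_of_indep h0 (A := {a | a.2 ≤ c}) (measurableSet_le measurable_snd measurable_const) z

theorem real_none_and_Z (h0 : IndepFun (fun w => (w.1, w.2.2.1)) (fun w => w.2.2.2) m) (c : ℝ)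
    (y z : Bool) : m.real {l | (c < l.2.2.1 ∧ l.1 = y) ∧ l.2.2.2 = z}
      = m.real {l | c < l.2.2.1 ∧ l.1 = y} * m.real {l | l.2.2.2 = z} :=
  real_inter_Z_of_indep h0 (A := {a | c < a.2 ∧ a.1 = y})
    ((measurableSet_lt measurable_const measurable_snd).inter
      (measurable_fst (measurableSet_singleton y))) z

/-- The outcome reads Y(1) only when V ≤ c and Y(0) only when V > c. Splitting there, independence
of Z from each pair (Y(t), V) separately is enough; the joint law of both potential outcomes is not
involved. -/
theorem real_outcome_and_Z (h0 : IndepFun (fun w => (w.1, w.2.2.1)) (fun w => w.2.2.2) m)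
    (h1 : IndepFun (fun w => (w.2.1, w.2.2.1)) (fun w => w.2.2.2) m) (c : ℝ) (z : Bool) :
    m.real {l | (if l.2.2.1 ≤ c then l.2.1 else l.1) = true ∧ l.2.2.2 = z}
      = armOutcome m c * m.real {l | l.2.2.2 = z} := by
  have e1 := real_inter_Z_of_indep h1 (A := {a | a.2 ≤ c ∧ a.1 = true})
    ((measurableSet_le measurable_snd measurable_const).inter
      (measurable_fst (measurableSet_singleton true))) z
  rw [armOutcome, add_mul, ← real_none_and_Z h0 c true z]
  refine Eq.trans ?_ (congrArg (· + _) e1)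
  rw [← measureReal_union]
  · congr 1
    ext l
    simp only [Set.mem_ofPred_eq, Set.mem_union]
    by_cases h : l.2.2.1 ≤ c
    · simp [h, not_lt.2 h]
    · simp [h, not_le.1 h]
  · refine Set.disjoint_left.2 fun l hl hl' => ?_
    exact absurd hl.1.1 (not_le.2 hl'.1.1)
  · exact ((measurableSet_latent_lt c).inter (measurableSet_latent_Y0 true)).inter
      (measurableSet_latent_Z z)

theorem real_le_of_uniform
    (hu : m.map (fun w => w.2.2.1) = volume.restrict (Set.Icc 0 1)) {c : ℝ} (h0 : 0 ≤ c)
    (h1 : c ≤ 1) : m.real {l | l.2.2.1 ≤ c} = c := by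
  have e : m {l | l.2.2.1 ≤ c} = m.map (fun w => w.2.2.1) (Set.Iic c) := by
    rw [Measure.map_apply (by fun_prop) measurableSet_Iic]; rfl
  rw [measureReal_def, e, hu, Measure.restrict_apply measurableSet_Iic]
  have : Set.Iic c ∩ Set.Icc (0 : ℝ) 1 = Set.Icc 0 c := by
    ext v
    simp only [Set.mem_inter_iff, Set.mem_Iic, Set.mem_Icc]
    constructor
    · rintro ⟨a, b, -⟩; exact ⟨b, a⟩
    · rintro ⟨a, b⟩; exact ⟨b, a, b.trans h1⟩
  rw [this, Real.volume_Icc, sub_zero, ENNReal.toReal_ofReal h0]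

theorem real_Ioc_and {a b : ℝ} (hab : a ≤ b) {p : Bool × Bool × ℝ × Bool → Prop}
    (hp : MeasurableSet {l | p l}) :
    m.real {l | l.2.2.1 ≤ b ∧ p l}
      = m.real {l | l.2.2.1 ≤ a ∧ p l} + m.real {l | (a < l.2.2.1 ∧ l.2.2.1 ≤ b) ∧ p l} := by
  rw [← measureReal_union]
  · congr 1
    ext l
    simp only [Set.mem_ofPred_eq, Set.mem_union]
    by_cases h : l.2.2.1 ≤ a
    · simp [h, not_lt.2 h, h.trans hab]
    · simp [h, not_le.1 h]
  · exact Set.disjoint_left.2 fun l hl hl' => absurd hl.1 (not_le.2 hl'.1.1)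
  · exact ((measurableSet_latent_lt a).inter (measurableSet_latent_le b)).inter hp

theorem real_lt_and {a b : ℝ} (hab : a ≤ b) {p : Bool × Bool × ℝ × Bool → Prop}
    (hp : MeasurableSet {l | p l}) :
    m.real {l | a < l.2.2.1 ∧ p l}
      = m.real {l | (a < l.2.2.1 ∧ l.2.2.1 ≤ b) ∧ p l} + m.real {l | b < l.2.2.1 ∧ p l} := by
  rw [← measureReal_union]
  · congr 1
    ext l
    simp only [Set.mem_ofPred_eq, Set.mem_union]
    by_cases h : l.2.2.1 ≤ b
    · simp [h, not_lt.2 h]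
    · simp [h, not_le.1 h, hab.trans_lt (not_le.1 h)]
  · exact Set.disjoint_left.2 fun l hl hl' => absurd hl.1.2 (not_le.2 hl'.1)
  · exact (measurableSet_latent_lt b).inter hp

theorem real_and_Y0_add (A : Set (Bool × Bool × ℝ × Bool)) :
    m.real {l | l ∈ A ∧ l.1 = true} + m.real {l | l ∈ A ∧ l.1 = false} = m.real A := by
  rw [← measureReal_inter_add_sdiff (s := A) (measurableSet_latent_Y0 true)]
  congr 2
  ext l
  simp

theorem real_Ioc (hu : m.map (fun w => w.2.2.1) = volume.restrict (Set.Icc 0 1)) {a b : ℝ}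
    (h0 : 0 ≤ a) (hab : a ≤ b) (h1 : b ≤ 1) :
    m.real {l | a < l.2.2.1 ∧ l.2.2.1 ≤ b} = b - a := by
  have h := real_Ioc_and (m := m) hab (p := fun _ => True) (by simp)
  simp only [and_true] at h
  rw [real_le_of_uniform hu (h0.trans hab) h1, real_le_of_uniform hu h0 (hab.trans h1)] at h
  linarith

/-- Moving the threshold from a to b changes the outcome only for V in (a, b], where Y(0) is
replaced by Y(1). -/
theorem armOutcome_sub {a b : ℝ} (hab : a ≤ b) :
    armOutcome m b - armOutcome m a
      = m.real {l | (a < l.2.2.1 ∧ l.2.2.1 ≤ b) ∧ l.2.1 = true}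
        - m.real {l | (a < l.2.2.1 ∧ l.2.2.1 ≤ b) ∧ l.1 = true} := by
  have h1 := real_Ioc_and (m := m) hab (measurableSet_latent_Y1 true)
  have h2 := real_lt_and (m := m) hab (measurableSet_latent_Y0 true)
  rw [armOutcome, armOutcome]
  linarith

theorem armOutcome_mono (hm : ∀ᵐ w ∂m, w.1 ≤ w.2.1) {a b : ℝ} (hab : a ≤ b) :
    armOutcome m a ≤ armOutcome m b := by
  rw [← sub_nonneg, armOutcome_sub hab, sub_nonneg, measureReal_def, measureReal_def]
  refine ENNReal.toReal_mono (measure_ne_top _ _) (measure_mono_ae ?_)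
  filter_upwards [hm] with l hl h
  obtain ⟨h1, h2⟩ : (a < l.2.2.1 ∧ l.2.2.1 ≤ b) ∧ l.1 = true := h
  refine ⟨h1, ?_⟩
  rw [h2] at hl
  exact top_le_iff.1 hl

/-- The gain among those with V in (a, b] cannot exceed their mass with Y(0) = 0. This makes θ̃* at
most 1. -/
theorem armOutcome_sub_le {a b : ℝ} (hab : a ≤ b) :
    armOutcome m b - armOutcome m a
      ≤ m.real {l | (a < l.2.2.1 ∧ l.2.2.1 ≤ b) ∧ l.1 = false} := by
  rw [armOutcome_sub hab, ← add_sub_cancel_left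
    (m.real {l | (a < l.2.2.1 ∧ l.2.2.1 ≤ b) ∧ l.1 = true})
    (m.real {l | (a < l.2.2.1 ∧ l.2.2.1 ≤ b) ∧ l.1 = false})]
  refine sub_le_sub_right ?_ _
  have := real_and_Y0_add (m := m) {l | a < l.2.2.1 ∧ l.2.2.1 ≤ b}
  refine le_trans (measureReal_mono fun l hl => hl.1) this.ge

/-- Anyone with V > a and Y(0) = 0 has outcome 0 at threshold a. Positivity of the denominator of
θ̃_L is thereby inherited from that of θ̃*. -/
theorem le_one_sub_armOutcome {a b : ℝ} :
    m.real {l | (a < l.2.2.1 ∧ l.2.2.1 ≤ b) ∧ l.1 = false} ≤ 1 - armOutcome m a := by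
  have h1 := real_and_Y0_add (m := m) {l | a < l.2.2.1}
  have h2 : m.real {l | l.2.2.1 ≤ a ∧ l.2.1 = true} ≤ m.real {l | l.2.2.1 ≤ a} :=
    measureReal_mono fun l hl => hl.1
  have h3 : m.real {l | l.2.2.1 ≤ a} + m.real {l | a < l.2.2.1} = 1 := by
    rw [← measureReal_union _ (measurableSet_latent_lt a)]
    · rw [show {l : Bool × Bool × ℝ × Bool | l.2.2.1 ≤ a} ∪ {l | a < l.2.2.1} = Set.univ from
        Set.eq_univ_of_forall fun l => le_or_gt l.2.2.1 a]
      simp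
    · exact Set.disjoint_left.2 fun l hl hl' =>
        absurd (show l.2.2.1 ≤ a from hl) (not_le.2 hl')
  have h4 : m.real {l | (a < l.2.2.1 ∧ l.2.2.1 ≤ b) ∧ l.1 = false}
      ≤ m.real {l | a < l.2.2.1 ∧ l.1 = false} := measureReal_mono fun l hl => ⟨hl.1.1, hl.2⟩
  simp only [Set.mem_ofPred_eq] at h1
  rw [armOutcome]
  linarith

end Latent

/-! ### The observed laws as images of the latent conditional law. -/

namespace Model

variable {Ω 𝒳 : Type*} [MeasurableSpace Ω] [MeasurableSpace 𝒳] (S : Model Ω 𝒳)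

/-- The latent variables `(Y(0), Y(1), V, Z)`. -/
def latent (ω : Ω) : Bool × Bool × ℝ × Bool := (S.Y0 ω, S.Y1 ω, S.V ω, S.Z ω)

theorem measurable_latent : Measurable S.latent :=
  S.measurable_Y0.prodMk (S.measurable_Y1.prodMk (S.measurable_V.prodMk S.measurable_Z))

instance : IsProbabilityMeasure S.covLaw :=
  Measure.isProbabilityMeasure_map S.measurable_X.aemeasurable

instance (x : 𝒳) : IsProbabilityMeasure (S.latentLaw x) := by
  unfold latentLaw; infer_instance

theorem measure_eq_lintegral_latentLaw {A : Set (𝒳 × Bool × Bool × ℝ × Bool)}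
    (hA : MeasurableSet A) :
    (S.P : Measure Ω) {ω | (S.X ω, S.latent ω) ∈ A}
      = ∫⁻ x, S.latentLaw x (Prod.mk x ⁻¹' A) ∂S.covLaw := by
  have h := compProd_map_condDistrib (mβ := ‹MeasurableSpace 𝒳›) (μ := (S.P : Measure Ω))
    (X := S.X) S.measurable_latent.aemeasurable
  have h1 : (S.P : Measure Ω) {ω | (S.X ω, S.latent ω) ∈ A}
      = ((S.P : Measure Ω).map fun ω => (S.X ω, S.latent ω)) A := by
    rw [Measure.map_apply (S.measurable_X.prodMk S.measurable_latent) hA]; rfl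
  rw [h1, ← h, Measure.compProd_apply hA]
  rfl

/-- The conditional law of a function of the covariates and the latent variables. -/
theorem ae_condKernel_eq_map {W : Type*} [MeasurableSpace W] [StandardBorelSpace W] [Nonempty W]
    [Countable W] {h : 𝒳 × Bool × Bool × ℝ × Bool → W} (hh : Measurable h)
    (Q : ProbabilityMeasure (𝒳 × W))
    (hQ : (Q : Measure (𝒳 × W))
      = (S.P : Measure Ω).map fun ω => (S.X ω, h (S.X ω, S.latent ω))) :
    (Q : Measure (𝒳 × W)).fst = S.covLaw ∧
    ∀ᵐ x ∂S.covLaw, (Q : Measure (𝒳 × W)).condKernel x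
      = (S.latentLaw x).map fun l => h (x, l) := by
  have hmeas : Measurable fun ω => h (S.X ω, S.latent ω) :=
    hh.comp (S.measurable_X.prodMk S.measurable_latent)
  have hfst : (Q : Measure (𝒳 × W)).fst = S.covLaw := by
    rw [hQ, Measure.fst_map_prodMk hmeas]; rfl
  refine ⟨hfst, ?_⟩
  -- W is countable, so it suffices to identify the conditional probability of each cell, by
  -- comparing integrals over measurable sets of covariates.
  have hw : ∀ w : W, ∀ᵐ x ∂S.covLaw, (Q : Measure (𝒳 × W)).condKernel x {w}
      = S.latentLaw x {l | h (x, l) = w} := by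
    intro w
    have hset : MeasurableSet {p : 𝒳 × Bool × Bool × ℝ × Bool | h p = w} :=
      hh (measurableSet_singleton w)
    refine ae_eq_of_forall_setLIntegral_eq_of_sigmaFinite
      (Kernel.measurable_coe _ (measurableSet_singleton w))
      (Kernel.measurable_kernel_prodMk_left (κ := condDistrib
        (fun ω => (S.Y0 ω, S.Y1 ω, S.V ω, S.Z ω)) S.X (S.P : Measure Ω)) hset) fun s hs _ => ?_
    rw [← hfst, Measure.setLIntegral_condKernel_eq_measure_prod hs (measurableSet_singleton w), hfst,
      hQ, Measure.map_apply (S.measurable_X.prodMk hmeas) (hs.prod (measurableSet_singleton w))]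
    have h1 := S.measure_eq_lintegral_latentLaw
      (A := {p | p.1 ∈ s ∧ h p = w}) ((measurable_fst hs).inter hset)
    refine Eq.trans h1 ?_
    rw [← lintegral_indicator hs]
    refine lintegral_congr fun x => ?_
    by_cases hx : x ∈ s
    · simp [hx, Set.preimage]
    · simp [hx, Set.preimage]
  filter_upwards [ae_all_iff.2 hw] with x hx
  refine Measure.ext_of_singleton fun w => ?_
  have hhx : Measurable fun l => h (x, l) := hh.comp measurable_prodMk_left
  rw [hx w, Measure.map_apply hhx (measurableSet_singleton w)]
  rfl

/-- The observed `(Z, T, Y)` as a function of the covariates and the latent variables. -/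
def observe (p : 𝒳 × Bool × Bool × ℝ × Bool) : Bool × Bool × Bool :=
  (p.2.2.2.2, decide (p.2.2.2.1 ≤ S.e p.2.2.2.2 p.1),
    if p.2.2.2.1 ≤ S.e p.2.2.2.2 p.1 then p.2.2.1 else p.2.1)

theorem measurable_observe : Measurable S.observe := by
  have he : Measurable fun p : 𝒳 × Bool × Bool × ℝ × Bool => S.e p.2.2.2.2 p.1 :=
    (measurable_from_prod_countable_right (f := fun p : Bool × 𝒳 => S.e p.1 p.2)
      S.measurable_e).comp (measurable_snd.snd.snd.snd.prodMk measurable_fst)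
  have hs : MeasurableSet {p : 𝒳 × Bool × Bool × ℝ × Bool | p.2.2.2.1 ≤ S.e p.2.2.2.2 p.1} :=
    measurableSet_le (by fun_prop) he
  refine Measurable.prodMk (by fun_prop) (Measurable.prodMk ?_ ?_)
  · refine measurable_to_bool ?_
    convert hs using 1
    ext p
    simp
  · exact Measurable.ite hs (by fun_prop) (by fun_prop)

theorem lawXZTY_eq_map : (S.lawXZTY : Measure (𝒳 × Bool × Bool × Bool))
    = (S.P : Measure Ω).map fun ω => (S.X ω, S.observe (S.X ω, S.latent ω)) := by
  have : (fun ω => (S.X ω, S.Z ω, S.T ω, S.Y ω))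
      = fun ω => (S.X ω, S.observe (S.X ω, S.latent ω)) := by
    ext ω <;> simp only [observe, latent, T, Y, decide_eq_true_eq] <;> congr
  rw [← this]
  rfl

theorem lawXZY_eq_map : (S.lawXZY : Measure (𝒳 × Bool × Bool))
    = (S.P : Measure Ω).map fun ω => (S.X ω, (S.observe (S.X ω, S.latent ω)).1,
      (S.observe (S.X ω, S.latent ω)).2.2) := by
  have : (fun ω => (S.X ω, S.Z ω, S.Y ω))
      = fun ω => (S.X ω, (S.observe (S.X ω, S.latent ω)).1,
      (S.observe (S.X ω, S.latent ω)).2.2) := by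
    ext ω <;> simp only [observe, latent, T, Y, decide_eq_true_eq]
    congr
  rw [← this]
  rfl

theorem fst_lawXZTY : (S.lawXZTY : Measure (𝒳 × Bool × Bool × Bool)).fst = S.covLaw :=
  (S.ae_condKernel_eq_map S.measurable_observe _ S.lawXZTY_eq_map).1

theorem fst_lawXZY : (S.lawXZY : Measure (𝒳 × Bool × Bool)).fst = S.covLaw :=
  (S.ae_condKernel_eq_map (h := fun p => ((S.observe p).1, (S.observe p).2.2))
    (S.measurable_observe.fst.prodMk S.measurable_observe.snd.snd) _ S.lawXZY_eq_map).1

end Model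

theorem pr_eq_of_condKernel_eq_map {𝒳 W L : Type*} [MeasurableSpace 𝒳] [MeasurableSpace W]
    [StandardBorelSpace W] [Nonempty W] [Countable W] [MeasurableSpace L]
    {Q : ProbabilityMeasure (𝒳 × W)} {x : 𝒳} {m : Measure L} {f : L → W} (hf : Measurable f)
    (h : (Q : Measure (𝒳 × W)).condKernel x = m.map f) (A B : Set W) :
    pr Q x A B = m.real {l | f l ∈ A ∧ f l ∈ B} / m.real {l | f l ∈ B} := by
  have hB : MeasurableSet B := B.to_countable.measurableSet
  have hA : MeasurableSet A := A.to_countable.measurableSet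
  rw [pr, h, measureReal_def, cond_apply hB, ENNReal.toReal_mul, ENNReal.toReal_inv,
    Measure.map_apply hf hB, Measure.map_apply hf (hB.inter hA), mul_comm, div_eq_mul_inv,
    Set.inter_comm]
  rfl

namespace Model

variable {Ω 𝒳 : Type*} [MeasurableSpace Ω] [MeasurableSpace 𝒳] (S : Model Ω 𝒳)

/-- The conditional probabilities of the observables, in terms of the latent variables. -/
theorem Assumptions.ae_pr_eq {S : Model Ω 𝒳} (hS : S.Assumptions) : ∀ᵐ x ∂S.covLaw, ∀ z,
    prZ S.lawXZTY z x = (S.latentLaw x).real {l | l.2.2.2 = z} ∧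
    prZ S.lawXZY z x = (S.latentLaw x).real {l | l.2.2.2 = z} ∧
    prT S.lawXZTY true z x = (S.latentLaw x).real {l | l.2.2.1 ≤ S.e z x} ∧
    prY S.lawXZTY z x = armOutcome (S.latentLaw x) (S.e z x) ∧
    prYL S.lawXZY z x = armOutcome (S.latentLaw x) (S.e z x) ∧
    prY0T0 S.lawXZTY z x = (S.latentLaw x).real {l | S.e z x < l.2.2.1 ∧ l.1 = false} := by
  have hk := (S.ae_condKernel_eq_map S.measurable_observe _ S.lawXZTY_eq_map).2
  have hm' : Measurable fun p => ((S.observe p).1, (S.observe p).2.2) :=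
    S.measurable_observe.fst.prodMk S.measurable_observe.snd.snd
  have hk' := (S.ae_condKernel_eq_map (h := fun p => ((S.observe p).1, (S.observe p).2.2)) hm' _
    S.lawXZY_eq_map).2
  filter_upwards [hk, hk', hS.exogenous0, hS.exogenous1, hS.instrument]
    with x h1 h2 hx0 hx1 hxz z
  set m := S.latentLaw x
  have hz := (hxz z).ne'
  have p1 := pr_eq_of_condKernel_eq_map (S.measurable_observe.comp measurable_prodMk_left) h1
  have p2 := pr_eq_of_condKernel_eq_map (hm'.comp measurable_prodMk_left) h2
  -- On the event Z = z the random threshold e(Z, x) is the constant e(z, x), so the independence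
  -- identities apply.
  have hout : ∀ l : Bool × Bool × ℝ × Bool,
      ((if l.2.2.1 ≤ S.e l.2.2.2 x then l.2.1 else l.1) = true ∧ l.2.2.2 = z) ↔
      ((if l.2.2.1 ≤ S.e z x then l.2.1 else l.1) = true ∧ l.2.2.2 = z) := by
    rintro l
    constructor <;> rintro ⟨a, rfl⟩ <;> exact ⟨a, rfl⟩
  refine ⟨?_, ?_, ?_, ?_, ?_, ?_⟩
  · rw [prZ, p1]; simp [observe]
  · rw [prZ, p2]; simp [observe]
  · rw [prT, p1, div_eq_iff (by simpa [observe] using hz)]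
    refine Eq.trans ?_ ((real_le_and_Z hx0 (S.e z x) z).trans ?_)
    · congr 1
      ext l
      simp only [observe, Set.mem_ofPred_eq, Function.comp, decide_eq_true_eq]
      constructor <;> rintro ⟨a, rfl⟩ <;> exact ⟨a, rfl⟩
    · rfl
  · rw [prY, p1, div_eq_iff (by simpa [observe] using hz)]
    refine Eq.trans ?_ ((real_outcome_and_Z hx0 hx1 (S.e z x) z).trans ?_)
    · congr 1
      ext l
      exact hout l
    · rfl
  · rw [prYL, p2, div_eq_iff (by simpa [observe] using hz)]
    refine Eq.trans ?_ ((real_outcome_and_Z hx0 hx1 (S.e z x) z).trans ?_)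
    · congr 1
      ext l
      exact hout l
    · rfl
  · rw [prY0T0, p1, div_eq_iff (by simpa [observe] using hz)]
    refine Eq.trans ?_ ((real_none_and_Z hx0 (S.e z x) false z).trans ?_)
    · congr 1
      ext l
      simp only [observe, Set.mem_ofPred_eq, Function.comp, decide_eq_false_iff_not, not_le]
      constructor
      · rintro ⟨⟨a, b⟩, rfl⟩
        rw [if_neg (not_le.2 b)] at a
        exact ⟨⟨b, a⟩, rfl⟩
      · rintro ⟨⟨b, a⟩, rfl⟩
        rw [if_neg (not_le.2 b)]
        exact ⟨⟨a, b⟩, rfl⟩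
    · rfl

end Model

/-! ### Compliers, and the order relations between observable probabilities. -/

namespace Model

variable {Ω 𝒳 : Type*} [MeasurableSpace Ω] [MeasurableSpace 𝒳] {S : Model Ω 𝒳}

theorem measurableSet_complier : MeasurableSet S.complier :=
  (measurableSet_lt ((S.measurable_e false).comp S.measurable_X) S.measurable_V).inter
    (measurableSet_le S.measurable_V ((S.measurable_e true).comp S.measurable_X))

theorem Assumptions.ae_latentLaw_complier (hS : S.Assumptions) : ∀ᵐ x ∂S.covLaw,
    (S.latentLaw x).real {l | S.e false x < l.2.2.1 ∧ l.2.2.1 ≤ S.e true x}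
      = S.e true x - S.e false x := by
  filter_upwards [hS.uniform, hS.rates] with x hu ⟨h0, h1, h2⟩
  exact real_Ioc hu h0 h1.le h2

theorem Assumptions.measure_complier_inter (hS : S.Assumptions) {s : Set 𝒳}
    (hs : MeasurableSet s) : (S.P : Measure Ω) (S.complier ∩ S.X ⁻¹' s)
      = ∫⁻ x in s, ENNReal.ofReal (S.e true x - S.e false x) ∂S.covLaw := by
  have hA : MeasurableSet {p : 𝒳 × Bool × Bool × ℝ × Bool |
      (S.e false p.1 < p.2.2.2.1 ∧ p.2.2.2.1 ≤ S.e true p.1) ∧ p.1 ∈ s} :=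
    ((measurableSet_lt ((S.measurable_e false).comp measurable_fst) (by fun_prop)).inter
      (measurableSet_le (by fun_prop) ((S.measurable_e true).comp measurable_fst))).inter
      (measurable_fst hs)
  refine (S.measure_eq_lintegral_latentLaw hA).trans ?_
  rw [← lintegral_indicator hs]
  refine lintegral_congr_ae ?_
  filter_upwards [hS.ae_latentLaw_complier] with x hx
  by_cases hxs : x ∈ s
  · simp only [Set.preimage, Set.mem_ofPred_eq, hxs, and_true, Set.indicator_of_mem]
    rw [← hx, ofReal_measureReal]
  · simp [Set.preimage, hxs]

theorem Assumptions.measure_complier (hS : S.Assumptions) : (S.P : Measure Ω) S.complier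
    = ∫⁻ x, ENNReal.ofReal (S.e true x - S.e false x) ∂S.covLaw := by
  simpa using hS.measure_complier_inter MeasurableSet.univ

theorem Assumptions.measure_complier_pos (hS : S.Assumptions) :
    0 < (S.P : Measure Ω) S.complier := by
  have hm : Measurable fun x => ENNReal.ofReal (S.e true x - S.e false x) :=
    ((S.measurable_e true).sub (S.measurable_e false)).ennreal_ofReal
  rw [hS.measure_complier, pos_iff_ne_zero, Ne, lintegral_eq_zero_iff hm]
  intro h
  have : ∀ᵐ x ∂S.covLaw, False := by
    filter_upwards [h, hS.rates] with x hx ⟨_, h1, _⟩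
    simp only [Pi.zero_apply, ENNReal.ofReal_eq_zero] at hx
    linarith
  exact absurd this (by simp [IsProbabilityMeasure.ne_zero])

/-- Bayes' rule: given X = x, V is uniform, so being a complier has probability e(1, x) - e(0, x).
-/
theorem Assumptions.complierCovLaw_eq (hS : S.Assumptions) : S.complierCovLaw
    = ((S.P : Measure Ω) S.complier)⁻¹ •
      S.covLaw.withDensity fun x => ENNReal.ofReal (S.e true x - S.e false x) := by
  ext s hs
  rw [complierCovLaw, Measure.map_apply S.measurable_X hs, cond_apply measurableSet_complier,
    Measure.smul_apply, withDensity_apply _ hs, hS.measure_complier_inter hs, smul_eq_mul]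

theorem complierCovLaw_absolutelyContinuous (hS : S.Assumptions) :
    S.complierCovLaw ≪ S.covLaw := by
  rw [hS.complierCovLaw_eq]
  exact (withDensity_absolutelyContinuous _ _).smul_left _

theorem Assumptions.integral_complierCovLaw (hS : S.Assumptions) (f : 𝒳 → ℝ) :
    ∫ x, f x ∂S.complierCovLaw = (∫ x, f x * (S.e true x - S.e false x) ∂S.covLaw)
      / ∫ x, (S.e true x - S.e false x) ∂S.covLaw := by
  have hm : Measurable fun x => S.e true x - S.e false x :=
    (S.measurable_e true).sub (S.measurable_e false)
  have hnn : ∀ᵐ x ∂S.covLaw, 0 ≤ S.e true x - S.e false x :=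
    hS.rates.mono fun x hx => by linarith [hx.2.1]
  rw [hS.complierCovLaw_eq, integral_smul_measure, ENNReal.toReal_inv, hS.measure_complier,
    integral_withDensity_eq_integral_toReal_smul hm.ennreal_ofReal (by simp),
    integral_eq_lintegral_of_nonneg_ae hnn hm.aestronglyMeasurable, smul_eq_mul, mul_comm,
    div_eq_mul_inv]
  congr 1
  refine integral_congr_ae ?_
  filter_upwards [hnn] with x hx
  rw [ENNReal.toReal_ofReal hx, smul_eq_mul, mul_comm]

/-- Order relations between the conditional probabilities of the observables. -/
theorem Assumptions.ae_observables (hS : S.Assumptions) : ∀ᵐ x ∂S.covLaw,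
    (∀ z, 0 < prZ S.lawXZTY z x) ∧ (∀ z, 0 < prZ S.lawXZY z x) ∧
    (∀ z, prT S.lawXZTY true z x = S.e z x) ∧
    (prYL S.lawXZY false x ≤ prYL S.lawXZY true x ∧ prYL S.lawXZY true x ≤ 1) ∧
    prY S.lawXZTY false x ≤ prY S.lawXZTY true x ∧
    prY S.lawXZTY true x - prY S.lawXZTY false x
      ≤ prY0T0 S.lawXZTY false x - prY0T0 S.lawXZTY true x ∧
    prY0T0 S.lawXZTY false x - prY0T0 S.lawXZTY true x
      = S.complierNonPersuaded x * (S.e true x - S.e false x) ∧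
    prY0T0 S.lawXZTY false x - prY0T0 S.lawXZTY true x ≤ 1 - prYL S.lawXZY false x := by
  filter_upwards [hS.ae_pr_eq, hS.uniform, hS.rates, hS.monotone, hS.instrument,
    hS.ae_latentLaw_complier] with x hx hu ⟨h0, h01, h1⟩ hmono hz hc
  -- In arm z the event Y = 0, T = 0 is V > e(z, x), Y(0) = 0; the difference of the arms leaves the
  -- compliers with Y(0) = 0.
  have hd : prY0T0 S.lawXZTY false x - prY0T0 S.lawXZTY true x = (S.latentLaw x).real
      {l | (S.e false x < l.2.2.1 ∧ l.2.2.1 ≤ S.e true x) ∧ l.1 = false} := by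
    rw [(hx false).2.2.2.2.2, (hx true).2.2.2.2.2,
      real_lt_and h01.le (measurableSet_latent_Y0 false), add_sub_cancel_right]
  have hcn : S.complierNonPersuaded x = (S.e true x - S.e false x)⁻¹ * (S.latentLaw x).real
      {l | (S.e false x < l.2.2.1 ∧ l.2.2.1 ≤ S.e true x) ∧ l.1 = false} := by
    have hm : MeasurableSet {l : Bool × Bool × ℝ × Bool |
        S.e false x < l.2.2.1 ∧ l.2.2.1 ≤ S.e true x} :=
      (measurableSet_latent_lt _).inter (measurableSet_latent_le _)
    rw [complierNonPersuaded, measureReal_def, cond_apply hm, ENNReal.toReal_mul,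
      ENNReal.toReal_inv, ← hc]
    rfl
  refine ⟨fun z => (hx z).1.symm ▸ hz z, fun z => (hx z).2.1.symm ▸ hz z, fun z => ?_, ?_, ?_, ?_,
    ?_, ?_⟩
  · rw [(hx z).2.2.1]
    cases z
    · exact real_le_of_uniform hu h0 (h01.le.trans h1)
    · exact real_le_of_uniform hu (h0.trans h01.le) h1
  · rw [(hx false).2.2.2.2.1, (hx true).2.2.2.2.1]
    exact ⟨armOutcome_mono hmono h01.le, sub_nonneg.1
      (measureReal_nonneg.trans (le_one_sub_armOutcome (m := S.latentLaw x) (b := S.e true x)))⟩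
  · rw [(hx false).2.2.2.1, (hx true).2.2.2.1]
    exact armOutcome_mono hmono h01.le
  · rw [hd, (hx false).2.2.2.1, (hx true).2.2.2.1]
    exact armOutcome_sub_le h01.le
  · rw [hd, hcn, mul_comm, mul_inv_cancel_left₀ (sub_pos.2 h01).ne']
  · rw [hd, (hx false).2.2.2.2.1]
    exact le_one_sub_armOutcome

end Model

/-- The extended inverse is ⊤ where f ≤ 0, whereas the real inverse is 0 at 0; almost sure
positivity makes the two agree. -/
theorem integrable_inv_of_lintegral_ne_top {𝒳 : Type*} [MeasurableSpace 𝒳] {μ : Measure 𝒳}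
    {f : 𝒳 → ℝ} (hf : Measurable f) (hpos : ∀ᵐ x ∂μ, 0 < f x)
    (h : ∫⁻ x, (ENNReal.ofReal (f x))⁻¹ ∂μ ≠ ⊤) : Integrable (fun x => (f x)⁻¹) μ := by
  refine ⟨hf.inv.aestronglyMeasurable, ?_⟩
  rw [hasFiniteIntegral_iff_ofReal (hpos.mono fun x hx => (inv_pos.2 hx).le)]
  refine lt_of_le_of_lt (lintegral_mono_ae ?_) h.lt_top
  filter_upwards [hpos] with x hx
  rw [ENNReal.ofReal_inv_of_pos hx]

theorem measurable_prZ {𝒳 U : Type*} [MeasurableSpace 𝒳] [MeasurableSpace U] [StandardBorelSpace U]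
    [Nonempty U] [Fintype U] (Q : ProbabilityMeasure (𝒳 × Bool × U)) (z : Bool) :
    Measurable (prZ Q z) := by
  rw [show prZ Q z = fun x => armMass (cellProb Q x) z from funext fun x => prZ_eq Q z x]
  exact measurable_comp_cellProb Q (measurable_armMass z)

end Persuasion

end

theorem theoremA4 {Ω 𝒳 : Type*} [MeasurableSpace Ω] [MeasurableSpace 𝒳]
    (S : Persuasion.Model Ω 𝒳) (hS : S.Assumptions)
    (he0 : ∃ c : ℝ, 0 < c ∧ ∀ᵐ x ∂S.covLaw, c ≤ S.e false x)
    (he1 : ∃ c : ℝ, c < 1 ∧ ∀ᵐ x ∂S.covLaw, S.e true x ≤ c)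
    (hnp : ∃ c : ℝ, 0 < c ∧ ∀ᵐ x ∂S.covLaw, c ≤ S.complierNonPersuaded x) :
    -- the thresholds are the exposure rates
    (∀ z, ∀ᵐ x ∂S.covLaw, Persuasion.prT S.lawXZTY true z x = S.e z x) ∧
    -- `θ_L` is well defined
    ((∀ᵐ x ∂S.covLaw, 0 < 1 - Persuasion.prYL S.lawXZY false x ∧
        Persuasion.condThetaL S.lawXZY x ∈ Set.Icc (0 : ℝ) 1) ∧
      Integrable (Persuasion.condThetaL S.lawXZY) S.covLaw) ∧
    -- `θ*` is well defined, and it is a functional of the law of the observables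
    ((∀ᵐ x ∂S.covLaw,
        0 < Persuasion.prY0T0 S.lawXZTY false x - Persuasion.prY0T0 S.lawXZTY true x ∧
        Persuasion.condThetaStar S.lawXZTY x ∈ Set.Icc (0 : ℝ) 1) ∧
      0 < (S.P : Measure Ω) S.complier ∧
      Integrable (Persuasion.condThetaStar S.lawXZTY) S.complierCovLaw ∧
      S.localRate = Persuasion.thetaStar S.lawXZTY) ∧
    -- `θ_L` is pathwise differentiable, with pathwise derivative `F_L`
    (∫⁻ x, (ENNReal.ofReal (Persuasion.prZ S.lawXZY true x * Persuasion.prZ S.lawXZY false x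
          * (1 - Persuasion.prYL S.lawXZY false x)))⁻¹ ∂S.covLaw ≠ ⊤ →
      ∀ M : ℝ, 1 ≤ M →
        Persuasion.IsPathwiseDerivative
          {Q | ∀ᵐ x ∂(Q : Measure (𝒳 × Bool × Bool)).fst, |Persuasion.condThetaL Q x| ≤ M}
          Persuasion.thetaL S.lawXZY (Persuasion.FL S.lawXZY)) ∧
    -- `θ*` is pathwise differentiable, with pathwise derivative `F*`
    (∫⁻ x, (ENNReal.ofReal
          (Persuasion.prZ S.lawXZTY true x * Persuasion.prZ S.lawXZTY false x))⁻¹ ∂S.covLaw ≠ ⊤ →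
      ∀ M : ℝ, 1 ≤ M →
        Persuasion.IsPathwiseDerivative
          {Q | ∀ᵐ x ∂(Q : Measure (𝒳 × Bool × Bool × Bool)).fst,
            |Persuasion.condThetaStar Q x| ≤ M}
          Persuasion.thetaStar S.lawXZTY (Persuasion.FStar S.lawXZTY)) := by
  open Persuasion in
  obtain ⟨c0, hc0, he0⟩ := he0
  obtain ⟨c1, hc1, he1⟩ := he1
  obtain ⟨c, hc, hnp⟩ := hnp
  have hobs := hS.ae_observables
  have hd : ∀ᵐ x ∂S.covLaw, 0 < prY0T0 S.lawXZTY false x - prY0T0 S.lawXZTY true x := by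
    filter_upwards [hobs, hnp, hS.rates] with x hx hcx hr
    rw [hx.2.2.2.2.2.2.1]
    exact mul_pos (hc.trans_le hcx) (sub_pos.2 hr.2.1)
  have hT : ∀ᵐ x ∂S.covLaw, ∀ z, prT S.lawXZTY true z x = S.e z x := hobs.mono fun x hx => hx.2.2.1
  have hr : ∀ᵐ x ∂S.covLaw, 0 < 1 - prYL S.lawXZY false x := by
    filter_upwards [hobs, hd] with x hx hdx
    exact hdx.trans_le hx.2.2.2.2.2.2.2
  have hL : ∀ᵐ x ∂S.covLaw, condThetaL S.lawXZY x ∈ Set.Icc (0 : ℝ) 1 := by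
    filter_upwards [hobs, hr] with x hx hrx
    obtain ⟨h1, h2⟩ := hx.2.2.2.1
    exact ⟨div_nonneg (by linarith) hrx.le, div_le_one_of_le₀ (by linarith) hrx.le⟩
  have hstar : ∀ᵐ x ∂S.covLaw, condThetaStar S.lawXZTY x ∈ Set.Icc (0 : ℝ) 1 := by
    filter_upwards [hobs, hd] with x hx hdx
    exact ⟨div_nonneg (sub_nonneg.2 hx.2.2.2.2.1) hdx.le,
      div_le_one_of_le₀ hx.2.2.2.2.2.1 hdx.le⟩
  have hLm : Measurable (condThetaL S.lawXZY) := by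
    rw [show condThetaL S.lawXZY = _ from funext (condThetaL_eq S.lawXZY)]
    exact measurable_comp_cellProb _ measurable_psiL
  have hstarm : Measurable (condThetaStar S.lawXZTY) := by
    rw [show condThetaStar S.lawXZTY = _ from funext (condThetaStar_eq S.lawXZTY)]
    exact measurable_comp_cellProb _ measurable_psiStar
  have hbd : ∀ a : ℝ, a ∈ Set.Icc (0 : ℝ) 1 → ‖a‖ ≤ 1 := fun a ha => by
    rw [Real.norm_of_nonneg ha.1]; exact ha.2
  have hBeq : meanRateDiff S.lawXZTY = ∫ x, (S.e true x - S.e false x) ∂S.covLaw := by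
    rw [meanRateDiff, S.fst_lawXZTY]
    exact integral_congr_ae (hT.mono fun x hx => by simp only [hx])
  refine ⟨fun z => hT.mono fun x hx => hx z, ⟨hr.and hL,
    Integrable.of_bound hLm.aestronglyMeasurable 1 (hL.mono fun x => hbd _)⟩,
    ⟨hd.and hstar, hS.measure_complier_pos, ?_, ?_⟩, fun hfin M hM => ?_, fun hfin M hM => ?_⟩
  · have : IsFiniteMeasure S.complierCovLaw := by
      rw [Persuasion.Model.complierCovLaw]; infer_instance
    exact Integrable.of_bound hstarm.aestronglyMeasurable 1
      ((Persuasion.Model.complierCovLaw_absolutelyContinuous hS).ae_le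
        (hstar.mono fun x => hbd _))
  · rw [Persuasion.Model.localRate, hS.integral_complierCovLaw, thetaStar, hBeq, S.fst_lawXZTY]
    congr 1
    exact integral_congr_ae (hT.mono fun x hx => by simp only [hx])
  · have hpos : ∀ᵐ x ∂S.covLaw, 0 < prZ S.lawXZY true x * prZ S.lawXZY false x
        * (1 - prYL S.lawXZY false x) := by
      filter_upwards [hobs, hr] with x hx hrx
      exact mul_pos (mul_pos (hx.2.1 _) (hx.2.1 _)) hrx
    have hm : Measurable (prYL S.lawXZY false) := by
      rw [show prYL S.lawXZY false = _ from funext (prYL_eq S.lawXZY false)]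
      exact measurable_comp_cellProb _ (measurable_armMean false num)
    have hω := integrable_inv_of_lintegral_ne_top (((measurable_prZ S.lawXZY true).mul
      (measurable_prZ S.lawXZY false)).mul (measurable_const.sub hm)) hpos hfin
    rw [← S.fst_lawXZY] at hobs hr hω
    exact isPathwiseDerivative_thetaL S.lawXZY (hobs.mono fun x hx => hx.2.1) hr
      (hobs.mono fun x hx => hx.2.2.2.1.1) hω hM
  · have hpos : ∀ᵐ x ∂S.covLaw, 0 < prZ S.lawXZTY true x * prZ S.lawXZTY false x :=
      hobs.mono fun x hx => mul_pos (hx.1 _) (hx.1 _)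
    have hω := integrable_inv_of_lintegral_ne_top ((measurable_prZ S.lawXZTY true).mul
      (measurable_prZ S.lawXZTY false)) hpos hfin
    have hB : meanRateDiff S.lawXZTY ≠ 0 := by
      rw [hBeq]
      refine ne_of_gt ?_
      rw [integral_eq_lintegral_of_nonneg_ae (hS.rates.mono fun x hx => (sub_pos.2 hx.2.1).le)
        ((S.measurable_e true).sub (S.measurable_e false)).aestronglyMeasurable,
        ← hS.measure_complier]
      exact ENNReal.toReal_pos hS.measure_complier_pos.ne' (measure_ne_top _ _)
    -- Strictly interior exposure rates make the conditional probabilities given T in F₁*, …, F₆*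
    -- genuine ones, as the algebraic simplification of F* requires.
    have hTlt : ∀ᵐ x ∂S.covLaw, ∀ z, 0 < prT S.lawXZTY true z x ∧ prT S.lawXZTY true z x < 1 := by
      filter_upwards [hT, he0, he1, hS.rates] with x hx h0 h1 ⟨_, h01, _⟩ z
      rw [hx]
      cases z <;> constructor <;> linarith
    have hΔ : ∀ᵐ x ∂S.covLaw, prT S.lawXZTY true false x ≤ prT S.lawXZTY true true x := by
      filter_upwards [hT, hS.rates] with x hx ⟨_, h01, _⟩
      rw [hx, hx]; exact h01.le
    -- The denominator of θ̃* is the rate difference times the share of compliers with Y(0) = 0,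
    -- which is at least c; hence R = 1/c.
    have hR : ∀ᵐ x ∂S.covLaw, prT S.lawXZTY true true x - prT S.lawXZTY true false x
        ≤ c⁻¹ * (prY0T0 S.lawXZTY false x - prY0T0 S.lawXZTY true x) := by
      filter_upwards [hobs, hT, hnp, hS.rates] with x hx hTx hcx ⟨_, h01, _⟩
      rw [hTx, hTx, hx.2.2.2.2.2.2.1, ← mul_assoc]
      refine le_mul_of_one_le_left (sub_nonneg.2 h01.le) ?_
      rw [inv_mul_eq_div, one_le_div hc]
      exact hcx
    rw [← S.fst_lawXZTY] at hobs hd hstar hω hTlt hΔ hR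
    exact isPathwiseDerivative_thetaStar S.lawXZTY (hobs.mono fun x hx => hx.1) hTlt hd hstar hΔ hR
      hB hω hM
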